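/- Let $n\ge 1$. Let $\langle x,y\rangle=\sum_{i=1}^{2n}x^iy^i-x^{2n+1}y^{2n+1}$ on $\mathbb R^{2n+1}$, extended complex bilinearly to $\mathbb C^{2n+1}$; write $\|v\|^2=\langle v,\bar v\rangle$. Let $S^{2n}_1=\{x\in\mathbb R^{2n+1}:\langle x,x\rangle=1\}$ and let $SO(2n,1)$ be the group of real matrices of determinant $1$ preserving $\langle\cdot,\cdot\rangle$. Let $T=\operatorname{diag}\{1,SO(2),\dots,SO(2),SO(1,1)\}\subset SO(2n,1)$, with Lie algebra $\mathfrak t$ consisting of the matrices $$\operatorname{diag}\Big\{0,\begin{pmatrix}0&a_1\\-a_1&0\end{pmatrix},\dots,\begin{pmatrix}0&a_{n-1}\\-a_{n-1}&0\end{pmatrix},\begin{pmatrix}0&a_n\\a_n&0\end{pmatrix}\Big\},\qquad a_k\in\mathbb R,$$ and let $\tilde a_k$ denote the linear functional with value $a_k$ on this matrix. Take as simple roots of $\mathfrak{so}(2n,1,\mathbb C)$ the roots $\alpha_1=i\tilde a_1$, $\alpha_k=i\tilde a_k-i\tilde a_{k-1}$ $(1<k<n)$, $\alpha_n=\tilde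 a_n-i\tilde a_{n-1}$, with lowest root $\alpha_0=-\tilde a_n-i\tilde a_{n-1}$ (for $n=1$: $\alpha_1=\tilde a_1$, $\alpha_0=-\tilde a_1$). With $[j,k]=E_{kj}-E_{jk}$ for $j<k\le 2n$ and $[j,2n+1]=E_{2n+1,j}+E_{j,2n+1}$, where $E_{jk}$ are the elementary matrices, fix the root vectors $$R_{\alpha_1}=[1,2]+i[1,3]\ (n\ge2),\qquad R_{\alpha_k}=[2k-2,2k]+i[2k-2,2k+1]-i[2k-1,2k]+[2k-1,2k+1]\ (1<k<n),$$ $$R_{\alpha_n}=[2n-2,2n]+[2n-2,2n+1]-i[2n-1,2n]-i[2n-1,2n+1]\ (n\ge2),$$ $$R_{\alpha_0}=[2n-2,2n]-[2n-2,2n+1]-i[2n-1,2n]+i[2n-1,2n+1]\ (n\ge2),$$ and, for $n=1$, $R_{\alpha_1}=[1,2]+[1,3]$, $R_{\alpha_0}=[1,2]-[1,3]$. A smooth map $f:\mathbb C\to S^{2n}_1$ is harmonic if $f_{z\bar z}$ is everywhere a multiple of $f$. It is superconformal if $\langle\partial_z^af,\partial_z^bf\rangle\equiv0$ for all $a,b\ge0$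 with $1\le a+b\le 2n-1$, and $\langle\partial_z^nf,\partial_z^nf\rangle\not\equiv0$. Its harmonic sequence is $f_0=f$, $f_{j+1}=\partial_zf_j-\frac{\langle\partial_zf_j,\bar f_j\rangle}{\|f_j\|^2}f_j$ wherever $\|f_j\|^2\ne0$, extended by continuity to the zeros of $f_j$; it is everywhere defined if this yields $f_1,\dots,f_n$ on all of $\mathbb C$, so that in particular no $f_j$, $j<n$, is null but non-zero at some point. A cyclic primitive frame of $f$ over an open set $U\subset\mathbb C$ is a smooth map $F:U\to SO(2n,1)$ with $Fe_1=f$ such that $F^{-1}F_z=A+\sum_{j=0}^nc_jR_{\alpha_j}$ with $A$ valued in $\mathfrak t^{\mathbb C}$ and functions $c_j:U\to\mathbb C$ (the root coefficients of $F$) that are all non-zero at some point of $U$. We say that the product $c_0c_1^2\cdots c_{n-1}^2c_n$ is constant, equal to $K\in\mathbb C$, if it equals $K$ on $U$ for every cyclic primitive frame of $f$ over any open $U\subset\mathbb C$. A lift of $f$ is a smooth map $\psi:\mathbb C\to SO(2n,1)/T$ whose composition with $gT\mapsto ge_1$ is $f$. A Toda frame of $\psi$ with respect to $W$ is a smooth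 map $F:\mathbb C\to SO(2n,1)$ with $\psi=FT$ such that, for some smooth $\Omega:\mathbb C\to i\mathfrak t$, $$F^{-1}F_z=\Omega_z+\operatorname{Ad}_{\exp\Omega}W .$$ Let $f:\mathbb C\to S^{2n}_1$ be a superconformal harmonic map with everywhere defined harmonic sequence $f_1,\dots,f_n$. (1) Suppose that $c_0c_1^2\cdots c_{n-1}^2c_n$ is constant, equal to $K$. Then $f$ has a lift $\psi:\mathbb C\to SO(2n,1)/T$ that possesses a Toda frame with respect to every cyclic element $W=\sum_{j=0}^nr_jR_{\alpha_j}$ (all $r_j\in\mathbb C\setminus\{0\}$) normalised by $r_0r_1^2\cdots r_{n-1}^2r_n=K$. Moreover, this $\psi$ is $\Lambda$-periodic for every lattice $\Lambda\subset\mathbb C$ with respect to which $f$ is periodic. (2) If $f$ is periodic with respect to some lattice $\Lambda\subset\mathbb C$, then $c_0c_1^2\cdots c_{n-1}^2c_n$ is automatically constant, so that (1) applies and the lift is $\Lambda$-periodic. -/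

import Mathlib

open Complex Matrix
open scoped ContDiff

/-- Real column vectors of length `2n+1`, the underlying space of `ℝ^{2n,1}`.
The standard basis vector `e_k` (`1 ≤ k ≤ 2n+1`) has index `k - 1`. -/
abbrev RVec (n : ℕ) : Type := Fin (2 * n + 1) → ℝ

/-- The complexification `ℂ^{2n+1}` of `ℝ^{2n,1}`. -/
abbrev CVec (n : ℕ) : Type := Fin (2 * n + 1) → ℂ

/-- Complex matrices of size `2n+1`. -/
abbrev CMat (n : ℕ) : Type := Matrix (Fin (2 * n + 1)) (Fin (2 * n + 1)) ℂ

/-- Diagonal entries of `υ = diag(1, …, 1, -1)`. -/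
def lorentzSign (n : ℕ) (i : Fin (2 * n + 1)) : ℝ := if i.val = 2 * n then -1 else 1

/-- The matrix `υ = diag(1, …, 1, -1)` of the Minkowski inner product. -/
def upsilon (n : ℕ) : Matrix (Fin (2 * n + 1)) (Fin (2 * n + 1)) ℝ :=
  Matrix.diagonal (lorentzSign n)

/-- The complex bilinear extension of the Minkowski inner product. -/
def bil {n : ℕ} (x y : CVec n) : ℂ := ∑ i, (lorentzSign n i : ℂ) * x i * y i

/-- Complex conjugation of vectors. -/
def conjVec {n : ℕ} (x : CVec n) : CVec n := fun i => (starRingEnd ℂ) (x i)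

/-- The Hermitian square `‖x‖² = ⟨x, x̄⟩`, of either sign. -/
def hermSq {n : ℕ} (x : CVec n) : ℂ := bil x (conjVec x)

/-- A map into `ℝ^{2n,1}`, seen as a map into the complexification. -/
def complexify {n : ℕ} (f : ℂ → RVec n) : ℂ → CVec n := fun z i => (f z i : ℂ)

/-- De Sitter space `S^{2n}_1`, the unit sphere of `ℝ^{2n,1}`. -/
def deSitter (n : ℕ) : Set (RVec n) := {x | ∑ i, lorentzSign n i * x i * x i = 1}

/-- The Wirtinger derivative `∂_z = (∂_x - i ∂_y) / 2`. -/
noncomputable def dz (g : ℂ → ℂ) (z : ℂ) : ℂ :=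
  (fderiv ℝ g z 1 - I * fderiv ℝ g z I) / 2

/-- The Wirtinger derivative `∂_{z̄} = (∂_x + i ∂_y) / 2`. -/
noncomputable def dzbar (g : ℂ → ℂ) (z : ℂ) : ℂ :=
  (fderiv ℝ g z 1 + I * fderiv ℝ g z I) / 2

/-- `∂_z` of vector valued maps, componentwise. -/
noncomputable def dzVec {n : ℕ} (g : ℂ → CVec n) : ℂ → CVec n :=
  fun z i => dz (fun w => g w i) z

/-- `∂_{z̄}` of vector valued maps, componentwise. -/
noncomputable def dzbarVec {n : ℕ} (g : ℂ → CVec n) : ℂ → CVec n :=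
  fun z i => dzbar (fun w => g w i) z

/-- `∂_z` of matrix valued maps, entrywise. -/
noncomputable def dzMat {n : ℕ} (g : ℂ → CMat n) : ℂ → CMat n :=
  fun z => Matrix.of fun a b => dz (fun w => g w a b) z

/-- Smooth harmonic maps `f : ℂ → S^{2n}_1`: the tension field of `f` is (up to the factor 4) the
component of `f_{z z̄}` tangent to `S^{2n}_1`, the orthogonal complement of `f`. -/
structure IsHarmonicMap {n : ℕ} (f : ℂ → RVec n) : Prop where
  smooth : ContDiff ℝ ∞ f
  mem_deSitter : ∀ z, f z ∈ deSitter n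
  tension : ∀ z, dzbarVec (dzVec (complexify f)) z =
    bil (dzbarVec (dzVec (complexify f)) z) (complexify f z) • complexify f z

/-- `f` has isotropy order `r`. -/
def HasIsotropyOrder {n : ℕ} (f : ℂ → RVec n) (r : ℕ) : Prop :=
  (∀ a b : ℕ, 1 ≤ a + b → a + b ≤ 2 * r + 1 → ∀ z,
    bil (dzVec^[a] (complexify f) z) (dzVec^[b] (complexify f) z) = 0) ∧
  ∃ z, bil (dzVec^[r + 1] (complexify f) z) (dzVec^[r + 1] (complexify f) z) ≠ 0

/-- Superconformal: the penultimate isotropy order `n - 1` (used for `n ≥ 1`). -/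
def IsSuperconformal {n : ℕ} (f : ℂ → RVec n) : Prop := HasIsotropyOrder f (n - 1)

/-- The entries `f_1, …, f_n` of the harmonic sequence of `f` are defined on all of `ℂ`:
`f_0 = f`, and `f_{j+1} = ∂_z f_j - (⟨∂_z f_j, f̄_j⟩ / ‖f_j‖²) f_j` wherever `‖f_j‖² ≠ 0`, extended
by continuity to the zeros of `f_j`; there is no point at which some `f_j`, `j < n`,
is null but not zero (at such a point the sequence cannot be continued). -/
def HarmonicSequenceEverywhereDefined {n : ℕ} (f : ℂ → RVec n) : Prop :=
  ∃ s : ℕ → ℂ → CVec n,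
    s 0 = complexify f ∧
    ∀ j < n,
      Continuous (s (j + 1)) ∧
      ∀ z,
        (hermSq (s j z) = 0 → s j z = 0) ∧
        (hermSq (s j z) ≠ 0 →
          s (j + 1) z = dzVec (s j) z -
            (bil (dzVec (s j) z) (conjVec (s j z)) / hermSq (s j z)) • s j z)

/-- The group `SO(2n,1)` of real matrices with `gᵗ υ g = υ` and `det g = 1`. -/
def SOLorentz (n : ℕ) : Subgroup (Matrix.SpecialLinearGroup (Fin (2 * n + 1)) ℝ) where
  carrier := {g | (g : Matrix _ _ ℝ)ᵀ * upsilon n * (g : Matrix _ _ ℝ) = upsilon n}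
  mul_mem' := by
    intro g h hg hh
    simp only [Set.mem_ofPred_eq, Matrix.SpecialLinearGroup.coe_mul, Matrix.transpose_mul] at *
    calc _ = (h : Matrix _ _ ℝ)ᵀ * ((g : Matrix _ _ ℝ)ᵀ * upsilon n * (g : Matrix _ _ ℝ)) *
          (h : Matrix _ _ ℝ) := by simp only [Matrix.mul_assoc]
      _ = _ := by rw [hg, hh]
  one_mem' := by simp
  inv_mem' := by
    intro g hg
    simp only [Set.mem_ofPred_eq] at *
    have h1 : (g : Matrix _ _ ℝ) * (g⁻¹).1 = 1 := by
      rw [← Matrix.SpecialLinearGroup.coe_mul, mul_inv_cancel, Matrix.SpecialLinearGroup.coe_one]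
    have h2 : (g⁻¹).1ᵀ * (g : Matrix _ _ ℝ)ᵀ = 1 := by
      rw [← Matrix.transpose_mul, h1, Matrix.transpose_one]
    generalize (g⁻¹).1 = k at *
    calc kᵀ * upsilon n * k
        = kᵀ * ((g : Matrix _ _ ℝ)ᵀ * upsilon n * (g : Matrix _ _ ℝ)) * k := by rw [hg]
      _ = (kᵀ * (g : Matrix _ _ ℝ)ᵀ) * upsilon n * ((g : Matrix _ _ ℝ) * k) := by
          simp only [Matrix.mul_assoc]
      _ = upsilon n := by rw [h1, h2]; simp

/-- The underlying real matrix of an element of `SO(2n,1)`. -/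
def soMat {n : ℕ} (g : SOLorentz n) : Matrix (Fin (2 * n + 1)) (Fin (2 * n + 1)) ℝ :=
  (g : Matrix.SpecialLinearGroup (Fin (2 * n + 1)) ℝ).1

/-- The underlying matrix of an element of `SO(2n,1)`, with complex entries. -/
def soCMat {n : ℕ} (g : SOLorentz n) : CMat n := (soMat g).map (fun x : ℝ => (x : ℂ))

theorem soCMat_mul {n : ℕ} (g h : SOLorentz n) : soCMat (g * h) = soCMat g * soCMat h := by
  ext a b
  simp [soCMat, soMat, Matrix.mul_apply]

theorem soCMat_one {n : ℕ} : soCMat (1 : SOLorentz n) = 1 := by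
  ext a b
  by_cases hab : a = b <;> simp [soCMat, soMat, Matrix.one_apply, hab]

/-- `[j,k] = E_{kj} - E_{jk}` if `k ≠ 2n+1`, and `E_{kj} + E_{jk}` if `k = 2n+1`, for
`1 ≤ j < k ≤ 2n+1`, where `E_{jk}` is the elementary matrix. -/
def brk (n j k : ℕ) : CMat n := Matrix.of fun a b =>
  if a.val + 1 = k ∧ b.val + 1 = j then 1
  else if a.val + 1 = j ∧ b.val + 1 = k then (if k = 2 * n + 1 then 1 else -1)
  else 0

/-- The element `diag{0, (0 a₁; -a₁ 0), …, (0 a_{n-1}; -a_{n-1} 0), (0 a_n; a_n 0)}` (here `a_k` is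
`a ⟨k-1, _⟩`). These are the elements of `𝔱` for real `a_k`, of `𝔱^ℂ` for complex `a_k`, and of
`i𝔱` for purely imaginary `a_k`. -/
def torusMat (n : ℕ) (a : Fin n → ℂ) : CMat n :=
  ∑ k : Fin n, a k •
    (if k.val + 1 = n then brk n (2 * n) (2 * n + 1)
      else -brk n (2 * (k.val + 1)) (2 * (k.val + 1) + 1))

/-- The Cartan subgroup `T = diag{1, SO(2), …, SO(2), SO(1,1)}` of `SO(2n,1)`: the matrices that
fix `e_1` and commute with all elements of `𝔱`. -/
def cartanT (n : ℕ) : Subgroup (SOLorentz n) where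
  carrier := {g | soCMat g *ᵥ Pi.single 0 1 = Pi.single 0 1 ∧
    ∀ a : Fin n → ℝ, soCMat g * torusMat n (fun k => (a k : ℂ)) =
      torusMat n (fun k => (a k : ℂ)) * soCMat g}
  mul_mem' := by
    intro g h hg hh
    have e := soCMat_mul g h
    simp only [Set.mem_ofPred_eq, e] at *
    refine ⟨?_, fun a => ?_⟩
    · rw [← Matrix.mulVec_mulVec, hh.1, hg.1]
    · rw [Matrix.mul_assoc, hh.2, ← Matrix.mul_assoc, hg.2, Matrix.mul_assoc]
  one_mem' := by
    simp only [Set.mem_ofPred_eq, soCMat_one, Matrix.one_mulVec, one_mul, mul_one, implies_true,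
      and_self]
  inv_mem' := by
    intro g hg
    have h1 : soCMat (g⁻¹) * soCMat g = 1 := by rw [← soCMat_mul, inv_mul_cancel, soCMat_one]
    have h2 : soCMat g * soCMat (g⁻¹) = 1 := by rw [← soCMat_mul, mul_inv_cancel, soCMat_one]
    simp only [Set.mem_ofPred_eq] at *
    refine ⟨?_, fun a => ?_⟩
    · conv_lhs => rw [← hg.1]
      rw [Matrix.mulVec_mulVec, h1, Matrix.one_mulVec]
    · calc soCMat (g⁻¹) * torusMat n (fun k => (a k : ℂ))
          = soCMat (g⁻¹) * (torusMat n (fun k => (a k : ℂ)) * soCMat g) * soCMat (g⁻¹) := by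
            rw [Matrix.mul_assoc, Matrix.mul_assoc, h2, Matrix.mul_one]
        _ = torusMat n (fun k => (a k : ℂ)) * soCMat (g⁻¹) := by
            rw [← hg.2, ← Matrix.mul_assoc, h1, Matrix.one_mul]

/-- The full isotropic flag manifold `SO(2n,1)/T`. -/
abbrev FlagManifold (n : ℕ) : Type := SOLorentz n ⧸ cartanT n

/-- `F : ℂ → SO(2n,1)` is smooth on `U`. -/
def SmoothFrameOn {n : ℕ} (U : Set ℂ) (F : ℂ → SOLorentz n) : Prop :=
  ∀ a b, ContDiffOn ℝ ∞ (fun z => soMat (F z) a b) U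

/-- `ψ : ℂ → SO(2n,1)/T` is smooth: it has smooth lifts to `SO(2n,1)` near every point. -/
def IsSmoothFlagMap {n : ℕ} (ψ : ℂ → FlagManifold n) : Prop :=
  ∀ z₀, ∃ U : Set ℂ, IsOpen U ∧ z₀ ∈ U ∧ ∃ F : ℂ → SOLorentz n,
    SmoothFrameOn U F ∧ ∀ z ∈ U, (F z : FlagManifold n) = ψ z

/-- `ψ : ℂ → SO(2n,1)/T` is a lift of `f : ℂ → S^{2n}_1`, with respect to the projection
`gT ↦ g e_1`. -/
def IsLiftOf {n : ℕ} (ψ : ℂ → FlagManifold n) (f : ℂ → RVec n) : Prop :=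
  ∀ z, ∀ g : SOLorentz n, (g : FlagManifold n) = ψ z → soMat g *ᵥ Pi.single 0 1 = f z

/-- `F⁻¹ F_z`. -/
noncomputable def logDz {n : ℕ} (F : ℂ → SOLorentz n) (z : ℂ) : CMat n :=
  soCMat ((F z)⁻¹) * dzMat (fun w => soCMat (F w)) z

/-- The root vectors `R_{α_j}`, `0 ≤ j ≤ n`, of the simple roots `α_1 = i ã_1`,
`α_k = i ã_k - i ã_{k-1}` (`1 < k < n`), `α_n = ã_n - i ã_{n-1}` and of the lowest root
`α_0 = -ã_n - i ã_{n-1}`; for `n = 1` these are `α_1 = ã_1` and `α_0 = -ã_1`. Here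
`ã_k (torusMat n a) = a_k`. -/
noncomputable def rootVec (n j : ℕ) : CMat n :=
  if j = 0 then
    if n = 1 then brk n 1 2 - brk n 1 3
    else brk n (2 * n - 2) (2 * n) - brk n (2 * n - 2) (2 * n + 1)
      - I • brk n (2 * n - 1) (2 * n) + I • brk n (2 * n - 1) (2 * n + 1)
  else if j = n then
    if n = 1 then brk n 1 2 + brk n 1 3
    else brk n (2 * n - 2) (2 * n) + brk n (2 * n - 2) (2 * n + 1)
      - I • brk n (2 * n - 1) (2 * n) - I • brk n (2 * n - 1) (2 * n + 1)
  else if j = 1 then brk n 1 2 + I • brk n 1 3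
  else brk n (2 * j - 2) (2 * j) + I • brk n (2 * j - 2) (2 * j + 1)
      - I • brk n (2 * j - 1) (2 * j) + brk n (2 * j - 1) (2 * j + 1)

/-- `∑_{j=0}^n c_j R_{α_j}`. -/
noncomputable def rootSum (n : ℕ) (c : ℕ → ℂ) : CMat n :=
  ∑ j ∈ Finset.range (n + 1), c j • rootVec n j

/-- `∑_{j=0}^n c_j R_{α_j}` is cyclic: all its components in the root spaces are non-zero. -/
def IsCyclicCoeff (n : ℕ) (c : ℕ → ℂ) : Prop := ∀ j ≤ n, c j ≠ 0

/-- `c_0 c_1² ⋯ c_{n-1}² c_n`. -/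
def rootProduct (n : ℕ) (c : ℕ → ℂ) : ℂ := c 0 * (∏ j ∈ Finset.Ico 1 n, c j ^ 2) * c n

/-- `F : U → SO(2n,1)` is a cyclic primitive frame of the harmonic map `f` over the open set `U`,
with root coefficients `c_j`: `F e_1 = f`, `F⁻¹ F_z` takes values in `𝔱^ℂ ⊕ ⨁_j 𝒢^{α_j}`, with
component `∑_j c_j R_{α_j}` in the second summand, and the latter is cyclic at some point. -/
structure IsCyclicPrimitiveFrame {n : ℕ} (U : Set ℂ) (f : ℂ → RVec n) (F : ℂ → SOLorentz n)
    (c : ℂ → ℕ → ℂ) : Prop where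
  isOpen : IsOpen U
  smooth : SmoothFrameOn U F
  frame : ∀ z ∈ U, soMat (F z) *ᵥ Pi.single 0 1 = f z
  primitive : ∀ z ∈ U, ∃ a : Fin n → ℂ, logDz F z = torusMat n a + rootSum n (c z)
  cyclic : ∃ z ∈ U, IsCyclicCoeff n (c z)

/-- The product `c_0 c_1² ⋯ c_{n-1}² c_n` of the root coefficients of `f` is constant, with value
`K`: this is its value at every point and for every cyclic primitive frame of `f` around it.
The frames need not be global; that a global one exists is not presupposed. -/
def RootProductConstant {n : ℕ} (f : ℂ → RVec n) (K : ℂ) : Prop :=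
  ∀ (U : Set ℂ) (F : ℂ → SOLorentz n) (c : ℂ → ℕ → ℂ),
    IsCyclicPrimitiveFrame U f F c → ∀ z ∈ U, rootProduct n (c z) = K

/-- `F` is a Toda frame of `ψ` with respect to `W`: a smooth lift `F : ℂ → SO(2n,1)` of `ψ` with
`F⁻¹ F_z = Ω_z + Ad_{exp Ω} W` for some smooth `Ω : ℂ → i𝔱`. -/
def IsTodaFrame {n : ℕ} (ψ : ℂ → FlagManifold n) (W : CMat n) (F : ℂ → SOLorentz n) : Prop :=
  SmoothFrameOn Set.univ F ∧
  (∀ z, (F z : FlagManifold n) = ψ z) ∧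
  ∃ (u : ℂ → Fin n → ℝ) (Ω : ℂ → CMat n),
    ContDiff ℝ ∞ u ∧
    (∀ z, Ω z = torusMat n (fun k => I * (u z k : ℂ))) ∧
    ∀ z, logDz F z = dzMat Ω z + NormedSpace.exp (Ω z) * W * NormedSpace.exp (-Ω z)

/-- `g` is periodic with respect to all elements of `Λ`. -/
def LatticePeriodic {X : Type*} (Λ : Submodule ℤ ℂ) (g : ℂ → X) : Prop :=
  ∀ l ∈ Λ, ∀ z, g (z + l) = g z

/-! Everything is governed by the function H = ⟨∂_z^n f, ∂_z^n f⟩. Let F be a frame with F e_1 = f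
and F⁻¹F_z in 𝔱^ℂ plus the root spaces of α_0, …, α_n. Passing the derivatives of f through F gives
H = 4^n c_0 c_1² ⋯ c_{n-1}² c_n (`bil_iterate_eq_rootProduct`), so the product does not depend on
the frame. Harmonicity and isotropy make H holomorphic; if f is doubly periodic, H is a bounded
entire function, hence constant by Liouville (`bil_iterate_const_of_periodic`). This is (2).

For (1), consider the open set where H ≠ 0. There f_1, …, f_{n-1} have no zeros, because ⟨f_j,
∂_z^{2n-j} f⟩ = ±H; they are isotropic and mutually Hermitian orthogonal (`IsHarmonicSequence.on`).
After scaling they are the columns e_{2k} + i e_{2k+1} of a Lorentz frame, whose last two columns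
are filled in canonically: a timelike one by projecting e_{2n+1}, a spacelike one by cofactors. This
base frame is primitive (`IsHarmonicSequenceOn.logDz_baseFrame`), so the assumed constancy says H =
4^n K wherever H ≠ 0. Hence {H ≠ 0} is closed, open and non-empty, that is, all of ℂ. The base frame
is then global, and ψ is its class modulo T. Its value at a point is a function of the harmonic
sequence at that point, so ψ inherits the periods of f.

The root coefficients c_j of the base frame have no zeros. Taking logarithms on the plane yields g :
ℂ → 𝔱^ℂ with c_j = r_j exp(α_j(g)) for j ≥ 1. For j = 0 the same equation follows from equality of
the products, since α_0 + 2α_1 + ⋯ + 2α_{n-1} + α_n = 0 (`eq_mul_exp_rootVal_of_rootProduct_eq`).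
The torus part of the base frame is -∂_z ḡ (`IsHarmonicSequenceOn.baseTorus_eq`); in the last block
this is the content of the equation for ∂_z̄ f_n. Multiplying by exp(Re g) ∈ T turns the torus part
into ∂_z(i Im g) and the root coefficients into r_j exp(α_j(i Im g)): a Toda frame with Ω = i Im g
(`isTodaFrame_mul_torusExp`). -/

open Filter Topology

/-! ### Wirtinger calculus. -/

section Wirtinger

theorem dz_congr {g h : ℂ → ℂ} {z : ℂ} (e : g =ᶠ[𝓝 z] h) : dz g z = dz h z := by
  simp [dz, e.fderiv_eq]

theorem dzbar_congr {g h : ℂ → ℂ} {z : ℂ} (e : g =ᶠ[𝓝 z] h) : dzbar g z = dzbar h z := by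
  simp [dzbar, e.fderiv_eq]

theorem dz_const (a z : ℂ) : dz (fun _ => a) z = 0 := by simp [dz]

theorem dzbar_const (a z : ℂ) : dzbar (fun _ => a) z = 0 := by simp [dzbar]

variable {g h : ℂ → ℂ} {z : ℂ}

theorem dz_add (hg : DifferentiableAt ℝ g z) (hh : DifferentiableAt ℝ h z) :
    dz (fun w => g w + h w) z = dz g z + dz h z := by
  simp only [dz, fderiv_fun_add hg hh, _root_.add_apply]; ring

theorem dzbar_add (hg : DifferentiableAt ℝ g z) (hh : DifferentiableAt ℝ h z) :
    dzbar (fun w => g w + h w) z = dzbar g z + dzbar h z := by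
  simp only [dzbar, fderiv_fun_add hg hh, _root_.add_apply]; ring

theorem dz_mul (hg : DifferentiableAt ℝ g z) (hh : DifferentiableAt ℝ h z) :
    dz (fun w => g w * h w) z = dz g z * h z + g z * dz h z := by
  simp only [dz, fderiv_fun_mul hg hh, _root_.add_apply,
    _root_.smul_apply, smul_eq_mul]; ring

theorem dzbar_mul (hg : DifferentiableAt ℝ g z) (hh : DifferentiableAt ℝ h z) :
    dzbar (fun w => g w * h w) z = dzbar g z * h z + g z * dzbar h z := by
  simp only [dzbar, fderiv_fun_mul hg hh, _root_.add_apply,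
    _root_.smul_apply, smul_eq_mul]; ring

theorem dz_sum {ι : Type*} (s : Finset ι) {F : ι → ℂ → ℂ}
    (hF : ∀ i ∈ s, DifferentiableAt ℝ (F i) z) :
    dz (fun w => ∑ i ∈ s, F i w) z = ∑ i ∈ s, dz (F i) z := by
  simp only [dz, fderiv_fun_sum hF, _root_.sum_apply, Finset.mul_sum,
    ← Finset.sum_sub_distrib, Finset.sum_div]

theorem dzbar_sum {ι : Type*} (s : Finset ι) {F : ι → ℂ → ℂ}
    (hF : ∀ i ∈ s, DifferentiableAt ℝ (F i) z) :
    dzbar (fun w => ∑ i ∈ s, F i w) z = ∑ i ∈ s, dzbar (F i) z := by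
  simp only [dzbar, fderiv_fun_sum hF, _root_.sum_apply, Finset.mul_sum,
    ← Finset.sum_add_distrib, Finset.sum_div]

theorem fderiv_conj_comp (hg : DifferentiableAt ℝ g z) (v : ℂ) :
    fderiv ℝ (fun w => (starRingEnd ℂ) (g w)) z v = (starRingEnd ℂ) (fderiv ℝ g z v) := by
  have := (conjCLE.toContinuousLinearMap.hasFDerivAt.comp z hg.hasFDerivAt).fderiv
  have e : (fun w => (starRingEnd ℂ) (g w)) = (⇑(conjCLE.toContinuousLinearMap) ∘ g) := by
    ext w; simp
  rw [e, this]; simp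

theorem dz_conj (hg : DifferentiableAt ℝ g z) :
    dz (fun w => (starRingEnd ℂ) (g w)) z = (starRingEnd ℂ) (dzbar g z) := by
  simp only [dz, dzbar, fderiv_conj_comp hg]
  simp [sub_eq_add_neg, conj_ofNat]

theorem dzbar_conj (hg : DifferentiableAt ℝ g z) :
    dzbar (fun w => (starRingEnd ℂ) (g w)) z = (starRingEnd ℂ) (dz g z) := by
  simp only [dz, dzbar, fderiv_conj_comp hg]
  simp [sub_eq_add_neg, conj_ofNat]

theorem dz_exp (hg : DifferentiableAt ℝ g z) :
    dz (fun w => Complex.exp (g w)) z = Complex.exp (g z) * dz g z := by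
  simp only [dz, hg.hasFDerivAt.cexp.fderiv, _root_.smul_apply, smul_eq_mul]; ring

theorem dzbar_exp (hg : DifferentiableAt ℝ g z) :
    dzbar (fun w => Complex.exp (g w)) z = Complex.exp (g z) * dzbar g z := by
  simp only [dzbar, hg.hasFDerivAt.cexp.fderiv, _root_.smul_apply, smul_eq_mul]; ring

theorem dz_translate (g : ℂ → ℂ) (l z : ℂ) : dz (fun w => g (w + l)) z = dz g (z + l) := by
  simp [dz, fderiv_comp_add_right]

theorem contDiffAt_dz (hg : ContDiffAt ℝ ∞ g z) : ContDiffAt ℝ ∞ (dz g) z := by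
  have h := hg.fderiv_right (m := ∞) (by simp)
  unfold dz
  fun_prop

theorem contDiffAt_dzbar (hg : ContDiffAt ℝ ∞ g z) : ContDiffAt ℝ ∞ (dzbar g) z := by
  have h := hg.fderiv_right (m := ∞) (by simp)
  unfold dzbar
  fun_prop

theorem ContDiffAt.diffAt {E : Type*} [NormedAddCommGroup E] [NormedSpace ℝ E] {g : ℂ → E}
    (hg : ContDiffAt ℝ ∞ g z) : DifferentiableAt ℝ g z := hg.differentiableAt (by simp)

/-- Both sides are (∂_x² + ∂_y²)/4, by symmetry of the second real derivative. -/
theorem dzbar_dz_comm (hg : ContDiffAt ℝ ∞ g z) : dzbar (dz g) z = dz (dzbar g) z := by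
  have h2 : DifferentiableAt ℝ (fderiv ℝ g) z := (hg.fderiv_right (m := ∞) (by simp)).diffAt
  have hs : IsSymmSndFDerivAt ℝ g z :=
    hg.isSymmSndFDerivAt (by
      rw [minSmoothness_of_isRCLikeNormedField]
      exact WithTop.coe_le_coe.mpr (le_top : (2 : ℕ∞) ≤ ⊤))
  have key : ∀ v w : ℂ, fderiv ℝ (fun y => fderiv ℝ g y v) z w = fderiv ℝ (fderiv ℝ g) z w v := by
    intro v w
    rw [(h2.hasFDerivAt.clm_apply (hasFDerivAt_const v z)).fderiv]
    simp
  have hd : ∀ v : ℂ, DifferentiableAt ℝ (fun y => fderiv ℝ g y v) z := fun v =>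
    h2.clm_apply (differentiableAt_const v)
  have e1 : dz g = fun y => (2⁻¹ : ℂ) * fderiv ℝ g y 1 + (-(I / 2)) * fderiv ℝ g y I := by
    ext y; simp only [dz]; ring
  have e2 : dzbar g = fun y => (2⁻¹ : ℂ) * fderiv ℝ g y 1 + (I / 2) * fderiv ℝ g y I := by
    ext y; simp only [dzbar]; ring
  have h3 : ∀ a : ℂ, ∀ v w : ℂ, fderiv ℝ (fun y => (2⁻¹ : ℂ) * fderiv ℝ g y 1 +
      a * fderiv ℝ g y I) z w = 2⁻¹ * fderiv ℝ (fderiv ℝ g) z w 1 +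
      a * fderiv ℝ (fderiv ℝ g) z w I := by
    intro a v w
    rw [fderiv_fun_add ((hd 1).const_mul _) ((hd I).const_mul _), fderiv_const_mul (hd 1),
      fderiv_const_mul (hd I)]
    simp [key]
  rw [e1, e2]
  simp only [dz, dzbar, h3 _ 1, hs.eq I 1]
  ring

theorem differentiableAt_of_dzbar_eq_zero (hg : DifferentiableAt ℝ g z) (h0 : dzbar g z = 0) :
    DifferentiableAt ℂ g z := by
  rw [differentiableAt_complex_iff_differentiableAt_real]
  refine ⟨hg, ?_⟩
  have h1 : fderiv ℝ g z 1 + I * fderiv ℝ g z I = 0 := by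
    simpa [dzbar] using h0
  have : I * (fderiv ℝ g z 1 + I * fderiv ℝ g z I) = 0 := by rw [h1, mul_zero]
  rw [mul_add, ← mul_assoc, I_mul_I] at this
  rw [smul_eq_mul]
  linear_combination -this

end Wirtinger

/-! ### The complex Minkowski form and conjugation. -/

section Bilinear

variable {n : ℕ} (x y w : CVec n) (a : ℂ)

theorem bil_comm : bil x y = bil y x := by
  unfold bil; exact Finset.sum_congr rfl fun i _ => by ring

theorem bil_add_left : bil (x + y) w = bil x w + bil y w := by
  simp only [bil, ← Finset.sum_add_distrib]
  exact Finset.sum_congr rfl fun i _ => by simp only [Pi.add_apply]; ring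

theorem bil_add_right : bil w (x + y) = bil w x + bil w y := by
  rw [bil_comm, bil_add_left, bil_comm x, bil_comm y]

theorem bil_smul_left : bil (a • x) y = a * bil x y := by
  simp only [bil, Finset.mul_sum]
  exact Finset.sum_congr rfl fun i _ => by simp only [Pi.smul_apply, smul_eq_mul]; ring

theorem bil_smul_right : bil x (a • y) = a * bil x y := by
  rw [bil_comm, bil_smul_left, bil_comm]

theorem bil_neg_left : bil (-x) y = -bil x y := by
  have := bil_smul_left x y (-1); simpa using this

theorem bil_sub_left : bil (x - y) w = bil x w - bil y w := by
  rw [sub_eq_add_neg, bil_add_left, bil_neg_left, sub_eq_add_neg]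

theorem bil_sub_right : bil w (x - y) = bil w x - bil w y := by
  rw [bil_comm, bil_sub_left, bil_comm x, bil_comm y]

theorem bil_zero_left : bil 0 y = 0 := by simp [bil]

theorem bil_zero_right : bil x 0 = 0 := by simp [bil]

theorem bil_conj : bil (conjVec x) (conjVec y) = (starRingEnd ℂ) (bil x y) := by
  simp [bil, conjVec]

theorem conjVec_conjVec : conjVec (conjVec x) = x := by ext i; simp [conjVec]

theorem bil_conj_left : bil (conjVec x) y = (starRingEnd ℂ) (bil x (conjVec y)) := by
  rw [← bil_conj, conjVec_conjVec]

theorem conjVec_add : conjVec (x + y) = conjVec x + conjVec y := by ext i; simp [conjVec]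

theorem conjVec_smul : conjVec (a • x) = (starRingEnd ℂ) a • conjVec x := by
  ext i; simp [conjVec]

theorem hermSq_conj : (starRingEnd ℂ) (hermSq x) = hermSq x := by
  rw [hermSq, ← bil_conj, conjVec_conjVec, bil_comm]

theorem hermSq_eq_ofReal_re : hermSq x = ((hermSq x).re : ℂ) :=
  (conj_eq_iff_re.mp (hermSq_conj x)).symm

end Bilinear

/-! ### Wirtinger calculus for vector fields. -/

section VectorCalculus

variable {n : ℕ} {u v : ℂ → CVec n} {g : ℂ → ℂ} {z : ℂ}

theorem ContDiffAt.coord (hu : ContDiffAt ℝ ∞ u z) (i : Fin (2 * n + 1)) :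
    ContDiffAt ℝ ∞ (fun w => u w i) z := contDiffAt_pi.mp hu i

theorem contDiffAt_div {h : ℂ → ℂ} (hg : ContDiffAt ℝ ∞ g z) (hh : ContDiffAt ℝ ∞ h z)
    (h0 : h z ≠ 0) : ContDiffAt ℝ ∞ (fun w => g w / h w) z := by
  simp only [div_eq_mul_inv]
  exact hg.mul (hh.inv h0)

theorem contDiffAt_smulVec (hg : ContDiffAt ℝ ∞ g z) (hu : ContDiffAt ℝ ∞ u z) :
    ContDiffAt ℝ ∞ (fun w => g w • u w) z :=
  contDiffAt_pi.mpr fun i => hg.mul (hu.coord i)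

theorem contDiffAt_dzVec (hu : ContDiffAt ℝ ∞ u z) : ContDiffAt ℝ ∞ (dzVec u) z :=
  contDiffAt_pi.mpr fun i => contDiffAt_dz (hu.coord i)

theorem contDiffAt_dzbarVec (hu : ContDiffAt ℝ ∞ u z) : ContDiffAt ℝ ∞ (dzbarVec u) z :=
  contDiffAt_pi.mpr fun i => contDiffAt_dzbar (hu.coord i)

theorem contDiffAt_conj (hg : ContDiffAt ℝ ∞ g z) :
    ContDiffAt ℝ ∞ (fun w => (starRingEnd ℂ) (g w)) z :=
  conjCLE.contDiff.contDiffAt.comp z hg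

theorem contDiffAt_conjVec (hu : ContDiffAt ℝ ∞ u z) :
    ContDiffAt ℝ ∞ (fun w => conjVec (u w)) z :=
  contDiffAt_pi.mpr fun i => contDiffAt_conj (hu.coord i)

theorem contDiffAt_bil (hu : ContDiffAt ℝ ∞ u z) (hv : ContDiffAt ℝ ∞ v z) :
    ContDiffAt ℝ ∞ (fun w => bil (u w) (v w)) z := by
  unfold bil
  exact ContDiffAt.sum fun i _ => (contDiffAt_const.mul (hu.coord i)).mul (hv.coord i)

theorem contDiffAt_hermSq (hu : ContDiffAt ℝ ∞ u z) :
    ContDiffAt ℝ ∞ (fun w => hermSq (u w)) z :=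
  contDiffAt_bil hu (contDiffAt_conjVec hu)

theorem dz_bil (hu : ContDiffAt ℝ ∞ u z) (hv : ContDiffAt ℝ ∞ v z) :
    dz (fun w => bil (u w) (v w)) z = bil (dzVec u z) (v z) + bil (u z) (dzVec v z) := by
  unfold bil
  rw [dz_sum]
  · rw [← Finset.sum_add_distrib]
    refine Finset.sum_congr rfl fun i _ => ?_
    rw [dz_mul ((hu.coord i).diffAt.const_mul _) (hv.coord i).diffAt,
      dz_mul (differentiableAt_const _) (hu.coord i).diffAt, dz_const]
    simp [dzVec]
  · exact fun i _ => ((hu.coord i).diffAt.const_mul _).mul (hv.coord i).diffAt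

theorem dzbar_bil (hu : ContDiffAt ℝ ∞ u z) (hv : ContDiffAt ℝ ∞ v z) :
    dzbar (fun w => bil (u w) (v w)) z = bil (dzbarVec u z) (v z) + bil (u z) (dzbarVec v z) := by
  unfold bil
  rw [dzbar_sum]
  · rw [← Finset.sum_add_distrib]
    refine Finset.sum_congr rfl fun i _ => ?_
    rw [dzbar_mul ((hu.coord i).diffAt.const_mul _) (hv.coord i).diffAt,
      dzbar_mul (differentiableAt_const _) (hu.coord i).diffAt, dzbar_const]
    simp [dzbarVec]
  · exact fun i _ => ((hu.coord i).diffAt.const_mul _).mul (hv.coord i).diffAt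

theorem dzVec_congr (e : u =ᶠ[𝓝 z] v) : dzVec u z = dzVec v z := by
  ext i; exact dz_congr (e.mono fun w hw => by simp [hw])

theorem dzbarVec_congr (e : u =ᶠ[𝓝 z] v) : dzbarVec u z = dzbarVec v z := by
  ext i; exact dzbar_congr (e.mono fun w hw => by simp [hw])

theorem dzVec_smul (hg : ContDiffAt ℝ ∞ g z) (hu : ContDiffAt ℝ ∞ u z) :
    dzVec (fun w => g w • u w) z = dz g z • u z + g z • dzVec u z := by
  ext i; exact dz_mul hg.diffAt (hu.coord i).diffAt

theorem dzbarVec_smul (hg : ContDiffAt ℝ ∞ g z) (hu : ContDiffAt ℝ ∞ u z) :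
    dzbarVec (fun w => g w • u w) z = dzbar g z • u z + g z • dzbarVec u z := by
  ext i; exact dzbar_mul hg.diffAt (hu.coord i).diffAt

theorem dzbarVec_add (hu : ContDiffAt ℝ ∞ u z) (hv : ContDiffAt ℝ ∞ v z) :
    dzbarVec (fun w => u w + v w) z = dzbarVec u z + dzbarVec v z := by
  ext i; exact dzbar_add (hu.coord i).diffAt (hv.coord i).diffAt

theorem dzVec_conj (hu : ContDiffAt ℝ ∞ u z) :
    dzVec (fun w => conjVec (u w)) z = conjVec (dzbarVec u z) := by
  ext i; exact dz_conj (hu.coord i).diffAt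

theorem dzbarVec_conj (hu : ContDiffAt ℝ ∞ u z) :
    dzbarVec (fun w => conjVec (u w)) z = conjVec (dzVec u z) := by
  ext i; exact dzbar_conj (hu.coord i).diffAt

theorem dzbarVec_dzVec_comm (hu : ContDiffAt ℝ ∞ u z) :
    dzbarVec (dzVec u) z = dzVec (dzbarVec u) z := by
  ext i; exact dzbar_dz_comm (hu.coord i)

theorem dzVec_translate (u : ℂ → CVec n) (l z : ℂ) :
    dzVec (fun w => u (w + l)) z = dzVec u (z + l) := by
  ext i; exact dz_translate (fun w => u w i) l z

theorem contDiffAt_dzVec_iterate (hu : ContDiffAt ℝ ∞ u z) (k : ℕ) :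
    ContDiffAt ℝ ∞ (dzVec^[k] u) z := by
  induction k with
  | zero => simpa using hu
  | succ k ih => rw [Function.iterate_succ_apply']; exact contDiffAt_dzVec ih

theorem dzVec_iterate_succ (u : ℂ → CVec n) (k : ℕ) (z : ℂ) :
    dzVec (dzVec^[k] u) z = dzVec^[k + 1] u z := by rw [Function.iterate_succ_apply']

end VectorCalculus

/-! ### Weight vectors of the torus, and root vectors as bivectors. -/

section RootVectors

/-- The standard basis vector with (zero-based) index `m`. -/
def stdVec (n m : ℕ) : CVec n := fun i => if i.val = m then 1 else 0

/-- The vector `e_{2k} + σ e_{2k+1}`; for `k = 0` this is `e_1`. -/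
def pairVec (n k : ℕ) (σ : ℂ) : CVec n :=
  fun i => if i.val = 2 * k - 1 then 1 else if i.val = 2 * k then σ else 0

/-- The sign of the last basis vector of the `k`-th plane, and `0` for `k = 0`. -/
def pairSign (n k : ℕ) : ℂ := if k = 0 then 0 else if k = n then -1 else 1

/-- The skew endomorphism `x ↦ ⟨u, x⟩ v - ⟨v, x⟩ u`. -/
def wedge {n : ℕ} (u v : CVec n) : CMat n :=
  Matrix.of fun a b => v a * (lorentzSign n b * u b) - u a * (lorentzSign n b * v b)

variable {n : ℕ}

theorem wedge_mulVec (u v x : CVec n) :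
    wedge u v *ᵥ x = bil u x • v - bil v x • u := by
  ext a
  simp only [wedge, mulVec, dotProduct, Matrix.of_apply, Pi.sub_apply, Pi.smul_apply, smul_eq_mul,
    bil, Finset.sum_mul, ← Finset.sum_sub_distrib]
  exact Finset.sum_congr rfl fun i _ => by ring

theorem brk_eq_wedge {j k : ℕ} (hjk : j < k) (hk : k ≤ 2 * n) :
    brk n (j + 1) (k + 1) = wedge (stdVec n j) (stdVec n k) := by
  ext a b
  simp only [brk, wedge, stdVec, lorentzSign, Matrix.of_apply, Nat.add_right_cancel_iff]
  have := a.isLt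
  have := b.isLt
  by_cases h1 : a.val = k <;> by_cases h2 : b.val = j <;> by_cases h3 : a.val = j <;>
    by_cases h4 : b.val = k <;> by_cases h5 : k = 2 * n <;> by_cases h6 : j = 2 * n <;>
    first
    | omega
    | simp_all

theorem bil_stdVec_right (x : CVec n) {m : ℕ} (hm : m < 2 * n + 1) :
    bil x (stdVec n m) = lorentzSign n ⟨m, hm⟩ * x ⟨m, hm⟩ := by
  unfold bil stdVec
  rw [Finset.sum_eq_single ⟨m, hm⟩]
  · simp
  · intro b _ hb
    have : b.val ≠ m := fun h => hb (Fin.ext h)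
    simp [this]
  · simp

theorem pairVec_eq {k : ℕ} (hk : 1 ≤ k) (σ : ℂ) :
    pairVec n k σ = stdVec n (2 * k - 1) + σ • stdVec n (2 * k) := by
  ext i
  simp only [pairVec, stdVec, Pi.add_apply, Pi.smul_apply, smul_eq_mul]
  by_cases h1 : i.val = 2 * k - 1
  · have : i.val ≠ 2 * k := by omega
    rw [if_pos h1, if_pos h1, if_neg this]; simp
  · rw [if_neg h1, if_neg h1]; simp

theorem pairVec_zero (σ : ℂ) : pairVec n 0 σ = stdVec n 0 := by
  ext i
  simp only [pairVec, stdVec]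
  by_cases h : i.val = 0 <;> simp [h]

theorem lorentzSign_of_ne {m : ℕ} (hm : m < 2 * n + 1) (h : m ≠ 2 * n) :
    lorentzSign n ⟨m, hm⟩ = 1 := by simp [lorentzSign, h]

theorem pairSign_eq {k : ℕ} (hk : 1 ≤ k) (hkn : k ≤ n) :
    pairSign n k = lorentzSign n ⟨2 * k, by omega⟩ := by
  have : k ≠ 0 := by omega
  by_cases h : k = n
  · subst h; simp [pairSign, lorentzSign, this]
  · simp [pairSign, lorentzSign, this, h]

theorem bil_pairVec_right (x : CVec n) {k : ℕ} (hk : 1 ≤ k) (hkn : k ≤ n) (σ : ℂ) :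
    bil x (pairVec n k σ) = x ⟨2 * k - 1, by omega⟩ + pairSign n k * σ * x ⟨2 * k, by omega⟩ := by
  rw [pairVec_eq hk, bil_add_right, bil_smul_right, bil_stdVec_right x (m := 2 * k - 1) (by omega),
    bil_stdVec_right x (m := 2 * k) (by omega), lorentzSign_of_ne _ (by omega), pairSign_eq hk hkn]
  push_cast; ring

theorem bil_pairVec_zero (hn : 1 ≤ n) (x : CVec n) (σ : ℂ) : bil x (pairVec n 0 σ) = x 0 := by
  rw [pairVec_zero, bil_stdVec_right x (m := 0) (by omega), lorentzSign_of_ne _ (by omega)]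
  simp

theorem bil_pairVec_pairVec (hn : 1 ≤ n) {k l : ℕ} (hl : l ≤ n) (σ τ : ℂ) :
    bil (pairVec n k σ) (pairVec n l τ) = if k = l then 1 + pairSign n k * σ * τ else 0 := by
  rcases Nat.eq_zero_or_pos l with rfl | hl0
  · rw [bil_pairVec_zero hn]
    by_cases h : k = 0
    · simp [h, pairVec, pairSign]
    · have h1 : ¬(0 = 2 * k - 1) := by omega
      simp [pairVec, h, h1]
  · rw [bil_pairVec_right _ hl0 hl]
    by_cases h : k = l
    · subst h
      have : 2 * k ≠ 2 * k - 1 := by omega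
      simp [pairVec, this]; ring
    · have h1 : ¬(2 * l - 1 = 2 * k - 1) := by omega
      have h2 : ¬(2 * l - 1 = 2 * k) := by omega
      have h3 : ¬(2 * l = 2 * k - 1) := by omega
      have h4 : ¬(2 * l = 2 * k) := by omega
      simp only [pairVec, h1, h2, h3, h4, h, if_false]; simp

theorem conjVec_pairVec (k : ℕ) (σ : ℂ) :
    conjVec (pairVec n k σ) = pairVec n k ((starRingEnd ℂ) σ) := by
  ext i
  simp only [conjVec, pairVec]
  split_ifs <;> simp

theorem index_cases (m : Fin (2 * n + 1)) :
    m.val = 0 ∨ ∃ k, 1 ≤ k ∧ k ≤ n ∧ (m.val = 2 * k - 1 ∨ m.val = 2 * k) := by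
  have := m.isLt
  by_cases h : m.val = 0
  · exact Or.inl h
  · exact Or.inr ⟨(m.val + 1) / 2, by omega, by omega, by omega⟩

/-- The vectors e_1, e_{2k} ± i e_{2k+1} and e_{2n} ± e_{2n+1} span and the form is non-degenerate,
so vectors can be compared by pairing with weight vectors of the torus. -/
theorem eq_zero_of_bil_pairVec (hn : 1 ≤ n) {x : CVec n}
    (h1 : ∀ k < n, bil x (pairVec n k I) = 0) (h2 : ∀ k < n, bil x (pairVec n k (-I)) = 0)
    (h3 : bil x (pairVec n n 1) = 0) (h4 : bil x (pairVec n n (-1)) = 0) : x = 0 := by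
  have key : ∀ (a b σ : ℂ), σ ≠ 0 → a + σ * b = 0 → a + -σ * b = 0 → a = 0 ∧ b = 0 := by
    intro a b σ hσ e1 e2
    have ha : a = 0 := by linear_combination (e1 + e2) / 2
    refine ⟨ha, ?_⟩
    rw [ha, zero_add] at e1
    exact (mul_eq_zero.mp e1).resolve_left hσ
  ext m
  rcases index_cases m with h | ⟨k, hk1, hkn, h⟩
  · have := h1 0 (by omega)
    rw [bil_pairVec_zero hn] at this
    rw [show m = 0 from Fin.ext h, this]; rfl
  · have hk0 : k ≠ 0 := by omega
    have : x ⟨2 * k - 1, by omega⟩ = 0 ∧ x ⟨2 * k, by omega⟩ = 0 := by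
      by_cases hk : k = n
      · subst hk
        rw [bil_pairVec_right x hk1 hkn] at h3 h4
        refine key _ _ (-1) (by simp) ?_ ?_
        · simpa [pairSign, hk0] using h3
        · simpa [pairSign, hk0] using h4
      · have h1 := h1 k (by omega)
        have h2 := h2 k (by omega)
        rw [bil_pairVec_right x hk1 hkn] at h1 h2
        refine key _ _ I I_ne_zero ?_ ?_
        · simpa [pairSign, hk0, hk] using h1
        · simpa [pairSign, hk0, hk] using h2
    rcases h with h | h
    · rw [show m = ⟨2 * k - 1, by omega⟩ from Fin.ext h, this.1]; rfl
    · rw [show m = ⟨2 * k, by omega⟩ from Fin.ext h, this.2]; rfl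

/-- Skew matrices with respect to the bilinear form. -/
def IsSkew (A : CMat n) : Prop := ∀ x y, bil (A *ᵥ x) y = -bil x (A *ᵥ y)

theorem isSkew_wedge (u v : CVec n) : IsSkew (wedge u v) := by
  intro x y
  simp only [wedge_mulVec, bil_sub_left, bil_sub_right, bil_smul_left, bil_smul_right,
    bil_comm _ x, bil_comm v y, bil_comm u y]
  ring

theorem IsSkew.add {A B : CMat n} (hA : IsSkew A) (hB : IsSkew B) : IsSkew (A + B) := by
  intro x y
  simp only [add_mulVec, bil_add_left, bil_add_right, hA x y, hB x y]; ring

theorem IsSkew.smul {A : CMat n} (hA : IsSkew A) (a : ℂ) : IsSkew (a • A) := by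
  intro x y
  simp only [smul_mulVec, bil_smul_left, bil_smul_right, hA x y]; ring

theorem IsSkew.sub {A B : CMat n} (hA : IsSkew A) (hB : IsSkew B) : IsSkew (A - B) := by
  intro x y
  simp only [sub_mulVec, bil_sub_left, bil_sub_right, hA x y, hB x y]; ring

theorem isSkew_sum {ι : Type*} (s : Finset ι) {A : ι → CMat n} (hA : ∀ i ∈ s, IsSkew (A i)) :
    IsSkew (∑ i ∈ s, A i) := by
  classical
  induction s using Finset.induction_on with
  | empty => intro x y; simp [bil_zero_left, bil_zero_right]
  | insert i s hi ih =>
    rw [Finset.sum_insert hi]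
    exact (hA i (Finset.mem_insert_self i s)).add
      (ih fun j hj => hA j (Finset.mem_insert_of_mem hj))

theorem mat_ext_mulVec {A B : CMat n} (h : ∀ x, A *ᵥ x = B *ᵥ x) : A = B :=
  Matrix.mulVec_injective (funext h)

/-- A skew matrix that kills all `e_{2k} ± i e_{2k+1}`, `k < n`, and has no component in the last
block is zero. -/
theorem IsSkew.eq_zero (hn : 1 ≤ n) {D : CMat n} (hD : IsSkew D)
    (h1 : ∀ k < n, D *ᵥ pairVec n k I = 0) (h2 : ∀ k < n, D *ᵥ pairVec n k (-I) = 0)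
    (h3 : bil (D *ᵥ pairVec n n 1) (pairVec n n (-1)) = 0) : D = 0 := by
  have self : ∀ x, bil (D *ᵥ x) x = 0 := by
    intro x
    have := hD x x
    rw [bil_comm x] at this
    linear_combination this / 2
  have h4 : D *ᵥ pairVec n n 1 = 0 := by
    refine eq_zero_of_bil_pairVec hn ?_ ?_ (self _) h3
    · intro k hk; rw [hD, h1 k hk, bil_zero_right, neg_zero]
    · intro k hk; rw [hD, h2 k hk, bil_zero_right, neg_zero]
  have h5 : D *ᵥ pairVec n n (-1) = 0 := by
    refine eq_zero_of_bil_pairVec hn ?_ ?_ ?_ (self _)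
    · intro k hk; rw [hD, h1 k hk, bil_zero_right, neg_zero]
    · intro k hk; rw [hD, h2 k hk, bil_zero_right, neg_zero]
    · rw [hD, h4, bil_zero_right, neg_zero]
  refine mat_ext_mulVec fun x => ?_
  rw [zero_mulVec]
  refine eq_zero_of_bil_pairVec hn ?_ ?_ ?_ ?_
  · intro k hk; rw [hD, h1 k hk, bil_zero_right, neg_zero]
  · intro k hk; rw [hD, h2 k hk, bil_zero_right, neg_zero]
  · rw [hD, h4, bil_zero_right, neg_zero]
  · rw [hD, h5, bil_zero_right, neg_zero]

/-- The adjoint action of a skew endomorphism on bivectors is by derivations; skewness moves A from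
the argument x onto u and v. -/
theorem IsSkew.commutator_wedge {A : CMat n} (hA : IsSkew A) (u v : CVec n) :
    A * wedge u v - wedge u v * A = wedge (A *ᵥ u) v + wedge u (A *ᵥ v) := by
  refine mat_ext_mulVec fun x => ?_
  simp only [sub_mulVec, add_mulVec, ← mulVec_mulVec, wedge_mulVec, mulVec_sub, mulVec_smul,
    hA u x, hA v x, neg_smul]
  abel

theorem wedge_smul_left (a : ℂ) (u v : CVec n) : wedge (a • u) v = a • wedge u v := by
  ext i j; simp [wedge]; ring

theorem wedge_smul_right (a : ℂ) (u v : CVec n) : wedge u (a • v) = a • wedge u v := by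
  ext i j; simp [wedge]; ring

theorem wedge_add_left (u u' v : CVec n) : wedge (u + u') v = wedge u v + wedge u' v := by
  ext i j; simp [wedge]; ring

theorem wedge_add_right (u v v' : CVec n) : wedge u (v + v') = wedge u v + wedge u v' := by
  ext i j; simp [wedge]; ring

/-- The linear functional `ã_k` on `𝔱^ℂ`, in coordinates; zero for `k = 0`. -/
def torusCoord (a : Fin n → ℂ) (k : ℕ) : ℂ :=
  if h : 1 ≤ k ∧ k ≤ n then a ⟨k - 1, by omega⟩ else 0

theorem torusCoord_zero (a : Fin n → ℂ) : torusCoord a 0 = 0 := by simp [torusCoord]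

theorem torusMat_eq_sum_wedge (a : Fin n → ℂ) :
    torusMat n a = ∑ k : Fin n, a k •
      ((if k.val + 1 = n then (1 : ℂ) else -1) •
        wedge (stdVec n (2 * (k.val + 1) - 1)) (stdVec n (2 * (k.val + 1)))) := by
  unfold torusMat
  refine Finset.sum_congr rfl fun k _ => ?_
  have hk := k.isLt
  congr 1
  have e := brk_eq_wedge (n := n) (j := 2 * (k.val + 1) - 1) (k := 2 * (k.val + 1)) (by omega)
    (by omega)
  have e2 : 2 * (k.val + 1) - 1 + 1 = 2 * (k.val + 1) := by omega
  rw [e2] at e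
  split_ifs with h
  · rw [← e, one_smul, h]
  · rw [← e, neg_one_smul]

theorem isSkew_torusMat (a : Fin n → ℂ) : IsSkew (torusMat n a) := by
  rw [torusMat_eq_sum_wedge]
  exact isSkew_sum _ fun k _ => ((isSkew_wedge _ _).smul _).smul _

/-- The condition on σ says that the vector is isotropic, and the two null lines of a block are the
eigenlines of that block. For k = 0 the vector e_1 is killed, which matches the convention
`torusCoord a 0 = 0`. -/
theorem torusMat_mulVec_pairVec (hn : 1 ≤ n) (a : Fin n → ℂ) {k : ℕ} (hk : k ≤ n) {σ : ℂ}
    (hσ : k = 0 ∨ 1 + pairSign n k * σ * σ = 0) :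
    torusMat n a *ᵥ pairVec n k σ = (σ * torusCoord a k) • pairVec n k σ := by
  have gen : ∀ l : ℕ, 1 ≤ l → l ≤ n →
      wedge (stdVec n (2 * l - 1)) (stdVec n (2 * l)) *ᵥ pairVec n k σ =
        if l = k then stdVec n (2 * l) - (pairSign n k * σ) • stdVec n (2 * l - 1) else 0 := by
    intro l hl hln
    have p : pairVec n l 0 = stdVec n (2 * l - 1) := by rw [pairVec_eq hl]; simp
    have q : stdVec n (2 * l) = pairVec n l 1 - pairVec n l 0 := by
      rw [pairVec_eq hl, pairVec_eq hl]; simp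
    rw [wedge_mulVec, q, ← p, bil_sub_left, bil_pairVec_pairVec hn hk,
      bil_pairVec_pairVec hn hk]
    by_cases h : l = k
    · subst h; simp
    · simp [h]
  rw [torusMat_eq_sum_wedge, sum_mulVec]
  simp only [smul_mulVec]
  rcases Nat.eq_zero_or_pos k with rfl | hk0
  · rw [torusCoord_zero, mul_zero, zero_smul]
    refine Finset.sum_eq_zero fun l _ => ?_
    rw [gen (l.val + 1) (by omega) (by omega), if_neg (show ¬(l.val + 1 = 0) by omega), smul_zero,
      smul_zero]
  · have hσ := hσ.resolve_left (by omega)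
    rw [Finset.sum_eq_single ⟨k - 1, by omega⟩]
    · simp only [Nat.sub_add_cancel hk0]
      rw [gen k hk0 hk, if_pos rfl, pairVec_eq hk0, torusCoord, dif_pos ⟨hk0, hk⟩]
      have h0 : k ≠ 0 := by omega
      by_cases h : k = n
      · simp only [pairSign, h, if_true] at hσ ⊢
        have hn0 : n ≠ 0 := by omega
        simp only [hn0, if_false] at hσ ⊢
        ext i
        simp only [Pi.add_apply, Pi.smul_apply, Pi.sub_apply, smul_eq_mul]
        linear_combination (a ⟨n - 1, by omega⟩ * stdVec n (2 * n) i) * hσ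
      · simp only [pairSign, h0, h, if_false] at hσ ⊢
        ext i
        simp only [Pi.add_apply, Pi.smul_apply, Pi.sub_apply, smul_eq_mul]
        linear_combination -(a ⟨k - 1, by omega⟩ * stdVec n (2 * k) i) * hσ
    · intro b _ hb
      have : b.val + 1 ≠ k := fun h => hb (Fin.ext (by simp; omega))
      rw [gen (b.val + 1) (by omega) (by omega), if_neg this, smul_zero, smul_zero]
    · simp

/-- The value of the root `α_j` on `torusMat n a`. -/
def rootVal (a : Fin n → ℂ) (j : ℕ) : ℂ :=
  (if j = 0 then -torusCoord a n else if j = n then torusCoord a n else I * torusCoord a j) -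
    I * torusCoord a ((if j = 0 then n else j) - 1)

/-- The second factor of the root vector `R_{α_j}`. -/
def rootTarget (n j : ℕ) : CVec n :=
  if j = 0 then pairVec n n (-1) else if j = n then pairVec n n 1 else pairVec n j I

/-- Each root vector is a decomposable bivector of weight vectors, so its root can be read off from
the two weights. R_{α_0} and R_{α_n} share the first factor; hence the index `if j = 0 then n else
j`. -/
theorem rootVec_eq_wedge (hn : 1 ≤ n) {j : ℕ} (hj : j ≤ n) :
    rootVec n j = wedge (pairVec n ((if j = 0 then n else j) - 1) (-I)) (rootTarget n j) := by
  have B : ∀ j k : ℕ, 1 ≤ j → j < k → k ≤ 2 * n + 1 →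
      brk n j k = wedge (stdVec n (j - 1)) (stdVec n (k - 1)) := by
    intro j k hj hjk hk
    have := brk_eq_wedge (n := n) (j := j - 1) (k := k - 1) (by omega) (by omega)
    rwa [Nat.sub_add_cancel hj, Nat.sub_add_cancel (by omega)] at this
  have W : ∀ (k l : ℕ) (τ : ℂ), 1 ≤ k → k < l → l ≤ n →
      wedge (pairVec n k (-I)) (pairVec n l τ) =
        brk n (2 * k) (2 * l) + τ • brk n (2 * k) (2 * l + 1) - I • brk n (2 * k + 1) (2 * l)
          - (I * τ) • brk n (2 * k + 1) (2 * l + 1) := by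
    intro k l τ hk hkl hl
    rw [B _ _ (by omega) (by omega) (by omega), B _ _ (by omega) (by omega) (by omega),
      B _ _ (by omega) (by omega) (by omega), B _ _ (by omega) (by omega) (by omega),
      pairVec_eq hk, pairVec_eq (show 1 ≤ l by omega)]
    simp only [wedge_add_left, wedge_add_right, wedge_smul_left, wedge_smul_right,
      Nat.add_sub_cancel]
    module
  have W0 : ∀ (l : ℕ) (τ : ℂ), 1 ≤ l → l ≤ n →
      wedge (pairVec n 0 (-I)) (pairVec n l τ) = brk n 1 (2 * l) + τ • brk n 1 (2 * l + 1) := by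
    intro l τ hl hln
    rw [B _ _ (by omega) (by omega) (by omega), B _ _ (by omega) (by omega) (by omega),
      pairVec_zero, pairVec_eq hl]
    simp only [wedge_add_right, wedge_smul_right, Nat.add_sub_cancel, Nat.sub_self]
  unfold rootVec rootTarget
  by_cases hj0 : j = 0
  · simp only [hj0, if_true]
    by_cases h1 : n = 1
    · subst h1
      simp [W0, sub_eq_add_neg]
    · rw [if_neg h1, W (n - 1) n (-1) (by omega) (by omega) le_rfl]
      have e1 : 2 * (n - 1) = 2 * n - 2 := by omega
      have e2 : 2 * n - 2 + 1 = 2 * n - 1 := by omega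
      rw [e1, e2]
      simp [sub_eq_add_neg]
  · simp only [hj0, if_false]
    by_cases hjn : j = n
    · simp only [hjn, if_true]
      by_cases h1 : n = 1
      · subst h1
        simp [W0]
      · rw [if_neg h1, W (n - 1) n 1 (by omega) (by omega) le_rfl]
        have e1 : 2 * (n - 1) = 2 * n - 2 := by omega
        have e2 : 2 * n - 2 + 1 = 2 * n - 1 := by omega
        rw [e1, e2]
        simp
    · simp only [hjn, if_false]
      by_cases h1 : j = 1
      · subst h1
        simp [W0 1 I le_rfl hj]
      · rw [if_neg h1, W (j - 1) j I (by omega) (by omega) hj]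
        have e1 : 2 * (j - 1) = 2 * j - 2 := by omega
        have e2 : 2 * j - 2 + 1 = 2 * j - 1 := by omega
        rw [e1, e2]
        simp

theorem isSkew_rootSum (hn : 1 ≤ n) (c : ℕ → ℂ) : IsSkew (rootSum n c) := by
  refine isSkew_sum _ fun j hj => ?_
  rw [rootVec_eq_wedge hn (by simpa [Nat.lt_succ_iff] using hj)]
  exact (isSkew_wedge _ _).smul _

theorem pair_null {k : ℕ} (hk : k < n) {σ : ℂ} (hσ : σ * σ = -1) :
    k = 0 ∨ 1 + pairSign n k * σ * σ = 0 := by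
  by_cases h : k = 0
  · exact Or.inl h
  · right
    simp only [pairSign, h, hk.ne, if_false]
    linear_combination hσ

theorem pair_null_last (hn : 1 ≤ n) {σ : ℂ} (hσ : σ * σ = 1) :
    n = 0 ∨ 1 + pairSign n n * σ * σ = 0 := by
  right
  have : n ≠ 0 := by omega
  simp only [pairSign, this, if_false, if_true]
  linear_combination -hσ

theorem torusMat_mulVec_rootTarget (hn : 1 ≤ n) (a : Fin n → ℂ) {j : ℕ} (hj : j ≤ n) :
    torusMat n a *ᵥ rootTarget n j =
      (if j = 0 then -torusCoord a n else if j = n then torusCoord a n else I * torusCoord a j) •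
        rootTarget n j := by
  unfold rootTarget
  split_ifs with h0 h1
  · rw [torusMat_mulVec_pairVec hn a le_rfl (pair_null_last hn (by simp)), neg_one_mul]
  · rw [torusMat_mulVec_pairVec hn a le_rfl (pair_null_last hn (by simp)), one_mul]
  · rw [torusMat_mulVec_pairVec hn a hj (pair_null (by omega) I_mul_I)]

/-- By the derivation rule, the weights of the two factors of the bivector add up to the root. -/
theorem torusMat_commutator_rootVec (hn : 1 ≤ n) (a : Fin n → ℂ) {j : ℕ} (hj : j ≤ n) :
    torusMat n a * rootVec n j - rootVec n j * torusMat n a = rootVal a j • rootVec n j := by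
  have hlt : (if j = 0 then n else j) - 1 < n := by split_ifs <;> omega
  rw [rootVec_eq_wedge hn hj, (isSkew_torusMat a).commutator_wedge,
    torusMat_mulVec_rootTarget hn a hj, torusMat_mulVec_pairVec hn a hlt.le
      (pair_null hlt (by simp)), wedge_smul_left, wedge_smul_right, ← add_smul, rootVal]
  congr 1
  ring

end RootVectors

/-! ### The action of a sum of root vectors on the weight vectors. -/

section RootSumAction

variable {n : ℕ}

/-- Write E_k = e_{2k} + i e_{2k+1} (with E_0 = e_1), Ē_k for its conjugate and N_± = e_{2n} ±
e_{2n+1}. This formula is the source of the cyclic chain E_0 → E_1 → ⋯ → E_{n-1} → N_± → Ē_{n-1} → ⋯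
→ Ē_1 → E_0 along which the root part moves lines. The terms j = 0 and j = n are split off because
they alone involve N_±. -/
theorem rootSum_mulVec (hn : 1 ≤ n) (c : ℕ → ℂ) (x : CVec n) :
    rootSum n c *ᵥ x =
      bil (pairVec n (n - 1) (-I)) x • (c 0 • pairVec n n (-1) + c n • pairVec n n 1) -
        (c 0 * bil (pairVec n n (-1)) x + c n * bil (pairVec n n 1) x) • pairVec n (n - 1) (-I) +
      ∑ j ∈ Finset.Ico 1 n, c j • (bil (pairVec n (j - 1) (-I)) x • pairVec n j I -
        bil (pairVec n j I) x • pairVec n (j - 1) (-I)) := by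
  have e : ∀ j ∈ Finset.Ico 1 n, (c j • rootVec n j) *ᵥ x =
      c j • (bil (pairVec n (j - 1) (-I)) x • pairVec n j I -
        bil (pairVec n j I) x • pairVec n (j - 1) (-I)) := by
    intro j hj
    obtain ⟨h1, h2⟩ := Finset.mem_Ico.mp hj
    have h0 : j ≠ 0 := by omega
    rw [rootVec_eq_wedge hn h2.le, smul_mulVec, wedge_mulVec, rootTarget, if_neg h0, if_neg h0,
      if_neg h2.ne]
  have h0 : n ≠ 0 := by omega
  rw [rootSum, Finset.sum_range_succ, Finset.sum_range_eq_add_Ico _ (by omega), add_mulVec,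
    add_mulVec, sum_mulVec, Finset.sum_congr rfl e, rootVec_eq_wedge hn (Nat.zero_le n),
    rootVec_eq_wedge hn le_rfl, smul_mulVec, smul_mulVec, wedge_mulVec, wedge_mulVec]
  simp only [rootTarget, if_true, h0, if_false]
  module

theorem one_add_pairSign_of_pos {k : ℕ} (hk : 1 ≤ k) (hkn : k < n) : 1 + pairSign n k = 2 := by
  have h0 : k ≠ 0 := by omega
  simp [pairSign, h0, hkn.ne]; norm_num

theorem bil_pairVec_of_ne (hn : 1 ≤ n) {k l : ℕ} (hl : l ≤ n) (h : k ≠ l) (σ τ : ℂ) :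
    bil (pairVec n k σ) (pairVec n l τ) = 0 := by
  rw [bil_pairVec_pairVec hn hl, if_neg h]

theorem bil_pairVec_self (hn : 1 ≤ n) {k : ℕ} (hk : k ≤ n) (σ τ : ℂ) :
    bil (pairVec n k σ) (pairVec n k τ) = 1 + pairSign n k * σ * τ := by
  rw [bil_pairVec_pairVec hn hk, if_pos rfl]

/-- The factor 1 + `pairSign n k` is ⟨Ē_k, E_k⟩: it is 1 for e_1 and 2 for 0 < k < n. -/
theorem rootSum_mulVec_pair (hn : 1 ≤ n) (c : ℕ → ℂ) {k : ℕ} (hk : k + 1 < n) :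
    rootSum n c *ᵥ pairVec n k I = ((1 + pairSign n k) * c (k + 1)) • pairVec n (k + 1) I := by
  rw [rootSum_mulVec hn, Finset.sum_eq_single (k + 1)]
  · rw [bil_pairVec_of_ne hn (l := k) (k := n - 1) (by omega) (by omega),
      bil_pairVec_of_ne hn (l := k) (k := n) (by omega) (by omega),
      bil_pairVec_of_ne hn (l := k) (k := n) (by omega) (by omega),
      bil_pairVec_of_ne hn (l := k) (k := k + 1) (by omega) (by omega), Nat.add_sub_cancel,
      bil_pairVec_self hn (by omega)]
    have : pairSign n k * -I * I = pairSign n k := by rw [mul_assoc]; simp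
    rw [this]
    module
  · intro j hj hjk
    obtain ⟨h1, h2⟩ := Finset.mem_Ico.mp hj
    rw [bil_pairVec_of_ne hn (l := k) (k := j - 1) (by omega) (by omega)]
    by_cases hjk : j = k
    · subst hjk
      have : j ≠ 0 := by omega
      rw [bil_pairVec_self hn h2.le]
      simp [pairSign, this, h2.ne]
    · rw [bil_pairVec_of_ne hn (by omega) hjk]; simp
  · intro h; exact absurd (Finset.mem_Ico.mpr ⟨by omega, hk⟩) h

theorem rootSum_mulVec_pair_last (hn : 1 ≤ n) (c : ℕ → ℂ) :
    rootSum n c *ᵥ pairVec n (n - 1) I =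
      (1 + pairSign n (n - 1)) • (c 0 • pairVec n n (-1) + c n • pairVec n n 1) := by
  rw [rootSum_mulVec hn, Finset.sum_eq_zero]
  · rw [bil_pairVec_of_ne hn (l := n - 1) (k := n) (by omega) (by omega),
      bil_pairVec_of_ne hn (l := n - 1) (k := n) (by omega) (by omega),
      bil_pairVec_self hn (by omega)]
    have : pairSign n (n - 1) * -I * I = pairSign n (n - 1) := by rw [mul_assoc]; simp
    rw [this]
    module
  · intro j hj
    obtain ⟨h1, h2⟩ := Finset.mem_Ico.mp hj
    rw [bil_pairVec_of_ne hn (l := n - 1) (k := j - 1) (by omega) (by omega)]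
    by_cases hjk : j = n - 1
    · have h0 : n - 1 ≠ 0 := by omega
      have h3 : n - 1 ≠ n := by omega
      rw [hjk, bil_pairVec_self hn (by omega)]
      simp [pairSign, h0, h3]
    · rw [bil_pairVec_of_ne hn (by omega) hjk]; simp

theorem rootSum_mulVec_conj_pair (hn : 1 ≤ n) (c : ℕ → ℂ) {k : ℕ} (hk : 1 ≤ k) (hkn : k < n) :
    rootSum n c *ᵥ pairVec n k (-I) = -(2 * c k) • pairVec n (k - 1) (-I) := by
  have h0 : k ≠ 0 := by omega
  have null : (1 : ℂ) + pairSign n k * (-I) * (-I) = 0 := by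
    simp [pairSign, h0, hkn.ne]
  have two : (1 : ℂ) + pairSign n k * I * (-I) = 2 := by
    simp [pairSign, h0, hkn.ne]; norm_num
  rw [rootSum_mulVec hn, Finset.sum_eq_single k]
  · rw [bil_pairVec_pairVec hn (by omega), bil_pairVec_pairVec hn (by omega),
      bil_pairVec_pairVec hn (by omega), bil_pairVec_pairVec hn (by omega),
      bil_pairVec_pairVec hn (by omega), if_neg (show ¬ n = k by omega),
      if_neg (show ¬ n = k by omega), if_neg (show ¬ k - 1 = k by omega), if_pos rfl, two]
    by_cases h : n - 1 = k
    · rw [if_pos h, h, null]; module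
    · rw [if_neg h]; module
  · intro j hj hjk
    obtain ⟨h1, h2⟩ := Finset.mem_Ico.mp hj
    rw [bil_pairVec_pairVec hn (by omega), bil_pairVec_pairVec hn (by omega), if_neg hjk]
    by_cases h : j - 1 = k
    · rw [if_pos h, h, null]; module
    · rw [if_neg h]; module
  · intro h; exact absurd (Finset.mem_Ico.mpr ⟨hk, hkn⟩) h

theorem rootSum_mulVec_null (hn : 1 ≤ n) (c : ℕ → ℂ) {σ : ℂ} :
    rootSum n c *ᵥ pairVec n n σ =
      -(c 0 * (1 + σ) + c n * (1 - σ)) • pairVec n (n - 1) (-I) := by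
  have h0 : n ≠ 0 := by omega
  rw [rootSum_mulVec hn, Finset.sum_eq_zero]
  · rw [bil_pairVec_pairVec hn (by omega), bil_pairVec_pairVec hn (by omega),
      bil_pairVec_pairVec hn (by omega), if_neg (by omega), if_pos rfl, if_pos rfl]
    simp only [pairSign, h0, if_false, if_true]
    module
  · intro j hj
    obtain ⟨h1, h2⟩ := Finset.mem_Ico.mp hj
    rw [bil_pairVec_pairVec hn (by omega), bil_pairVec_pairVec hn (by omega), if_neg (by omega),
      if_neg (by omega)]
    module

end RootSumAction

/-! ### Moving frames in SO(2n,1). -/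

section Frames

variable {n : ℕ}

theorem bil_eq_dotProduct (x y : CVec n) :
    bil x y = x ⬝ᵥ ((upsilon n).map (fun r : ℝ => (r : ℂ)) *ᵥ y) := by
  have : (upsilon n).map (fun r : ℝ => (r : ℂ)) = diagonal fun i => (lorentzSign n i : ℂ) := by
    rw [upsilon, diagonal_map (by simp)]
  rw [this]
  simp only [bil, dotProduct, mulVec_diagonal]
  exact Finset.sum_congr rfl fun i _ => by ring

theorem soCMat_transpose_mul (g : SOLorentz n) :
    (soCMat g)ᵀ * (upsilon n).map (fun r : ℝ => (r : ℂ)) * soCMat g =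
      (upsilon n).map (fun r : ℝ => (r : ℂ)) := by
  have h := g.2
  change (soMat g)ᵀ * upsilon n * soMat g = upsilon n at h
  have h2 := congrArg (fun M => M.map (fun r : ℝ => (r : ℂ))) h
  have m : ∀ A B : Matrix (Fin (2 * n + 1)) (Fin (2 * n + 1)) ℝ,
      (A * B).map (fun r : ℝ => (r : ℂ)) =
        A.map (fun r : ℝ => (r : ℂ)) * B.map (fun r : ℝ => (r : ℂ)) := by
    intro A B; ext i j; simp [Matrix.mul_apply]
  simpa only [m, transpose_map, soCMat] using h2

theorem bil_soCMat (g : SOLorentz n) (x y : CVec n) :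
    bil (soCMat g *ᵥ x) (soCMat g *ᵥ y) = bil x y := by
  rw [bil_eq_dotProduct, bil_eq_dotProduct]
  conv_rhs => rw [← soCMat_transpose_mul g]
  rw [← mulVec_mulVec, ← mulVec_mulVec, dotProduct_mulVec x, vecMul_transpose]

theorem soCMat_inv_mul (g : SOLorentz n) : soCMat g⁻¹ * soCMat g = 1 := by
  rw [← soCMat_mul, inv_mul_cancel, soCMat_one]

theorem soCMat_mul_inv (g : SOLorentz n) : soCMat g * soCMat g⁻¹ = 1 := by
  rw [← soCMat_mul, mul_inv_cancel, soCMat_one]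

theorem bil_inv_mulVec (g : SOLorentz n) (x y : CVec n) :
    bil (soCMat g⁻¹ *ᵥ x) y = bil x (soCMat g *ᵥ y) := by
  rw [← bil_soCMat g (soCMat g⁻¹ *ᵥ x) y, mulVec_mulVec, soCMat_mul_inv, one_mulVec]

theorem conjVec_soCMat_mulVec (g : SOLorentz n) (x : CVec n) :
    conjVec (soCMat g *ᵥ x) = soCMat g *ᵥ conjVec x := by
  ext i; simp [conjVec, mulVec, dotProduct, soCMat]

variable {U : Set ℂ} {F : ℂ → SOLorentz n}

theorem SmoothFrameOn.contDiffAt_entry (hF : SmoothFrameOn U F) (hU : IsOpen U) {z : ℂ}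
    (hz : z ∈ U) (a b : Fin (2 * n + 1)) : ContDiffAt ℝ ∞ (fun w => soCMat (F w) a b) z :=
  ofRealCLM.contDiff.contDiffAt.comp z ((hF a b).contDiffAt (hU.mem_nhds hz))

theorem SmoothFrameOn.contDiffAt_mulVec (hF : SmoothFrameOn U F) (hU : IsOpen U) {z : ℂ}
    (hz : z ∈ U) (x : CVec n) : ContDiffAt ℝ ∞ (fun w => soCMat (F w) *ᵥ x) z := by
  refine contDiffAt_pi.mpr fun i => ?_
  simp only [mulVec, dotProduct]
  exact ContDiffAt.sum fun j _ => (hF.contDiffAt_entry hU hz i j).mul contDiffAt_const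

theorem SmoothFrameOn.dzVec_mulVec (hF : SmoothFrameOn U F) (hU : IsOpen U) {z : ℂ}
    (hz : z ∈ U) (x : CVec n) :
    dzVec (fun w => soCMat (F w) *ᵥ x) z = soCMat (F z) *ᵥ (logDz F z *ᵥ x) := by
  rw [logDz, mulVec_mulVec, ← Matrix.mul_assoc, soCMat_mul_inv, Matrix.one_mul]
  ext i
  simp only [dzVec, mulVec, dotProduct]
  rw [dz_sum _ fun j _ => ((hF.contDiffAt_entry hU hz i j).mul contDiffAt_const).diffAt]
  refine Finset.sum_congr rfl fun j _ => ?_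
  rw [dz_mul (hF.contDiffAt_entry hU hz i j).diffAt (differentiableAt_const _), dz_const]
  simp [dzMat]

/-- The products ⟨F x, F y⟩ are constant; differentiating them puts F⁻¹F_z in the complexified Lie
algebra. -/
theorem SmoothFrameOn.isSkew_logDz (hF : SmoothFrameOn U F) (hU : IsOpen U) {z : ℂ}
    (hz : z ∈ U) : IsSkew (logDz F z) := by
  intro x y
  have h := dz_bil (hF.contDiffAt_mulVec hU hz x) (hF.contDiffAt_mulVec hU hz y)
  simp only [bil_soCMat, dz_const, hF.dzVec_mulVec hU hz] at h
  linear_combination -h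

/-- The derivative of the coefficients of a vector field in a moving frame. -/
theorem SmoothFrameOn.dz_bil_mulVec (hF : SmoothFrameOn U F) (hU : IsOpen U) {z : ℂ}
    (hz : z ∈ U) {u : ℂ → CVec n} (hu : ContDiffAt ℝ ∞ u z) (x : CVec n) :
    dz (fun w => bil (u w) (soCMat (F w) *ᵥ x)) z =
      bil (dzVec u z) (soCMat (F z) *ᵥ x) +
        bil (u z) (soCMat (F z) *ᵥ (logDz F z *ᵥ x)) := by
  rw [dz_bil hu (hF.contDiffAt_mulVec hU hz x), hF.dzVec_mulVec hU hz]

theorem eq_of_bil_frame (hn : 1 ≤ n) (g : SOLorentz n) {x : CVec n}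
    (h1 : ∀ k < n, bil x (soCMat g *ᵥ pairVec n k I) = 0)
    (h2 : ∀ k < n, bil x (soCMat g *ᵥ pairVec n k (-I)) = 0)
    (h3 : bil x (soCMat g *ᵥ pairVec n n 1) = 0)
    (h4 : bil x (soCMat g *ᵥ pairVec n n (-1)) = 0) : x = 0 := by
  simp only [← bil_inv_mulVec] at h1 h2 h3 h4
  rw [← one_mulVec x, ← soCMat_mul_inv g, ← mulVec_mulVec,
    eq_zero_of_bil_pairVec hn h1 h2 h3 h4, mulVec_zero]

theorem sum_range_odd (G : ℕ → ℂ) (n : ℕ) :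
    ∑ i ∈ Finset.range (2 * n + 1), G i =
      G 0 + ∑ k ∈ Finset.range n, (G (2 * k + 1) + G (2 * k + 2)) := by
  induction n with
  | zero => simp
  | succ n ih =>
    rw [show 2 * (n + 1) + 1 = 2 * n + 1 + 1 + 1 by ring, Finset.sum_range_succ,
      Finset.sum_range_succ, ih, Finset.sum_range_succ]
    ring

/-- A vector orthogonal to all `e_{2k} + i e_{2k+1}`, `k < n`, has square given by its last two
coefficients. -/
theorem bil_self_of_bil_pairVec (hn : 1 ≤ n) {x : CVec n}
    (h1 : ∀ k < n, bil x (pairVec n k I) = 0) :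
    bil x x = bil x (pairVec n n 1) * bil x (pairVec n n (-1)) := by
  set G : ℕ → ℂ := fun i => if h : i < 2 * n + 1 then lorentzSign n ⟨i, h⟩ * x ⟨i, h⟩ * x ⟨i, h⟩
    else 0 with hG
  have e : bil x x = ∑ i ∈ Finset.range (2 * n + 1), G i := by
    rw [← Fin.sum_univ_eq_sum_range]
    exact Finset.sum_congr rfl fun i _ => by simp only [hG, i.isLt, dif_pos]
  have hG0 : G 0 = 0 := by
    have := h1 0 (by omega)
    rw [bil_pairVec_zero hn] at this
    have e : (⟨0, by omega⟩ : Fin (2 * n + 1)) = 0 := rfl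
    simp [hG, e, this]
  obtain ⟨m, rfl⟩ : ∃ m, n = m + 1 := ⟨n - 1, by omega⟩
  rw [e, sum_range_odd, hG0, Finset.sum_range_succ, Finset.sum_eq_zero, zero_add, zero_add,
    bil_pairVec_right _ hn le_rfl, bil_pairVec_right _ hn le_rfl]
  · have a1 : 2 * m + 1 < 2 * (m + 1) + 1 := by omega
    have a2 : 2 * m + 2 < 2 * (m + 1) + 1 := by omega
    simp only [hG, a1, a2, dif_pos, pairSign, lorentzSign]
    have b1 : ¬(2 * m + 1 = 2 * (m + 1)) := by omega
    have b2 : 2 * m + 2 = 2 * (m + 1) := by omega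
    simp [b1, b2]
    have c1 : (⟨2 * (m + 1) - 1, by omega⟩ : Fin (2 * (m + 1) + 1)) = ⟨2 * m + 1, a1⟩ := by
      ext; simp; omega
    rw [c1]
    ring
  · intro k hk
    have hk := Finset.mem_range.mp hk
    have h := h1 (k + 1) (by omega)
    rw [bil_pairVec_right _ (by omega) (by omega)] at h
    have a1 : 2 * k + 1 < 2 * (m + 1) + 1 := by omega
    have a2 : 2 * k + 2 < 2 * (m + 1) + 1 := by omega
    have b1 : ¬(2 * k + 1 = 2 * (m + 1)) := by omega
    have b2 : ¬(2 * k + 2 = 2 * (m + 1)) := by omega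
    have b3 : ¬ (k = m) := by omega
    simp only [hG, a1, a2, dif_pos, lorentzSign, b1, b2, if_false, ofReal_one, one_mul]
    simp only [pairSign, Nat.add_eq_zero_iff, one_ne_zero, and_false, if_false,
      Nat.add_right_cancel_iff, b3, one_mul] at h
    have c1 : (⟨2 * (k + 1) - 1, by omega⟩ : Fin (2 * (m + 1) + 1)) = ⟨2 * k + 1, a1⟩ := by
      ext; simp; omega
    have c2 : (⟨2 * (k + 1), by omega⟩ : Fin (2 * (m + 1) + 1)) = ⟨2 * k + 2, a2⟩ := by
      ext; simp; omega
    rw [c1, c2] at h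
    -- A block a, b with k < n contributes a² + b² = (a - ib)(a + ib), and a + ib is the coefficient
    -- assumed to vanish.
    have hI := I_mul_I
    linear_combination (x ⟨2 * k + 1, a1⟩ - I * x ⟨2 * k + 2, a2⟩) * h +
      (x ⟨2 * k + 2, a2⟩ ^ 2) * hI

end Frames

/-! ### The root coefficient product as the square of ∂_z^n f. -/

section RootProduct

variable {n : ℕ} {f : ℂ → RVec n}

theorem contDiff_complexify (hf : ContDiff ℝ ∞ f) : ContDiff ℝ ∞ (complexify f) :=
  contDiff_pi.mpr fun i => ofRealCLM.contDiff.comp (contDiff_pi.mp hf i)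

theorem contDiffAt_iterate (hf : ContDiff ℝ ∞ f) (k : ℕ) (z : ℂ) :
    ContDiffAt ℝ ∞ (dzVec^[k] (complexify f)) z :=
  contDiffAt_dzVec_iterate (contDiff_complexify hf).contDiffAt k

theorem conjVec_complexify (f : ℂ → RVec n) (z : ℂ) :
    conjVec (complexify f z) = complexify f z := by
  ext i; simp [conjVec, complexify]

theorem bil_complexify_self (hf : ∀ z, f z ∈ deSitter n) (z : ℂ) :
    bil (complexify f z) (complexify f z) = 1 := by
  have h := hf z
  simp only [deSitter, Set.mem_ofPred_eq] at h
  simp only [bil, complexify]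
  exact_mod_cast h

theorem complexify_eq_mulVec_pairVec {g : SOLorentz n} {v : RVec n}
    (h : soMat g *ᵥ Pi.single 0 1 = v) (σ : ℂ) :
    soCMat g *ᵥ pairVec n 0 σ = fun i => (v i : ℂ) := by
  rw [pairVec_zero]
  have : stdVec n 0 = Pi.single 0 1 := by
    ext i
    by_cases h : i = 0
    · subst h; simp [stdVec]
    · have : i.val ≠ 0 := fun e => h (Fin.ext e)
      simp [stdVec, h]
  ext i
  rw [this, ← h]
  simp [soCMat]

/-- The square of `∂_z^n f` in terms of the root coefficients of a primitive frame. -/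
theorem bil_iterate_eq_rootProduct (hn : 1 ≤ n) (hf : ContDiff ℝ ∞ f)
    (hS : ∀ z, f z ∈ deSitter n)
    (hiso : ∀ b : ℕ, 1 ≤ b → b ≤ n → ∀ z,
      bil (dzVec^[b] (complexify f) z) (complexify f z) = 0)
    {U : Set ℂ} (hU : IsOpen U) {F : ℂ → SOLorentz n} (hF : SmoothFrameOn U F)
    (hFf : ∀ z ∈ U, soMat (F z) *ᵥ Pi.single 0 1 = f z)
    {a : ℂ → Fin n → ℂ} {c : ℂ → ℕ → ℂ}
    (hlog : ∀ z ∈ U, logDz F z = torusMat n (a z) + rootSum n (c z)) {z : ℂ} (hz : z ∈ U) :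
    bil (dzVec^[n] (complexify f) z) (dzVec^[n] (complexify f) z) =
      4 ^ n * rootProduct n (c z) := by
  set D : ℕ → ℂ → CVec n := fun m => dzVec^[m] (complexify f) with hD
  have h0 : n ≠ 0 := by omega
  -- Differentiating a relation ⟨∂_z^m f, F p⟩ = 0 that holds on the open set U trades one
  -- derivative of f for one application of F⁻¹F_z to the constant vector p.
  have step : ∀ (m k : ℕ) (σ : ℂ), (∀ z ∈ U, bil (D m z) (soCMat (F z) *ᵥ pairVec n k σ) = 0) →
      ∀ z ∈ U, bil (D (m + 1) z) (soCMat (F z) *ᵥ pairVec n k σ) =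
        -bil (D m z) (soCMat (F z) *ᵥ (torusMat n (a z) *ᵥ pairVec n k σ)) -
        bil (D m z) (soCMat (F z) *ᵥ (rootSum n (c z) *ᵥ pairVec n k σ)) := by
    intro m k σ h z hz
    have e := hF.dz_bil_mulVec hU hz (contDiffAt_iterate hf m z) (pairVec n k σ)
    rw [dz_congr (h := fun _ => 0) (Filter.eventually_of_mem (hU.mem_nhds hz) h), dz_const,
      dzVec_iterate_succ, hlog z hz, add_mulVec, mulVec_add, bil_add_right] at e
    simp only [hD]
    linear_combination -e
  -- If p is a weight vector, the torus part only reproduces the vanishing product, and the root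
  -- part alone remains.
  have step_null : ∀ (m k : ℕ) (σ : ℂ), k ≤ n → (k = 0 ∨ 1 + pairSign n k * σ * σ = 0) →
      (∀ z ∈ U, bil (D m z) (soCMat (F z) *ᵥ pairVec n k σ) = 0) →
      ∀ z ∈ U, bil (D (m + 1) z) (soCMat (F z) *ᵥ pairVec n k σ) =
        -bil (D m z) (soCMat (F z) *ᵥ (rootSum n (c z) *ᵥ pairVec n k σ)) := by
    intro m k σ hk hσ h z hz
    rw [step m k σ h z hz, torusMat_mulVec_pairVec hn _ hk hσ, mulVec_smul, bil_smul_right,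
      h z hz]
    ring
  have init : ∀ k, 1 ≤ k → k ≤ n → ∀ σ, ∀ z ∈ U,
      bil (D 0 z) (soCMat (F z) *ᵥ pairVec n k σ) = 0 := by
    intro k hk hkn σ z hz
    have : D 0 z = soCMat (F z) *ᵥ pairVec n 0 I :=
      (complexify_eq_mulVec_pairVec (hFf z hz) I).symm
    rw [this, bil_soCMat, bil_pairVec_of_ne hn hkn (by omega)]
  -- The products with e_1 start from ⟨f, f⟩ = 1, so they are out of reach of the induction;
  -- isotropy of f is needed here.
  have first : ∀ (m : ℕ) (σ : ℂ), 1 ≤ m → m ≤ n → ∀ z ∈ U,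
      bil (D m z) (soCMat (F z) *ᵥ pairVec n 0 σ) = 0 := by
    intro m σ h1 h2 z hz
    rw [complexify_eq_mulVec_pairVec (hFf z hz)]
    exact hiso m h1 h2 z
  have cI : ∀ {k}, k < n → k = 0 ∨ 1 + pairSign n k * I * I = 0 := fun hk =>
    pair_null hk I_mul_I
  have cmI : ∀ {k}, k < n → k = 0 ∨ 1 + pairSign n k * (-I) * (-I) = 0 := fun hk =>
    pair_null hk (by simp)
  -- coefficients against the vectors of positive level vanish above the diagonal
  have upper : ∀ m k, m < k → k < n → ∀ z ∈ U,
      bil (D m z) (soCMat (F z) *ᵥ pairVec n k (-I)) = 0 := by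
    intro m
    induction m with
    | zero => intro k hk hkn; exact init k hk hkn.le _
    | succ m ih =>
      intro k hk hkn z hz
      rw [step_null m k _ hkn.le (cmI hkn) (ih k (by omega) hkn) z hz,
        rootSum_mulVec_conj_pair hn _ (by omega) hkn, mulVec_smul, bil_smul_right,
        ih (k - 1) (by omega) (by omega) z hz]
      ring
  -- Each passage Ē_{m+1} ↦ -2 c_{m+1} Ē_m contributes one factor 2 c_{m+1}, starting from ⟨f, f⟩ =
  -- 1.
  have diag : ∀ m, m < n → ∀ z ∈ U, bil (D m z) (soCMat (F z) *ᵥ pairVec n m (-I)) =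
      ∏ j ∈ Finset.Ico 1 (m + 1), (2 * c z j) := by
    intro m
    induction m with
    | zero =>
      intro _ z hz
      rw [complexify_eq_mulVec_pairVec (hFf z hz)]
      simpa using! bil_complexify_self hS z
    | succ m ih =>
      intro hm z hz
      rw [step_null m (m + 1) _ hm.le (cmI hm) (upper m (m + 1) (by omega) hm) z hz,
        rootSum_mulVec_conj_pair hn _ (by omega) hm, mulVec_smul, bil_smul_right,
        Nat.add_sub_cancel, ih (by omega) z hz, Finset.prod_Ico_succ_top (b := m + 1) (by omega)]
      ring
  -- N_± is sent to a multiple of Ē_{n-1}, to which the derivatives of order below n - 1 are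
  -- orthogonal.
  have last : ∀ σ : ℂ, σ * σ = 1 → ∀ m < n, ∀ z ∈ U,
      bil (D m z) (soCMat (F z) *ᵥ pairVec n n σ) = 0 := by
    intro σ hσ m
    induction m with
    | zero => intro _; exact init n hn le_rfl σ
    | succ m ih =>
      intro hm z hz
      rw [step_null m n σ le_rfl (pair_null_last hn hσ) (ih (by omega)) z hz,
        rootSum_mulVec_null hn, mulVec_smul, bil_smul_right,
        upper m (n - 1) (by omega) (by omega) z hz]
      ring
  have last' : ∀ σ : ℂ, σ * σ = 1 →
      bil (D n z) (soCMat (F z) *ᵥ pairVec n n σ) =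
        (c z 0 * (1 + σ) + c z n * (1 - σ)) * ∏ j ∈ Finset.Ico 1 n, (2 * c z j) := by
    intro σ hσ
    have e := step_null (n - 1) n σ le_rfl (pair_null_last hn hσ) (last σ hσ (n - 1) (by omega)) z
      hz
    have d := diag (n - 1) (by omega) z hz
    rw [Nat.sub_add_cancel hn] at e d
    rw [e, rootSum_mulVec_null hn, mulVec_smul, bil_smul_right, d]
    ring
  -- The root part sends E_k to E_{k+1}, and E_{n-1} to the span of N_±, so these products remain
  -- zero up to order n.
  have lower : ∀ m, m ≤ n → ∀ k, 1 ≤ k → k < n → ∀ z ∈ U,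
      bil (D m z) (soCMat (F z) *ᵥ pairVec n k I) = 0 := by
    intro m
    induction m with
    | zero => intro _ k hk hkn; exact init k hk hkn.le _
    | succ m ih =>
      intro hm k hk hkn z hz
      rw [step_null m k _ hkn.le (cI hkn) (ih (by omega) k hk hkn) z hz]
      by_cases h : k + 1 < n
      · rw [rootSum_mulVec_pair hn _ h, mulVec_smul, bil_smul_right,
          ih (by omega) (k + 1) (by omega) h z hz]
        ring
      · have : k = n - 1 := by omega
        rw [this, rootSum_mulVec_pair_last hn, mulVec_smul, bil_smul_right, mulVec_add,
          mulVec_smul, mulVec_smul, bil_add_right, bil_smul_right, bil_smul_right,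
          last 1 (by simp) m (by omega) z hz, last (-1) (by simp) m (by omega) z hz]
        ring
  -- In the frame, ∂_z^n f is orthogonal to all E_k with k < n, so its square is the product of its
  -- pairings with N_+ and N_-, which are 2c_0 ∏ 2c_j and 2c_n ∏ 2c_j.
  have q := bil_self_of_bil_pairVec hn (x := soCMat (F z)⁻¹ *ᵥ D n z) (by
    intro k hk
    rw [bil_inv_mulVec]
    rcases Nat.eq_zero_or_pos k with rfl | hk0
    · exact first n I hn le_rfl z hz
    · exact lower n le_rfl k hk0 hk z hz)
  rw [bil_soCMat, bil_inv_mulVec, bil_inv_mulVec, last' 1 (by simp), last' (-1) (by simp)] at q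
  change bil (D n z) (D n z) = _
  rw [q, rootProduct, Finset.prod_mul_distrib, Finset.prod_pow, Finset.prod_const,
    Nat.card_Ico]
  obtain ⟨m, rfl⟩ : ∃ m, n = m + 1 := ⟨n - 1, by omega⟩
  simp only [Nat.add_sub_cancel, pow_succ]
  have : (4 : ℂ) ^ m = 2 ^ m * 2 ^ m := by rw [← mul_pow]; norm_num
  rw [this]
  ring

end RootProduct

/-! ### Holomorphy of ⟨∂_z^n f, ∂_z^n f⟩ and Liouville. -/

section Holomorphic

variable {n : ℕ} {f : ℂ → RVec n}

/-- The derivatives of a harmonic map with isotropy order `n - 1` satisfy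
`⟨∂_z̄ ∂_z^{k+1} f, ∂_z^b f⟩ = 0` for `b ≥ 1`, `k + b ≤ 2n - 1`. -/
theorem bil_dzbar_iterate (hharm : IsHarmonicMap f)
    (hiso : ∀ a b : ℕ, 1 ≤ a + b → a + b ≤ 2 * n - 1 → ∀ z,
      bil (dzVec^[a] (complexify f) z) (dzVec^[b] (complexify f) z) = 0) (k : ℕ) :
    ∀ b, 1 ≤ b → k + b ≤ 2 * n - 1 → ∀ z,
      bil (dzbarVec (dzVec^[k + 1] (complexify f)) z) (dzVec^[b] (complexify f) z) = 0 := by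
  induction k with
  | zero =>
    intro b hb hbn z
    have h := hharm.tension z
    rw [show dzVec^[0 + 1] (complexify f) = dzVec (complexify f) from rfl, h, bil_smul_left]
    have := hiso 0 b (by omega) (by omega) z
    rw [Function.iterate_zero, id] at this
    rw [this, mul_zero]
  | succ k ih =>
    intro b hb hbn z
    have s := contDiffAt_iterate hharm.smooth (k + 1) z
    -- Differentiate the relation for k and commute ∂_z with ∂_z̄; the term in which ∂_z^b f is
    -- differentiated vanishes by the relation for b + 1.
    have e := dz_bil (contDiffAt_dzbarVec s) (contDiffAt_iterate hharm.smooth b z)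
    have e0 : (fun w => bil (dzbarVec (dzVec^[k + 1] (complexify f)) w)
        (dzVec^[b] (complexify f) w)) = fun _ => 0 := funext (ih b hb (by omega))
    rw [e0, dz_const, dzVec_iterate_succ, ih (b + 1) (by omega) (by omega) z,
      ← dzbarVec_dzVec_comm s, show dzVec (dzVec^[k + 1] (complexify f)) =
        dzVec^[k + 1 + 1] (complexify f) from funext fun w => dzVec_iterate_succ _ _ w] at e
    linear_combination -e

theorem periodic_iterate {l : ℂ} (hp : ∀ z, f (z + l) = f z) (k : ℕ) :
    ∀ z, dzVec^[k] (complexify f) (z + l) = dzVec^[k] (complexify f) z := by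
  induction k with
  | zero => intro z; ext i; simp [complexify, hp z]
  | succ k ih =>
    intro z
    rw [← dzVec_iterate_succ, ← dzVec_translate, ← dzVec_iterate_succ]
    exact dzVec_congr (Filter.Eventually.of_forall ih)

/-- For a doubly periodic superconformal harmonic map, `⟨∂_z^n f, ∂_z^n f⟩` is constant. -/
theorem bil_iterate_const_of_periodic (hn : 1 ≤ n) (hharm : IsHarmonicMap f)
    (hiso : ∀ a b : ℕ, 1 ≤ a + b → a + b ≤ 2 * n - 1 → ∀ z,
      bil (dzVec^[a] (complexify f) z) (dzVec^[b] (complexify f) z) = 0)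
    (Λ : Submodule ℤ ℂ) [DiscreteTopology Λ] [IsZLattice ℝ Λ] (hp : LatticePeriodic Λ f) (z : ℂ) :
    bil (dzVec^[n] (complexify f) z) (dzVec^[n] (complexify f) z) =
      bil (dzVec^[n] (complexify f) 0) (dzVec^[n] (complexify f) 0) := by
  set H : ℂ → ℂ := fun z => bil (dzVec^[n] (complexify f) z) (dzVec^[n] (complexify f) z) with hH
  have hs : ∀ z, ContDiffAt ℝ ∞ H z := fun z =>
    contDiffAt_bil (contDiffAt_iterate hharm.smooth n z) (contDiffAt_iterate hharm.smooth n z)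
  have hd : Differentiable ℂ H := by
    intro w
    refine differentiableAt_of_dzbar_eq_zero (hs w).diffAt ?_
    have s := contDiffAt_iterate hharm.smooth n w
    -- This is the extreme admissible case k + b = 2n - 1; it says that ⟨∂_z̄ ∂_z^n f, ∂_z^n f⟩ = 0,
    -- which is half of ∂_z̄ H.
    have e := bil_dzbar_iterate hharm hiso (n - 1) n hn (by omega) w
    rw [Nat.sub_add_cancel hn] at e
    rw [hH, dzbar_bil s s, bil_comm _ (dzbarVec _ w), e, add_zero]
  have hc : Continuous H := hd.continuous
  have hb := (IsZLattice.isCompact_range_of_periodic Λ H hc fun w l hl => by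
    simp only [hH, periodic_iterate (hp l hl) n w]).isBounded
  exact hd.apply_eq_apply_of_bounded hb z 0

theorem isotropy_of_superconformal (hn : 1 ≤ n) (h : IsSuperconformal f) (a b : ℕ)
    (h1 : 1 ≤ a + b) (h2 : a + b ≤ 2 * n - 1) (z : ℂ) :
    bil (dzVec^[a] (complexify f) z) (dzVec^[b] (complexify f) z) = 0 :=
  h.1 a b h1 (by omega) z

/-- The root coefficient product of every cyclic primitive frame is `4⁻ⁿ ⟨∂_z^n f, ∂_z^n f⟩`. -/
theorem IsCyclicPrimitiveFrame.bil_iterate (hn : 1 ≤ n) (hharm : IsHarmonicMap f)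
    (hsuper : IsSuperconformal f) {U : Set ℂ} {F : ℂ → SOLorentz n} {c : ℂ → ℕ → ℂ}
    (hF : IsCyclicPrimitiveFrame U f F c) {z : ℂ} (hz : z ∈ U) :
    bil (dzVec^[n] (complexify f) z) (dzVec^[n] (complexify f) z) =
      4 ^ n * rootProduct n (c z) := by
  choose! a ha using hF.primitive
  refine bil_iterate_eq_rootProduct hn hharm.smooth hharm.mem_deSitter ?_ hF.isOpen hF.smooth
    hF.frame ha hz
  intro b hb hbn w
  exact isotropy_of_superconformal hn hsuper b 0 (by omega) (by omega) w

theorem exists_rootProductConstant_of_periodic (hn : 1 ≤ n) (hharm : IsHarmonicMap f)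
    (hsuper : IsSuperconformal f) (Λ : Submodule ℤ ℂ) [DiscreteTopology Λ] [IsZLattice ℝ Λ]
    (hp : LatticePeriodic Λ f) : ∃ K : ℂ, RootProductConstant f K := by
  refine ⟨bil (dzVec^[n] (complexify f) 0) (dzVec^[n] (complexify f) 0) / 4 ^ n, ?_⟩
  intro U F c hF z hz
  rw [← bil_iterate_const_of_periodic hn hharm (isotropy_of_superconformal hn hsuper) Λ hp z,
    hF.bil_iterate hn hharm hsuper hz]
  field_simp

end Holomorphic

/-! ### Structure equations of the harmonic sequence. -/

section HarmonicSequence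

variable {n : ℕ} {f : ℂ → RVec n} {s : ℕ → ℂ → CVec n} {V : Set ℂ}

/-- The recursion of the harmonic sequence, without the continuity requirement. -/
def IsHarmonicSequence (f : ℂ → RVec n) (s : ℕ → ℂ → CVec n) : Prop :=
  s 0 = complexify f ∧ ∀ j < n, ∀ z, (hermSq (s j z) = 0 → s j z = 0) ∧
    (hermSq (s j z) ≠ 0 → s (j + 1) z = dzVec (s j) z -
      (bil (dzVec (s j) z) (conjVec (s j z)) / hermSq (s j z)) • s j z)

theorem dz_eq_zero_on {g : ℂ → ℂ} (hV : IsOpen V) (hg : ∀ z ∈ V, g z = 0) {z : ℂ} (hz : z ∈ V) :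
    dz g z = 0 := by
  rw [dz_congr (h := fun _ => 0) (Filter.eventually_of_mem (hV.mem_nhds hz) hg), dz_const]

theorem dzbar_eq_zero_on {g : ℂ → ℂ} (hV : IsOpen V) (hg : ∀ z ∈ V, g z = 0) {z : ℂ}
    (hz : z ∈ V) : dzbar g z = 0 := by
  rw [dzbar_congr (h := fun _ => 0) (Filter.eventually_of_mem (hV.mem_nhds hz) hg), dzbar_const]

/-- Differentiating ⟨∂_z^{n-i-1} f, ∂_z^{n+i} f⟩ = 0, of total order 2n - 1, moves a derivative from
one side to the other at the cost of a sign. -/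
theorem bil_iterate_anti (hf : ContDiff ℝ ∞ f)
    (hiso : ∀ a b : ℕ, 1 ≤ a + b → a + b ≤ 2 * n - 1 → ∀ z,
      bil (dzVec^[a] (complexify f) z) (dzVec^[b] (complexify f) z) = 0) (i : ℕ) (hi : i < n)
    (z : ℂ) :
    bil (dzVec^[n - i] (complexify f) z) (dzVec^[n + i] (complexify f) z) =
      (-1) ^ i * bil (dzVec^[n] (complexify f) z) (dzVec^[n] (complexify f) z) := by
  induction i with
  | zero => simp
  | succ i ih =>
    have e := dz_bil (contDiffAt_iterate hf (n - (i + 1)) z) (contDiffAt_iterate hf (n + i) z)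
    rw [dz_eq_zero_on isOpen_univ (fun w _ => hiso _ _ (by omega) (by omega) w) (Set.mem_univ z),
      dzVec_iterate_succ, dzVec_iterate_succ, show n - (i + 1) + 1 = n - i by omega,
      ih (by omega)] at e
    rw [pow_succ]
    linear_combination -e

theorem IsHarmonicSequence.hermSq_zero (hs : IsHarmonicSequence f s)
    (hS : ∀ z, f z ∈ deSitter n) (z : ℂ) : hermSq (s 0 z) = 1 := by
  rw [hermSq, hs.1, conjVec_complexify, bil_complexify_self hS]

/-- Since ⟨∂_z f, f⟩ = 0, the first projection removes nothing. -/
theorem IsHarmonicSequence.one (hn : 1 ≤ n) (hs : IsHarmonicSequence f s)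
    (hS : ∀ z, f z ∈ deSitter n)
    (hiso : ∀ a b : ℕ, 1 ≤ a + b → a + b ≤ 2 * n - 1 → ∀ z,
      bil (dzVec^[a] (complexify f) z) (dzVec^[b] (complexify f) z) = 0) :
    s 1 = dzVec (complexify f) := by
  ext1 z
  have h := (hs.2 0 hn z).2 (by rw [hs.hermSq_zero hS]; exact one_ne_zero)
  have := hiso 1 0 (by omega) (by omega) z
  rw [zero_add, hs.hermSq_zero hS, hs.1, conjVec_complexify] at h
  simp only [Function.iterate_one, Function.iterate_zero, id] at this
  rw [h, this]; simp

/-- Where `⟨∂_z^n f, ∂_z^n f⟩ ≠ 0` the harmonic sequence is smooth, and it has the same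
pairings with the derivatives of `f` as these derivatives have among each other. -/
theorem IsHarmonicSequence.smooth_pairing (hn : 1 ≤ n) (hs : IsHarmonicSequence f s)
    (hf : ContDiff ℝ ∞ f) (hS : ∀ z, f z ∈ deSitter n)
    (hiso : ∀ a b : ℕ, 1 ≤ a + b → a + b ≤ 2 * n - 1 → ∀ z,
      bil (dzVec^[a] (complexify f) z) (dzVec^[b] (complexify f) z) = 0)
    (hV : IsOpen V) (hH : ∀ z ∈ V,
      bil (dzVec^[n] (complexify f) z) (dzVec^[n] (complexify f) z) ≠ 0)
    (j : ℕ) (hj : 1 ≤ j) : j ≤ n → ∀ z ∈ V, ContDiffAt ℝ ∞ (s j) z ∧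
      (∀ b, j + b < 2 * n → bil (s j z) (dzVec^[b] (complexify f) z) = 0) ∧
      bil (s j z) (dzVec^[2 * n - j] (complexify f) z) ≠ 0 := by
  induction j, hj using Nat.le_induction with
  | base =>
    intro _ z hz
    rw [hs.one hn hS hiso]
    refine ⟨contDiffAt_iterate hf 1 z, fun b hb => hiso 1 b (by omega) (by omega) z, ?_⟩
    have := bil_iterate_anti hf hiso (n - 1) (by omega) z
    rw [show n - (n - 1) = 1 by omega, show n + (n - 1) = 2 * n - 1 by omega,
      Function.iterate_one] at this
    rw [this]
    exact mul_ne_zero (pow_ne_zero _ (by simp)) (hH z hz)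
  | succ j hj ih =>
    intro hjn
    have ih := ih (by omega)
    have hne : ∀ z ∈ V, hermSq (s j z) ≠ 0 := by
      -- At such a point f_j would be null and hence zero, because the sequence is everywhere
      -- defined; this contradicts the non-zero pairing with ∂_z^{2n-j} f.
      intro z hz h0
      have h := (ih z hz).2.2
      rw [(hs.2 j (by omega) z).1 h0, bil_zero_left] at h
      exact h rfl
    have hform : ∀ z ∈ V, s (j + 1) z = dzVec (s j) z -
        (bil (dzVec (s j) z) (conjVec (s j z)) / hermSq (s j z)) • s j z := fun z hz =>
      (hs.2 j (by omega) z).2 (hne z hz)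
    intro z hz
    have sm := (ih z hz).1
    -- f_{j+1} and ∂_z f_j differ by a multiple of f_j, which is orthogonal to ∂_z^b f; integrating
    -- by parts moves the derivative onto ∂_z^b f.
    have key : ∀ b, j + b < 2 * n → bil (s (j + 1) z) (dzVec^[b] (complexify f) z) =
        -bil (s j z) (dzVec^[b + 1] (complexify f) z) := by
      intro b hb
      have e := dz_bil sm (contDiffAt_iterate hf b z)
      rw [dz_eq_zero_on hV (fun w hw => (ih w hw).2.1 b hb) hz, dzVec_iterate_succ] at e
      rw [hform z hz, bil_sub_left, bil_smul_left, (ih z hz).2.1 b hb]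
      linear_combination -e
    refine ⟨?_, ?_, ?_⟩
    · have e : s (j + 1) =ᶠ[𝓝 z] fun w => dzVec (s j) w -
          (bil (dzVec (s j) w) (conjVec (s j w)) / hermSq (s j w)) • s j w :=
        Filter.eventually_of_mem (hV.mem_nhds hz) hform
      refine ContDiffAt.congr_of_eventuallyEq ?_ e
      have d := contDiffAt_dzVec sm
      exact d.sub (contDiffAt_smulVec (contDiffAt_div (contDiffAt_bil d (contDiffAt_conjVec sm))
        (contDiffAt_hermSq sm) (hne z hz)) sm)
    · intro b hb
      rw [key b (by omega), (ih z hz).2.1 (b + 1) (by omega), neg_zero]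
    · rw [key _ (by omega), show 2 * n - (j + 1) + 1 = 2 * n - j by omega]
      exact neg_ne_zero.mpr (ih z hz).2.2

/-- A smooth field orthogonal to `∂_z f, …, ∂_z^j f` is orthogonal to the `j`-th entry of the
harmonic sequence. -/
theorem IsHarmonicSequence.bil_eq_zero (hn : 1 ≤ n) (hs : IsHarmonicSequence f s)
    (hf : ContDiff ℝ ∞ f) (hS : ∀ z, f z ∈ deSitter n)
    (hiso : ∀ a b : ℕ, 1 ≤ a + b → a + b ≤ 2 * n - 1 → ∀ z,
      bil (dzVec^[a] (complexify f) z) (dzVec^[b] (complexify f) z) = 0)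
    (hV : IsOpen V) (hsm : ∀ j ≤ n, ∀ z ∈ V, ContDiffAt ℝ ∞ (s j) z)
    (hne : ∀ j < n, ∀ z ∈ V, hermSq (s j z) ≠ 0) (j : ℕ) (hj : 1 ≤ j) :
    j ≤ n → ∀ u : ℂ → CVec n, (∀ z ∈ V, ContDiffAt ℝ ∞ u z) →
      (∀ b, 1 ≤ b → b ≤ j → ∀ z ∈ V, bil (dzVec^[b] (complexify f) z) (u z) = 0) →
      ∀ z ∈ V, bil (s j z) (u z) = 0 := by
  induction j, hj using Nat.le_induction with
  | base =>
    intro _ u _ h z hz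
    rw [hs.one hn hS hiso]
    exact h 1 le_rfl le_rfl z hz
  | succ j hj ih =>
    intro hjn u hu h z hz
    have h1 := ih (by omega) u hu fun b hb hbj => h b hb (by omega)
    -- The induction runs over all fields u precisely so that it can be applied to ∂_z u, which
    -- satisfies one orthogonality relation fewer.
    have h2 := ih (by omega) (dzVec u) (fun w hw => contDiffAt_dzVec (hu w hw)) (by
      intro b hb hbj w hw
      have e := dz_bil (contDiffAt_iterate hf b w) (hu w hw)
      rw [dz_eq_zero_on hV (h b hb (by omega)) hw, dzVec_iterate_succ,
        h (b + 1) (by omega) (by omega) w hw] at e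
      linear_combination -e)
    have e := dz_bil (hsm j (by omega) z hz) (hu z hz)
    rw [dz_eq_zero_on hV h1 hz, h2 z hz] at e
    rw [(hs.2 j (by omega) z).2 (hne j (by omega) z hz), bil_sub_left, bil_smul_left, h1 z hz]
    linear_combination -e

/-- There is only one negative direction: isotropy expresses x_{2n+1}² as the sum of the other x_i²,
and the triangle inequality bounds |x_{2n+1}|² by the sum of their |x_i|². -/
theorem hermSq_re_nonneg_of_isotropic {x : CVec n} (h0 : bil x x = 0) : 0 ≤ (hermSq x).re := by
  have hlast : ∀ y : Fin (2 * n + 1) → ℂ, ∑ i, (lorentzSign n i : ℂ) * y i =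
      ∑ i : Fin (2 * n), y i.castSucc - y (Fin.last _) := by
    intro y
    rw [Fin.sum_univ_castSucc, sub_eq_add_neg]
    congr 1
    · refine Finset.sum_congr rfl fun i _ => ?_
      have : i.val ≠ 2 * n := i.isLt.ne
      simp [lorentzSign, this]
    · simp [lorentzSign]
  have e1 : x (Fin.last _) * x (Fin.last _) = ∑ i : Fin (2 * n), x i.castSucc * x i.castSucc := by
    have := hlast fun i => x i * x i
    simp only [bil, mul_assoc] at h0
    rw [h0] at this
    linear_combination this
  have e2 : (hermSq x).re = ∑ i : Fin (2 * n), ‖x i.castSucc‖ ^ 2 - ‖x (Fin.last _)‖ ^ 2 := by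
    have := hlast fun i => x i * (starRingEnd ℂ) (x i)
    have e : hermSq x = ∑ i, (lorentzSign n i : ℂ) * (x i * (starRingEnd ℂ) (x i)) := by
      simp [hermSq, bil, conjVec, mul_assoc]
    rw [e, this]
    simp only [mul_conj', ← ofReal_pow, ← ofReal_sum, ← ofReal_sub, ofReal_re]
  have e3 : ‖x (Fin.last _)‖ ^ 2 ≤ ∑ i : Fin (2 * n), ‖x i.castSucc‖ ^ 2 := by
    rw [← norm_pow, sq, e1]
    refine (norm_sum_le _ _).trans (le_of_eq ?_)
    exact Finset.sum_congr rfl fun i _ => by rw [norm_mul, sq]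
  rw [e2]; linarith

/-- The properties of the harmonic sequence over an open set on which `f_0, …, f_{n-1}` have no
zeros. -/
structure IsHarmonicSequenceOn (V : Set ℂ) (f : ℂ → RVec n) (s : ℕ → ℂ → CVec n) : Prop where
  isOpen : IsOpen V
  zero : s 0 = complexify f
  smooth : ∀ j ≤ n, ∀ z ∈ V, ContDiffAt ℝ ∞ (s j) z
  pos : ∀ j < n, ∀ z ∈ V, 0 < (hermSq (s j z)).re
  iso : ∀ i ≤ n, ∀ j ≤ n, 1 ≤ i + j → i + j < 2 * n → ∀ z ∈ V, bil (s i z) (s j z) = 0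
  orth : ∀ i ≤ n, ∀ j ≤ n, i ≠ j → ∀ z ∈ V, bil (s i z) (conjVec (s j z)) = 0
  dz : ∀ j < n, ∀ z ∈ V, dzVec (s j) z =
    s (j + 1) z + (dz (fun w => hermSq (s j w)) z / hermSq (s j z)) • s j z
  dzbar : ∀ j < n, ∀ z ∈ V, dzbarVec (s (j + 1)) z =
    (-(hermSq (s (j + 1) z) / hermSq (s j z))) • s j z

/-- Non-vanishing of H supplies smoothness and excludes zeros, isotropy passes from the derivatives
of f to the f_j, and harmonicity enters through ∂_z̄ f_1 = -‖f_1‖² f. The remaining ∂_z̄-equations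
come from commuting ∂_z and ∂_z̄. -/
theorem IsHarmonicSequence.on (hn : 1 ≤ n) (hs : IsHarmonicSequence f s)
    (hharm : IsHarmonicMap f)
    (hiso : ∀ a b : ℕ, 1 ≤ a + b → a + b ≤ 2 * n - 1 → ∀ z,
      bil (dzVec^[a] (complexify f) z) (dzVec^[b] (complexify f) z) = 0)
    (hV : IsOpen V) (hH : ∀ z ∈ V,
      bil (dzVec^[n] (complexify f) z) (dzVec^[n] (complexify f) z) ≠ 0) :
    IsHarmonicSequenceOn V f s := by
  have hf := hharm.smooth
  have hS := hharm.mem_deSitter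
  have P := hs.smooth_pairing hn hf hS hiso hV hH
  have s1 := hs.one hn hS hiso
  have sm : ∀ j ≤ n, ∀ z ∈ V, ContDiffAt ℝ ∞ (s j) z := by
    intro j hj z hz
    rcases Nat.eq_zero_or_pos j with rfl | h
    · rw [hs.1]; exact (contDiff_complexify hf).contDiffAt
    · exact (P j h hj z hz).1
  have ne : ∀ j < n, ∀ z ∈ V, hermSq (s j z) ≠ 0 := by
    intro j hj z hz h0
    rcases Nat.eq_zero_or_pos j with rfl | h
    · rw [hs.hermSq_zero hS] at h0; exact one_ne_zero h0
    · have h := (P j h hj.le z hz).2.2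
      rw [(hs.2 j hj z).1 h0, bil_zero_left] at h
      exact h rfl
  have form : ∀ j < n, ∀ z ∈ V, dzVec (s j) z = s (j + 1) z +
      (bil (dzVec (s j) z) (conjVec (s j z)) / hermSq (s j z)) • s j z := by
    intro j hj z hz
    rw [(hs.2 j hj z).2 (ne j hj z hz)]; abel
  have iso' : ∀ i ≤ n, ∀ j ≤ n, 1 ≤ j → i + j < 2 * n → ∀ z ∈ V, bil (s j z) (s i z) = 0 := by
    intro i hi j hj h1 h2
    refine hs.bil_eq_zero hn hf hS hiso hV sm ne j h1 hj (s i) (sm i hi) ?_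
    intro b hb hbj z hz
    rw [bil_comm]
    rcases Nat.eq_zero_or_pos i with rfl | h
    · rw [hs.1]
      exact hiso 0 b (by omega) (by omega) z
    · exact (P i h hi z hz).2.1 b (by omega)
  have iso : ∀ i ≤ n, ∀ j ≤ n, 1 ≤ i + j → i + j < 2 * n → ∀ z ∈ V,
      bil (s i z) (s j z) = 0 := by
    intro i hi j hj h1 h2 z hz
    rcases Nat.eq_zero_or_pos i with rfl | h
    · rw [bil_comm]; exact iso' 0 hi j hj (by omega) h2 z hz
    · exact iso' j hj i hi h (by omega) z hz
  have smc : ∀ j ≤ n, ∀ z ∈ V, ContDiffAt ℝ ∞ (fun w => conjVec (s j w)) z := fun j hj z hz =>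
    contDiffAt_conjVec (sm j hj z hz)
  have dbar0 : ∀ z, dzbarVec (s 0) z = conjVec (s 1 z) := by
    intro z
    have h := dzbarVec_conj (u := complexify f) (z := z) (contDiff_complexify hf).contDiffAt
    simp only [conjVec_complexify] at h
    rw [hs.1, s1]
    exact h
  -- Hermitian orthogonality to earlier entries and the ∂_z̄-equation are proved in one induction,
  -- since each uses the other at lower levels: ∂_z f̄_i is the conjugate of ∂_z̄ f_i, a multiple of
  -- f_{i-1}.
  have T : ∀ j ≤ n, (∀ i < j, ∀ z ∈ V, bil (s j z) (conjVec (s i z)) = 0) ∧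
      ∀ i, j = i + 1 → ∀ z ∈ V, dzbarVec (s j) z = (-(hermSq (s j z) / hermSq (s i z))) • s i z :=
      by
    intro j
    induction j using Nat.strong_induction_on with
    | _ j ih =>
      intro hjn
      rcases Nat.eq_zero_or_pos j with rfl | hj0
      · exact ⟨fun i hi => absurd hi (by omega), fun i hi => absurd hi (by omega)⟩
      obtain ⟨m, rfl⟩ : ∃ m, j = m + 1 := ⟨j - 1, by omega⟩
      have orth : ∀ i < m + 1, ∀ z ∈ V, bil (s (m + 1) z) (conjVec (s i z)) = 0 := by
        intro i hi z hz
        have hm := form m (by omega) z hz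
        by_cases him : i = m
        · subst him
          rw [(hs.2 i (by omega) z).2 (ne i (by omega) z hz), bil_sub_left, bil_smul_left]
          change _ - _ / _ * hermSq (s i z) = 0
          rw [div_mul_cancel₀ _ (ne i (by omega) z hz), sub_self]
        · have him : i < m := by omega
          have o := (ih m (by omega) (by omega)).1 i him
          have e := dz_bil (sm m (by omega) z hz) (smc i (by omega) z hz)
          rw [dz_eq_zero_on hV o hz, dzVec_conj (sm i (by omega) z hz), hm, bil_add_left,
            bil_smul_left, o z hz] at e
          have e2 : bil (s m z) (conjVec (dzbarVec (s i) z)) = 0 := by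
            rcases Nat.eq_zero_or_pos i with rfl | hi0
            · rw [dbar0, conjVec_conjVec]
              exact iso m (by omega) 1 (by omega) (by omega) (by omega) z hz
            · obtain ⟨l, rfl⟩ : ∃ l, i = l + 1 := ⟨i - 1, by omega⟩
              rw [(ih (l + 1) (by omega) (by omega)).2 l rfl z hz, conjVec_smul, bil_smul_right,
                (ih m (by omega) (by omega)).1 l (by omega) z hz, mul_zero]
          rw [e2] at e
          linear_combination -e
      refine ⟨orth, fun i hi z hz => ?_⟩
      obtain rfl : i = m := by omega
      have smi := sm i (by omega) z hz
      have w1 : bil (dzbarVec (s (i + 1)) z) (conjVec (s i z)) = -hermSq (s (i + 1) z) := by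
        have e := dzbar_bil (sm (i + 1) hjn z hz) (smc i (by omega) z hz)
        rw [dzbar_eq_zero_on hV (orth i (by omega)) hz, dzbarVec_conj smi, form i (by omega) z hz,
          conjVec_add, conjVec_smul, bil_add_right, bil_smul_right, orth i (by omega) z hz] at e
        rw [hermSq]
        linear_combination -e
      rcases Nat.eq_zero_or_pos i with rfl | hi0
      · have t := hharm.tension z
        rw [hs.hermSq_zero hS, zero_add, s1, t, hs.1, div_one]
        rw [zero_add, hs.1, s1, conjVec_complexify] at w1
        rw [w1]
      · obtain ⟨l, rfl⟩ : ∃ l, i = l + 1 := ⟨i - 1, by omega⟩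
        have sml := sm l (by omega) z hz
        have w2 : bil (dzbarVec (s (l + 1 + 1)) z) (conjVec (s l z)) = 0 := by
          have e := dzbar_bil (sm (l + 1 + 1) hjn z hz) (smc l (by omega) z hz)
          rw [dzbar_eq_zero_on hV (orth l (by omega)) hz, dzbarVec_conj sml,
            form l (by omega) z hz, conjVec_add, conjVec_smul, bil_add_right, bil_smul_right,
            orth l (by omega) z hz, orth (l + 1) (by omega) z hz] at e
          linear_combination -e
        -- Commuting ∂_z̄ past ∂_z in f_{l+2} = ∂_z f_{l+1} - q f_{l+1} leaves only f_{l+1} and f_l.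
        -- The two coefficients are then found by pairing with the conjugates of these, as computed
        -- in `w1` and `w2`.
        obtain ⟨α, β, hw⟩ : ∃ α β : ℂ,
            dzbarVec (s (l + 1 + 1)) z = α • s (l + 1) z + β • s l z := by
          have D := (ih (l + 1) (by omega) (by omega)).2 l rfl
          have e1 : dzbarVec (s (l + 1 + 1)) z = dzbarVec (fun w => dzVec (s (l + 1)) w +
              (-(bil (dzVec (s (l + 1)) w) (conjVec (s (l + 1) w)) / hermSq (s (l + 1) w))) •
                s (l + 1) w) z := by
            refine dzbarVec_congr (Filter.eventually_of_mem (hV.mem_nhds hz) fun w hw => ?_)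
            rw [(hs.2 (l + 1) (by omega) w).2 (ne (l + 1) (by omega) w hw),
              sub_eq_add_neg, ← neg_smul]
          have smd := contDiffAt_dzVec smi
          have smq : ContDiffAt ℝ ∞ (fun w => -(bil (dzVec (s (l + 1)) w)
              (conjVec (s (l + 1) w)) / hermSq (s (l + 1) w))) z :=
            (contDiffAt_div (contDiffAt_bil smd (contDiffAt_conjVec smi)) (contDiffAt_hermSq smi)
              (ne (l + 1) (by omega) z hz)).neg
          have smr : ContDiffAt ℝ ∞ (fun w => -(hermSq (s (l + 1) w) / hermSq (s l w))) z :=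
            (contDiffAt_div (contDiffAt_hermSq smi) (contDiffAt_hermSq sml)
              (ne l (by omega) z hz)).neg
          rw [dzbarVec_add smd (contDiffAt_smulVec smq smi), dzbarVec_smul smq smi,
            dzbarVec_dzVec_comm smi,
            D z hz, dzVec_congr (Filter.eventually_of_mem (hV.mem_nhds hz) D),
            dzVec_smul smr sml, form l (by omega) z hz] at e1
          exact ⟨_, _, e1.trans (by
            simp only [smul_add, smul_smul]
            rw [show ∀ a b c d e : CVec n, a + (b + c) + (d + e) = (b + d) + (a + c + e) by
              intros; abel, ← add_smul, ← add_smul, ← add_smul])⟩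
        have o1 := (ih (l + 1) (by omega) (by omega)).1 l (by omega) z hz
        have o2 : bil (s l z) (conjVec (s (l + 1) z)) = 0 := by
          rw [bil_comm, bil_conj_left, o1, map_zero]
        rw [hw, bil_add_left, bil_smul_left, bil_smul_left] at w1 w2
        rw [o1] at w2
        rw [o2] at w1
        have n1 := ne (l + 1) (by omega) z hz
        have n2 := ne l (by omega) z hz
        change α * hermSq (s (l + 1) z) + _ = _ at w1
        change _ + β * hermSq (s l z) = _ at w2
        have hβ : β = 0 := by
          have : β * hermSq (s l z) = 0 := by linear_combination w2
          exact (mul_eq_zero.mp this).resolve_right n2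
        have hα : α = -(hermSq (s (l + 1 + 1) z) / hermSq (s (l + 1) z)) := by
          rw [eq_neg_iff_add_eq_zero, ← mul_left_inj' n1]
          field_simp
          linear_combination w1
        rw [hw, hα, hβ, zero_smul, add_zero]
  have orth : ∀ i ≤ n, ∀ j ≤ n, i ≠ j → ∀ z ∈ V, bil (s i z) (conjVec (s j z)) = 0 := by
    intro i hi j hj hij z hz
    rcases lt_or_gt_of_ne hij with h | h
    · rw [bil_comm, bil_conj_left, (T j hj).1 i h z hz, map_zero]
    · exact (T i hi).1 j h z hz
  refine ⟨hV, hs.1, sm, ?_, iso, orth, ?_, ?_⟩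
  · intro j hj z hz
    rcases Nat.eq_zero_or_pos j with rfl | h
    · rw [hs.hermSq_zero hS]; simp
    -- For 1 ≤ j < n the entry f_j is isotropic, which gives ‖f_j‖² ≥ 0; strictness is the absence
    -- of zeros.
    · have nn := hermSq_re_nonneg_of_isotropic
        (iso j hj.le j hj.le (by omega) (by omega) z hz)
      refine lt_of_le_of_ne nn fun h0 => ne j hj z hz ?_
      rw [hermSq_eq_ofReal_re, ← h0, ofReal_zero]
  · intro j hj z hz
    rw [form j hj z hz]
    congr 3
    have e := dz_bil (sm j hj.le z hz) (smc j hj.le z hz)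
    have e2 : bil (s j z) (conjVec (dzbarVec (s j) z)) = 0 := by
      rcases Nat.eq_zero_or_pos j with rfl | hi0
      · rw [dbar0, conjVec_conjVec]
        exact iso 0 (by omega) 1 (by omega) (by omega) (by omega) z hz
      · obtain ⟨l, rfl⟩ : ∃ l, j = l + 1 := ⟨j - 1, by omega⟩
        rw [(T (l + 1) (by omega)).2 l rfl z hz, conjVec_smul, bil_smul_right,
          (T (l + 1) (by omega)).1 l (by omega) z hz, mul_zero]
    rw [dzVec_conj (sm j hj.le z hz), e2, add_zero] at e
    exact e.symm
  · intro j hj z hz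
    exact (T (j + 1) hj).2 j rfl z hz

end HarmonicSequence

/-! ### Canonical completion of an orthonormal system to a Lorentz frame. -/

section Completion

variable {n : ℕ}

/-- The Minkowski inner product on `ℝ^{2n,1}`. -/
def lor (x y : RVec n) : ℝ := ∑ i, lorentzSign n i * x i * y i

theorem lor_comm (x y : RVec n) : lor x y = lor y x := by
  unfold lor; exact Finset.sum_congr rfl fun i _ => by ring

theorem lor_smul_left (a : ℝ) (x y : RVec n) : lor (a • x) y = a * lor x y := by
  simp only [lor, Finset.mul_sum]
  exact Finset.sum_congr rfl fun i _ => by simp only [Pi.smul_apply, smul_eq_mul]; ring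

theorem lor_smul_right (a : ℝ) (x y : RVec n) : lor x (a • y) = a * lor x y := by
  rw [lor_comm, lor_smul_left, lor_comm]

theorem lor_sub_left (x y w : RVec n) : lor (x - y) w = lor x w - lor y w := by
  simp only [lor, ← Finset.sum_sub_distrib]
  exact Finset.sum_congr rfl fun i _ => by simp only [Pi.sub_apply]; ring

theorem lor_sum_left {ι : Type*} (s : Finset ι) (G : ι → RVec n) (w : RVec n) :
    lor (∑ i ∈ s, G i) w = ∑ i ∈ s, lor (G i) w := by
  simp only [lor, Finset.sum_apply, Finset.mul_sum, Finset.sum_mul]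
  exact Finset.sum_comm

theorem lor_eq_sub (x y : RVec n) :
    lor x y = ∑ i : Fin (2 * n), x i.castSucc * y i.castSucc - x (Fin.last _) * y (Fin.last _) := by
  rw [lor, Fin.sum_univ_castSucc, sub_eq_add_neg]
  congr 1
  · refine Finset.sum_congr rfl fun i _ => ?_
    have : i.val ≠ 2 * n := i.isLt.ne
    simp [lorentzSign, this]
  · simp [lorentzSign]

/-- The orthogonal complement of a timelike vector is spacelike. -/
theorem lor_self_pos_of_orthogonal {x w : RVec n} (hx : lor x x < 0) (hxw : lor x w = 0)
    (hw : w ≠ 0) : 0 < lor w w := by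
  rw [lor_eq_sub] at hx hxw ⊢
  set A := ∑ i : Fin (2 * n), x i.castSucc * x i.castSucc with hA
  set B := ∑ i : Fin (2 * n), w i.castSucc * w i.castSucc with hB
  set C := ∑ i : Fin (2 * n), x i.castSucc * w i.castSucc with hC
  -- With A < t² and C = tr, Cauchy–Schwarz reads t²r² ≤ AB < t²B as soon as B > 0, so r² < B.
  have cs : C ^ 2 ≤ A * B := by
    have := Finset.sum_mul_sq_le_sq_mul_sq Finset.univ (fun i : Fin (2 * n) => x i.castSucc)
      (fun i => w i.castSucc)
    simpa only [hA, hB, hC, sq] using this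
  have hA0 : 0 ≤ A := Finset.sum_nonneg fun i _ => mul_self_nonneg _
  have hB0 : 0 ≤ B := Finset.sum_nonneg fun i _ => mul_self_nonneg _
  set t := x (Fin.last _)
  set r := w (Fin.last _) with hr
  have ht : 0 < t * t := by linarith
  have hC' : C = t * r := by linarith
  rcases hB0.eq_or_lt with h0 | hpos
  · exfalso
    apply hw
    have hi := (Finset.sum_eq_zero_iff_of_nonneg (fun i _ => mul_self_nonneg _)).mp h0.symm
    have hr0 : r = 0 := by
      have : (t * t) * (r * r) ≤ 0 := by rw [← h0, hC'] at cs; nlinarith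
      by_contra h
      have : 0 < r * r := mul_self_pos.mpr h
      nlinarith
    ext i
    refine Fin.lastCases ?_ (fun j => ?_) i
    · exact hr0
    · simpa using hi j (Finset.mem_univ j)
  · rw [hC'] at cs
    by_contra h
    have h1 : B ≤ r * r := by linarith
    have h2 : t * t * (r * r) ≤ A * B := by nlinarith
    have h3 : A * B < t * t * B := mul_lt_mul_of_pos_right (by linarith) hpos
    have h4 : t * t * B ≤ t * t * (r * r) := mul_le_mul_of_nonneg_left h1 ht.le
    linarith

theorem gram_apply (M : Matrix (Fin (2 * n + 1)) (Fin (2 * n + 1)) ℝ) (a b : Fin (2 * n + 1)) :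
    (Mᵀ * upsilon n * M) a b = lor (fun i => M i a) (fun i => M i b) := by
  rw [upsilon, Matrix.mul_apply]
  simp only [mul_diagonal, transpose_apply, lor]
  exact Finset.sum_congr rfl fun i _ => by ring

theorem det_upsilon_ne_zero : (upsilon n).det ≠ 0 := by
  rw [upsilon, det_diagonal]
  refine Finset.prod_ne_zero_iff.mpr fun i _ => ?_
  unfold lorentzSign; split_ifs <;> simp

/-- The last basis vector minus its components along `q_0, …, q_{2n-2}`. -/
def timeRaw (q : ℕ → RVec n) : RVec n :=
  Pi.single (Fin.last _) 1 -
    ∑ m ∈ Finset.range (2 * n - 1), lor (Pi.single (Fin.last _) 1) (q m) • q m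

/-- The unit timelike vector orthogonal to `q_0, …, q_{2n-2}` obtained by projection. -/
noncomputable def timeVec (q : ℕ → RVec n) : RVec n :=
  (√(-lor (timeRaw q) (timeRaw q)))⁻¹ • timeRaw q

/-- The index of the last spacelike column. -/
def lastSpace (n : ℕ) (hn : 1 ≤ n) : Fin (2 * n + 1) := ⟨2 * n - 1, by omega⟩

/-- The matrix with columns `q_0, …, q_{2n-2}, w, timeVec q`. -/
noncomputable def fillMat (hn : 1 ≤ n) (q : ℕ → RVec n) (w : RVec n) :
    Matrix (Fin (2 * n + 1)) (Fin (2 * n + 1)) ℝ :=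
  (Matrix.of fun i j => if j = Fin.last _ then timeVec q i else q j.val i).updateCol
    (lastSpace n hn) w

/-- The cofactor vector completing `q_0, …, q_{2n-2}, timeVec q`. -/
noncomputable def spaceVec (hn : 1 ≤ n) (q : ℕ → RVec n) : RVec n :=
  fun i => lorentzSign n i * adjugate (fillMat hn q 0) (lastSpace n hn) i

/-- The Lorentz frame extending the orthonormal system `q_0, …, q_{2n-2}`. -/
noncomputable def frameMat (hn : 1 ≤ n) (q : ℕ → RVec n) :
    Matrix (Fin (2 * n + 1)) (Fin (2 * n + 1)) ℝ :=
  fillMat hn q (spaceVec hn q)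

variable {hn : 1 ≤ n} {q : ℕ → RVec n}

theorem fillMat_col_of_lt (w : RVec n) {j : Fin (2 * n + 1)} (hj : j.val < 2 * n - 1) :
    (fun i => fillMat hn q w i j) = q j.val := by
  have h1 : j ≠ lastSpace n hn := fun h => by
    have := congrArg Fin.val h; simp only [lastSpace] at this; omega
  have h2 : j ≠ Fin.last _ := fun h => by
    have := congrArg Fin.val h; simp only [Fin.val_last] at this; omega
  ext i
  simp [fillMat, h1, h2]

theorem last_ne_lastSpace : Fin.last (2 * n) ≠ lastSpace n hn := fun h => by
  have := congrArg Fin.val h; simp only [lastSpace, Fin.val_last] at this; omega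

theorem fillMat_col_last (w : RVec n) :
    (fun i => fillMat hn q w i (Fin.last _)) = timeVec q := by
  ext i
  simp [fillMat, last_ne_lastSpace]

theorem fillMat_col_lastSpace (w : RVec n) :
    (fun i => fillMat hn q w i (lastSpace n hn)) = w := by
  ext i
  simp [fillMat]

theorem fillMat_col_eq (w w' : RVec n) {j : Fin (2 * n + 1)} (hj : j ≠ lastSpace n hn) (i) :
    fillMat hn q w i j = fillMat hn q w' i j := by
  simp [fillMat, hj]

/-- Cramer's rule: the signs in `spaceVec` cancel those of the form, so `spaceVec` is the Lorentzian
cross product of the other columns. -/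
theorem lor_spaceVec (w : RVec n) : lor (spaceVec hn q) w = (fillMat hn q w).det := by
  have e : (fillMat hn q 0).updateCol (lastSpace n hn) w = fillMat hn q w := by
    simp [fillMat]
  have hsq : ∀ i, lorentzSign n i * lorentzSign n i = 1 := by
    intro i; unfold lorentzSign; split_ifs <;> norm_num
  rw [← e, ← cramer_apply, cramer_eq_adjugate_mulVec]
  simp only [lor, spaceVec, mulVec, dotProduct]
  exact Finset.sum_congr rfl fun i _ => by rw [← mul_assoc, hsq, one_mul]

theorem index_frame (hn : 1 ≤ n) (j : Fin (2 * n + 1)) :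
    j.val < 2 * n - 1 ∨ j = lastSpace n hn ∨ j = Fin.last _ := by
  have := j.isLt
  by_cases h : j.val < 2 * n - 1
  · exact Or.inl h
  by_cases h2 : j.val = 2 * n - 1
  · exact Or.inr (Or.inl (Fin.ext h2))
  · exact Or.inr (Or.inr (Fin.ext (by simp only [Fin.val_last]; omega)))

theorem lor_timeRaw (horth : ∀ m < 2 * n - 1, ∀ l < 2 * n - 1,
    lor (q m) (q l) = if m = l then 1 else 0) {m : ℕ} (hm : m < 2 * n - 1) :
    lor (timeRaw q) (q m) = 0 := by
  rw [timeRaw, lor_sub_left, lor_sum_left, Finset.sum_eq_single m]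
  · rw [lor_smul_left, horth m hm m hm, if_pos rfl]; ring
  · intro l hl hlm
    rw [lor_smul_left, horth l (Finset.mem_range.mp hl) m hm, if_neg hlm, mul_zero]
  · intro h; exact absurd (Finset.mem_range.mpr hm) h

/-- The square equals -1 - ∑ ⟨e_{2n+1}, q_m⟩², because the q_m are spacelike unit vectors. Thus the
projection never degenerates, and normalising it is smooth and free of choices. -/
theorem lor_timeRaw_self (horth : ∀ m < 2 * n - 1, ∀ l < 2 * n - 1,
    lor (q m) (q l) = if m = l then 1 else 0) : lor (timeRaw q) (timeRaw q) ≤ -1 := by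
  have hee : lor (Pi.single (Fin.last (2 * n)) (1 : ℝ)) (Pi.single (Fin.last _) 1) = -1 := by
    rw [lor_eq_sub, Finset.sum_eq_zero]
    · simp
    · intro i _; simp [(Fin.castSucc_lt_last i).ne]
  have e1 : lor (timeRaw q) (timeRaw q) = lor (timeRaw q) (Pi.single (Fin.last _) 1) := by
    have e2 : ∀ x, lor (timeRaw q) x = lor x (Pi.single (Fin.last _) 1) -
        ∑ m ∈ Finset.range (2 * n - 1),
          lor (Pi.single (Fin.last _) 1) (q m) * lor x (q m) := by
      intro x
      rw [timeRaw, lor_sub_left, lor_sum_left, lor_comm _ x]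
      simp only [lor_smul_left, lor_comm x]
    rw [e2 (timeRaw q), Finset.sum_eq_zero, sub_zero]
    intro m hm
    rw [lor_timeRaw horth (Finset.mem_range.mp hm), mul_zero]
  rw [e1, timeRaw, lor_sub_left, lor_sum_left, hee]
  have : 0 ≤ ∑ i ∈ Finset.range (2 * n - 1),
      lor (lor (Pi.single (Fin.last _) 1) (q i) • q i) (Pi.single (Fin.last _) 1) := by
    refine Finset.sum_nonneg fun i _ => ?_
    rw [lor_smul_left, lor_comm (q i)]
    exact mul_self_nonneg _
  linarith

theorem lor_timeVec (horth : ∀ m < 2 * n - 1, ∀ l < 2 * n - 1,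
    lor (q m) (q l) = if m = l then 1 else 0) {m : ℕ} (hm : m < 2 * n - 1) :
    lor (timeVec q) (q m) = 0 := by
  rw [timeVec, lor_smul_left, lor_timeRaw horth hm, mul_zero]

theorem lor_timeVec_self (horth : ∀ m < 2 * n - 1, ∀ l < 2 * n - 1,
    lor (q m) (q l) = if m = l then 1 else 0) : lor (timeVec q) (timeVec q) = -1 := by
  have h := lor_timeRaw_self horth
  have hp : 0 < -lor (timeRaw q) (timeRaw q) := by linarith
  have h0 : lor (timeRaw q) (timeRaw q) ≠ 0 := by intro h0; linarith
  rw [timeVec, lor_smul_left, lor_smul_right, ← mul_assoc, ← mul_inv,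
    Real.mul_self_sqrt hp.le]
  field_simp

/-- Once w is orthogonal to the other columns, ⟨w, w⟩ is the only entry of the Gram matrix not yet
fixed. -/
theorem gram_fillMat (horth : ∀ m < 2 * n - 1, ∀ l < 2 * n - 1,
    lor (q m) (q l) = if m = l then 1 else 0) {w : RVec n}
    (hw : ∀ j ≠ lastSpace n hn, lor w (fun i => fillMat hn q w i j) = 0) :
    (fillMat hn q w)ᵀ * upsilon n * fillMat hn q w =
      upsilon n * diagonal fun i => if i = lastSpace n hn then lor w w else 1 := by
  have sgnlt : ∀ j : Fin (2 * n + 1), j ≠ Fin.last _ → lorentzSign n j = 1 := by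
    intro j hj
    have : j.val ≠ 2 * n := fun h => hj (Fin.ext h)
    simp [lorentzSign, this]
  ext a b
  rw [gram_apply, upsilon, diagonal_mul_diagonal, diagonal_apply]
  rcases index_frame hn a with ha | rfl | rfl
  · have ha1 : a ≠ lastSpace n hn := fun h => by
      have := congrArg Fin.val h; simp only [lastSpace] at this; omega
    have ha2 : a ≠ Fin.last _ := fun h => by
      have := congrArg Fin.val h; simp only [Fin.val_last] at this; omega
    rcases index_frame hn b with hb | rfl | rfl
    · rw [fillMat_col_of_lt w ha, fillMat_col_of_lt w hb, horth _ ha _ hb, sgnlt a ha2,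
        if_neg ha1, mul_one]
      simp only [Fin.ext_iff]
    · rw [fillMat_col_lastSpace, lor_comm, hw a ha1, if_neg ha1]
    · rw [fillMat_col_of_lt w ha, fillMat_col_last, lor_comm, lor_timeVec horth ha, if_neg ha2]
  · rw [fillMat_col_lastSpace]
    by_cases hb : lastSpace n hn = b
    · subst hb
      rw [fillMat_col_lastSpace, if_pos rfl, if_pos rfl, sgnlt _ last_ne_lastSpace.symm, one_mul]
    · rw [hw b (Ne.symm hb), if_neg hb]
  · rw [fillMat_col_last]
    rcases index_frame hn b with hb | rfl | rfl
    · have hb2 : b ≠ Fin.last _ := fun h => by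
        have := congrArg Fin.val h; simp only [Fin.val_last] at this; omega
      rw [fillMat_col_of_lt w hb, lor_timeVec horth hb, if_neg hb2.symm]
    · have := hw _ last_ne_lastSpace
      rw [fillMat_col_last] at this
      rw [fillMat_col_lastSpace, lor_comm, this, if_neg last_ne_lastSpace]
    · rw [fillMat_col_last, lor_timeVec_self horth, if_pos rfl, if_neg last_ne_lastSpace]
      simp [lorentzSign]

theorem det_fillMat_sq (horth : ∀ m < 2 * n - 1, ∀ l < 2 * n - 1,
    lor (q m) (q l) = if m = l then 1 else 0) {w : RVec n}
    (hw : ∀ j ≠ lastSpace n hn, lor w (fun i => fillMat hn q w i j) = 0) :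
    (fillMat hn q w).det * (fillMat hn q w).det = lor w w := by
  have h := congrArg det (gram_fillMat horth hw)
  rw [det_mul, det_mul, det_mul, det_transpose, det_diagonal, Finset.prod_ite_eq'] at h
  have h0 := det_upsilon_ne_zero (n := n)
  simp only [Finset.mem_univ, if_true] at h
  refine mul_left_cancel₀ h0 ?_
  linear_combination h

theorem lor_spaceVec_col (w : RVec n) {j : Fin (2 * n + 1)} (hj : j ≠ lastSpace n hn) :
    lor (spaceVec hn q) (fun i => fillMat hn q w i j) = 0 := by
  rw [lor_spaceVec]
  refine det_zero_of_column_eq hj fun i => ?_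
  rw [congrFun (fillMat_col_lastSpace _) i, fillMat_col_eq _ w hj]

/-- Let d be the determinant. The cross product property gives ⟨s, s⟩ = d for s = `spaceVec`, and
the Gram matrix gives d² = ⟨s, s⟩, so d² = d. Moreover s is orthogonal to a timelike vector and
non-zero, whence d > 0 and d = 1. -/
theorem det_frameMat (horth : ∀ m < 2 * n - 1, ∀ l < 2 * n - 1,
    lor (q m) (q l) = if m = l then 1 else 0) : (frameMat hn q).det = 1 := by
  have hN : lor (timeVec q) (timeVec q) < 0 := by rw [lor_timeVec_self horth]; norm_num
  have hX : ∀ w, lor (timeVec q) w = 0 → w ≠ 0 → 0 < lor w w := fun w h1 h2 =>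
    lor_self_pos_of_orthogonal hN h1 h2
  -- Putting 0 in the free column makes the system singular and yields a non-zero w orthogonal to
  -- the other columns. Its square is positive, so ⟨s, w⟩, a determinant, is non-zero and s ≠ 0.
  obtain ⟨w, hw0, hw⟩ : ∃ w : RVec n, w ≠ 0 ∧
      ∀ j ≠ lastSpace n hn, lor (fun i => fillMat hn q w i j) w = 0 := by
    have hdet : ((fillMat hn q 0)ᵀ * upsilon n).det = 0 := by
      rw [det_mul, det_transpose, det_eq_zero_of_column_eq_zero (lastSpace n hn)
        fun i => congrFun (fillMat_col_lastSpace _) i, zero_mul]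
    obtain ⟨w, hw0, hw⟩ := exists_mulVec_eq_zero_iff.mpr hdet
    refine ⟨w, hw0, fun j hj => ?_⟩
    have := congrFun hw j
    rw [upsilon] at this
    simp only [mulVec, dotProduct, mul_diagonal, transpose_apply, Pi.zero_apply] at this
    rw [← this, lor]
    exact Finset.sum_congr rfl fun i _ => by rw [fillMat_col_eq w 0 hj]; ring
  have hNw : lor (timeVec q) w = 0 := by
    have := hw _ last_ne_lastSpace
    rwa [fillMat_col_last] at this
  have d1 := det_fillMat_sq horth fun j hj => (lor_comm _ _).trans (hw j hj)
  have hd : (fillMat hn q w).det ≠ 0 := by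
    intro h
    rw [h, mul_zero] at d1
    exact (hX w hNw hw0).ne d1
  rw [← lor_spaceVec] at hd
  have hs0 : spaceVec hn q ≠ 0 := by
    intro h
    rw [h] at hd
    exact hd (by simp [lor])
  have hNs : lor (timeVec q) (spaceVec hn q) = 0 := by
    have := lor_spaceVec_col (hn := hn) (q := q) 0 last_ne_lastSpace
    rwa [fillMat_col_last, lor_comm] at this
  have d2 := det_fillMat_sq horth (w := spaceVec hn q) fun j hj => lor_spaceVec_col _ hj
  have hpos := hX _ hNs hs0
  rw [lor_spaceVec] at d2 hpos
  exact mul_left_cancel₀ hpos.ne' (by rw [mul_one]; exact d2)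

theorem frameMat_gram (horth : ∀ m < 2 * n - 1, ∀ l < 2 * n - 1,
    lor (q m) (q l) = if m = l then 1 else 0) :
    (frameMat hn q)ᵀ * upsilon n * frameMat hn q = upsilon n := by
  have h1 : lor (spaceVec hn q) (spaceVec hn q) = 1 := by
    rw [lor_spaceVec]; exact det_frameMat horth
  rw [frameMat, gram_fillMat horth fun j hj => lor_spaceVec_col _ hj, h1]
  simp

/-- Adapted systems `v_0, …, v_{n-1}`: they have the same products with each other and with their
conjugates as the vectors `e_1` and `e_{2k} + i e_{2k+1}`, `1 ≤ k < n`. -/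
structure IsAdapted (v : ℕ → CVec n) : Prop where
  real : conjVec (v 0) = v 0
  bil : ∀ k < n, ∀ l < n, bil (v k) (v l) = if k = l then 1 - pairSign n k else 0
  bil_conj : ∀ k < n, ∀ l < n,
    _root_.bil (v k) (conjVec (v l)) = if k = l then 1 + pairSign n k else 0

/-- The real and imaginary parts of a system of complex vectors. -/
def realParts (v : ℕ → CVec n) (m : ℕ) : RVec n :=
  if m = 0 ∨ m % 2 = 1 then fun i => (v ((m + 1) / 2) i).re else fun i => (v (m / 2) i).im

theorem lor_re_re (a b : CVec n) : lor (fun i => (a i).re) (fun i => (b i).re) =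
    ((bil a (conjVec b) + bil a b) / 2).re := by
  simp only [lor, bil, conjVec, ← Finset.sum_add_distrib, Finset.sum_div, re_sum]
  refine Finset.sum_congr rfl fun i _ => ?_
  have : ((lorentzSign n i : ℂ) * a i * (starRingEnd ℂ) (b i) + lorentzSign n i * a i * b i) / 2 =
      ((lorentzSign n i : ℝ) * (b i).re : ℝ) * a i := by
    rw [ofReal_mul, re_eq_add_conj]; ring
  rw [this, re_ofReal_mul]; ring

theorem lor_im_re (a b : CVec n) : lor (fun i => (a i).im) (fun i => (b i).re) =
    ((bil a (conjVec b) + bil a b) / 2).im := by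
  simp only [lor, bil, conjVec, ← Finset.sum_add_distrib, Finset.sum_div, im_sum]
  refine Finset.sum_congr rfl fun i _ => ?_
  have : ((lorentzSign n i : ℂ) * a i * (starRingEnd ℂ) (b i) + lorentzSign n i * a i * b i) / 2 =
      ((lorentzSign n i : ℝ) * (b i).re : ℝ) * a i := by
    rw [ofReal_mul, re_eq_add_conj]; ring
  rw [this, im_ofReal_mul]; ring

theorem lor_im_im (a b : CVec n) : lor (fun i => (a i).im) (fun i => (b i).im) =
    ((bil a (conjVec b) - bil a b) / 2).re := by
  simp only [lor, bil, conjVec, ← Finset.sum_sub_distrib, Finset.sum_div, re_sum]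
  refine Finset.sum_congr rfl fun i _ => ?_
  have : ((lorentzSign n i : ℂ) * a i * (starRingEnd ℂ) (b i) - lorentzSign n i * a i * b i) / 2 =
      ((lorentzSign n i : ℝ) * (b i).im : ℝ) * (-I * a i) := by
    rw [ofReal_mul, im_eq_sub_conj]; field_simp; ring
  rw [this, re_ofReal_mul]; simp; ring

theorem one_sub_pairSign {k : ℕ} (hk : 1 ≤ k) (hkn : k < n) : 1 - pairSign n k = 0 := by
  have h0 : k ≠ 0 := by omega
  simp [pairSign, h0, hkn.ne]

/-- Products of real and imaginary parts are real or imaginary parts of (⟨a, b̄⟩ ± ⟨a, b⟩)/2; the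
norm 2 of the isotropic v_k makes both parts unit vectors. -/
theorem IsAdapted.orthonormal {v : ℕ → CVec n} (hv : IsAdapted v) {m l : ℕ}
    (hm : m < 2 * n - 1) (hl : l < 2 * n - 1) :
    lor (realParts v m) (realParts v l) = if m = l then 1 else 0 := by
  have key : ∀ k, k < n → (((1 + pairSign n k) + (1 - pairSign n k)) / 2 : ℂ) = 1 := by
    intro k _; ring
  unfold realParts
  by_cases h1 : m = 0 ∨ m % 2 = 1 <;> by_cases h2 : l = 0 ∨ l % 2 = 1
  · rw [if_pos h1, if_pos h2, lor_re_re, hv.bil _ (by omega) _ (by omega),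
      hv.bil_conj _ (by omega) _ (by omega)]
    by_cases h : m = l
    · subst h; simp
    · rw [if_neg (by omega), if_neg (by omega), if_neg h]; simp
  · rw [if_pos h1, if_neg h2, lor_comm, lor_im_re, hv.bil _ (by omega) _ (by omega),
      hv.bil_conj _ (by omega) _ (by omega), if_neg (show ¬ m = l by omega)]
    split_ifs <;> simp
  · rw [if_neg h1, if_pos h2, lor_im_re, hv.bil _ (by omega) _ (by omega),
      hv.bil_conj _ (by omega) _ (by omega), if_neg (show ¬ m = l by omega)]
    split_ifs <;> simp
  · rw [if_neg h1, if_neg h2, lor_im_im, hv.bil _ (by omega) _ (by omega),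
      hv.bil_conj _ (by omega) _ (by omega)]
    by_cases h : m = l
    · subst h
      rw [if_pos rfl, if_pos rfl, if_pos rfl, one_sub_pairSign (by omega) (by omega),
        one_add_pairSign_of_pos (by omega) (by omega)]
      simp
    · rw [if_neg (by omega), if_neg (by omega), if_neg h]; simp

open Classical in
/-- The Lorentz frame completing an adapted system. -/
noncomputable def adaptedFrame (hn : 1 ≤ n) (v : ℕ → CVec n) : SOLorentz n :=
  if hv : IsAdapted v then
    ⟨⟨frameMat hn (realParts v), det_frameMat fun _ hm _ hl => hv.orthonormal hm hl⟩,
      frameMat_gram fun _ hm _ hl => hv.orthonormal hm hl⟩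
  -- The default makes the frame a function of the bare system v, so equal systems have equal
  -- frames; periodicity of the lift rests on this.
  else 1

theorem IsAdapted.soMat_adaptedFrame {v : ℕ → CVec n} (hv : IsAdapted v) :
    soMat (adaptedFrame hn v) = frameMat hn (realParts v) := by
  rw [adaptedFrame, dif_pos hv]; rfl

theorem soCMat_mulVec_stdVec (g : SOLorentz n) {m : ℕ} (hm : m < 2 * n + 1) :
    soCMat g *ᵥ stdVec n m = fun i => (soMat g i ⟨m, hm⟩ : ℂ) := by
  ext i
  simp only [mulVec, dotProduct, stdVec, soCMat, map_apply]
  rw [Finset.sum_eq_single ⟨m, hm⟩]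
  · simp
  · intro b _ hb
    have : b.val ≠ m := fun h => hb (Fin.ext h)
    simp [this]
  · simp

theorem IsAdapted.adaptedFrame_mulVec {v : ℕ → CVec n} (hv : IsAdapted v) {k : ℕ} (hk : k < n) :
    soCMat (adaptedFrame hn v) *ᵥ pairVec n k I = v k := by
  have col : ∀ m (hm : m < 2 * n - 1), soCMat (adaptedFrame hn v) *ᵥ stdVec n m =
      fun i => (realParts v m i : ℂ) := by
    intro m hm
    rw [soCMat_mulVec_stdVec _ (by omega), hv.soMat_adaptedFrame]
    ext i
    have := congrFun (fillMat_col_of_lt (hn := hn) (q := realParts v) (spaceVec hn (realParts v))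
      (j := ⟨m, by omega⟩) hm) i
    rw [frameMat, this]
  rcases Nat.eq_zero_or_pos k with rfl | h
  · rw [pairVec_zero, col 0 (by omega)]
    ext i
    have := congrFun hv.real i
    simp only [conjVec] at this
    simpa [realParts] using conj_eq_iff_re.mp this
  · rw [pairVec_eq h, mulVec_add, mulVec_smul, col _ (by omega), col _ (by omega)]
    ext i
    have h1 : 2 * k - 1 = 0 ∨ (2 * k - 1) % 2 = 1 := by omega
    have h2 : ¬(2 * k = 0 ∨ (2 * k) % 2 = 1) := by omega
    simp only [realParts, h1, h2, if_true, if_false, Pi.add_apply, Pi.smul_apply, smul_eq_mul]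
    rw [show (2 * k - 1 + 1) / 2 = k by omega, show 2 * k / 2 = k by omega, mul_comm I,
      re_add_im]

end Completion

/-! ### Smooth dependence of the completion. -/

section CompletionSmooth

variable {n : ℕ} {hn : 1 ≤ n} {z : ℂ}

theorem contDiffAt_lor {x y : ℂ → RVec n} (hx : ContDiffAt ℝ ∞ x z) (hy : ContDiffAt ℝ ∞ y z) :
    ContDiffAt ℝ ∞ (fun w => lor (x w) (y w)) z := by
  unfold lor
  exact ContDiffAt.sum fun i _ =>
    (contDiffAt_const.mul (contDiffAt_pi.mp hx i)).mul (contDiffAt_pi.mp hy i)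

theorem contDiffAt_det {m : Type*} [Fintype m] [DecidableEq m] {M : ℂ → Matrix m m ℝ}
    (hM : ∀ i j, ContDiffAt ℝ ∞ (fun w => M w i j) z) :
    ContDiffAt ℝ ∞ (fun w => (M w).det) z := by
  simp only [det_apply]
  exact ContDiffAt.sum fun σ _ => (contDiffAt_prod fun i _ => hM _ _).const_smul _

theorem contDiffAt_timeVec {q : ℂ → ℕ → RVec n}
    (hq : ∀ m < 2 * n - 1, ContDiffAt ℝ ∞ (fun w => q w m) z)
    (horth : ∀ m < 2 * n - 1, ∀ l < 2 * n - 1, lor (q z m) (q z l) = if m = l then 1 else 0) :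
    ContDiffAt ℝ ∞ (fun w => timeVec (q w)) z := by
  have h1 : ContDiffAt ℝ ∞ (fun w => timeRaw (q w)) z := by
    unfold timeRaw
    refine contDiffAt_const.sub (ContDiffAt.sum fun m hm => ?_)
    have := hq m (Finset.mem_range.mp hm)
    exact (contDiffAt_lor contDiffAt_const this).smul this
  have h2 : -lor (timeRaw (q z)) (timeRaw (q z)) ≠ 0 := by
    have := lor_timeRaw_self horth; linarith
  unfold timeVec
  refine ContDiffAt.smul (ContDiffAt.inv ((contDiffAt_lor h1 h1).neg.sqrt h2) ?_) h1
  have := lor_timeRaw_self horth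
  exact (Real.sqrt_pos.mpr (by linarith)).ne'

theorem contDiffAt_fillMat {q : ℂ → ℕ → RVec n}
    (hq : ∀ m < 2 * n - 1, ContDiffAt ℝ ∞ (fun w => q w m) z)
    (horth : ∀ m < 2 * n - 1, ∀ l < 2 * n - 1, lor (q z m) (q z l) = if m = l then 1 else 0)
    {x : ℂ → RVec n} (hx : ContDiffAt ℝ ∞ x z) (i j : Fin (2 * n + 1)) :
    ContDiffAt ℝ ∞ (fun w => fillMat hn (q w) (x w) i j) z := by
  rcases index_frame hn j with hj | rfl | rfl
  · have : ∀ w, fillMat hn (q w) (x w) i j = q w j.val i := fun w =>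
      congrFun (fillMat_col_of_lt _ hj) i
    simp only [this]
    exact contDiffAt_pi.mp (hq _ hj) i
  · have : ∀ w, fillMat hn (q w) (x w) i (lastSpace n hn) = x w i := fun w =>
      congrFun (fillMat_col_lastSpace _) i
    simp only [this]
    exact contDiffAt_pi.mp hx i
  · have : ∀ w, fillMat hn (q w) (x w) i (Fin.last _) = timeVec (q w) i := fun w =>
      congrFun (fillMat_col_last _) i
    simp only [this]
    exact contDiffAt_pi.mp (contDiffAt_timeVec hq horth) i

theorem contDiffAt_frameMat {q : ℂ → ℕ → RVec n}
    (hq : ∀ m < 2 * n - 1, ContDiffAt ℝ ∞ (fun w => q w m) z)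
    (horth : ∀ m < 2 * n - 1, ∀ l < 2 * n - 1, lor (q z m) (q z l) = if m = l then 1 else 0)
    (i j : Fin (2 * n + 1)) :
    ContDiffAt ℝ ∞ (fun w => frameMat hn (q w) i j) z := by
  refine contDiffAt_fillMat hq horth (contDiffAt_pi.mpr fun i => ?_) i j
  unfold spaceVec
  simp only [adjugate_apply]
  refine contDiffAt_const.mul (contDiffAt_det fun a b => ?_)
  simp only [updateRow_apply]
  split_ifs
  · exact contDiffAt_const
  · exact contDiffAt_fillMat hq horth contDiffAt_const a b

theorem contDiffAt_realParts {v : ℂ → ℕ → CVec n} {m : ℕ} (hm : m < 2 * n - 1)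
    (hv : ∀ k < n, ContDiffAt ℝ ∞ (fun w => v w k) z) :
    ContDiffAt ℝ ∞ (fun w => realParts (v w) m) z := by
  unfold realParts
  split_ifs
  · exact contDiffAt_pi.mpr fun i =>
      reCLM.contDiff.contDiffAt.comp z ((hv _ (by omega)).coord i)
  · exact contDiffAt_pi.mpr fun i =>
      imCLM.contDiff.contDiffAt.comp z ((hv _ (by omega)).coord i)

theorem smoothFrameOn_adaptedFrame {V : Set ℂ} (hV : IsOpen V) {v : ℂ → ℕ → CVec n}
    (hv : ∀ z ∈ V, IsAdapted (v z)) (hs : ∀ z ∈ V, ∀ k < n, ContDiffAt ℝ ∞ (fun w => v w k) z) :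
    SmoothFrameOn V fun z => adaptedFrame hn (v z) := by
  intro a b z hz
  refine ContDiffAt.contDiffWithinAt ?_
  refine (contDiffAt_frameMat (hn := hn) (q := fun w => realParts (v w))
    (fun m hm => contDiffAt_realParts hm (hs z hz))
    (fun _ hm _ hl => (hv z hz).orthonormal hm hl) a b).congr_of_eventuallyEq ?_
  refine Filter.eventually_of_mem (hV.mem_nhds hz) fun w hw => ?_
  simp only [(hv w hw).soMat_adaptedFrame]

end CompletionSmooth

/-! ### The base frame of the harmonic sequence is primitive. -/

section BaseFrame

variable {n : ℕ} {f : ℂ → RVec n} {s : ℕ → ℂ → CVec n} {V : Set ℂ}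

/-- `⟨v, v̄⟩` for `v = e_{2k} + i e_{2k+1}`, and `1` for `k = 0`. -/
def pairNorm (k : ℕ) : ℝ := if k = 0 then 1 else 2

theorem pairNorm_pos (k : ℕ) : 0 < pairNorm k := by unfold pairNorm; split_ifs <;> norm_num

theorem pairNorm_eq {k : ℕ} (hk : k < n) : (pairNorm k : ℂ) = 1 + pairSign n k := by
  rcases Nat.eq_zero_or_pos k with rfl | h
  · simp [pairNorm, pairSign]
  · rw [one_add_pairSign_of_pos h hk, pairNorm, if_neg (by omega)]; simp

/-- The normalising factor of the `k`-th entry of the harmonic sequence. -/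
noncomputable def radius (s : ℕ → ℂ → CVec n) (k : ℕ) (z : ℂ) : ℝ :=
  √((hermSq (s k z)).re / pairNorm k)

/-- The normalised harmonic sequence. -/
noncomputable def unitSeq (s : ℕ → ℂ → CVec n) (z : ℂ) (k : ℕ) : CVec n :=
  ((radius s k z : ℂ))⁻¹ • s k z

/-- The Lorentz frame of the normalised harmonic sequence. -/
noncomputable def baseFrame (hn : 1 ≤ n) (s : ℕ → ℂ → CVec n) (z : ℂ) : SOLorentz n :=
  adaptedFrame hn (unitSeq s z)

/-- Twice the coefficient of `f_n` at the first null vector of the base frame. -/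
noncomputable def nullCoeff (hn : 1 ≤ n) (s : ℕ → ℂ → CVec n) (σ : ℂ) (z : ℂ) : ℂ :=
  bil (s n z) (soCMat (baseFrame hn s z) *ᵥ pairVec n n σ)

/-- The torus component of the base frame. -/
noncomputable def baseTorus (hn : 1 ≤ n) (s : ℕ → ℂ → CVec n) (z : ℂ) (k : Fin n) : ℂ :=
  if k.val + 1 = n then
    bil (logDz (baseFrame hn s) z *ᵥ pairVec n n 1) (pairVec n n (-1)) / 2
  else -I * (dz (fun w => (radius s (k.val + 1) w : ℂ)) z / radius s (k.val + 1) z)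

/-- The root coefficients of the base frame. -/
noncomputable def baseRoot (hn : 1 ≤ n) (s : ℕ → ℂ → CVec n) (z : ℂ) (k : ℕ) : ℂ :=
  if k = 0 then nullCoeff hn s 1 z / (2 * (pairNorm (n - 1) * radius s (n - 1) z))
  else if k = n then nullCoeff hn s (-1) z / (2 * (pairNorm (n - 1) * radius s (n - 1) z))
  else radius s k z / (pairNorm (k - 1) * radius s (k - 1) z)

namespace IsHarmonicSequenceOn

theorem hermSq_ne (hs : IsHarmonicSequenceOn V f s) {k : ℕ} (hk : k < n) {z : ℂ}
    (hz : z ∈ V) : hermSq (s k z) ≠ 0 := by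
  intro h
  have := hs.pos k hk z hz
  rw [h] at this
  simp at this

theorem radius_pos (hs : IsHarmonicSequenceOn V f s) {k : ℕ} (hk : k < n) {z : ℂ}
    (hz : z ∈ V) : 0 < radius s k z :=
  Real.sqrt_pos.mpr (div_pos (hs.pos k hk z hz) (pairNorm_pos k))

theorem radius_ne (hs : IsHarmonicSequenceOn V f s) {k : ℕ} (hk : k < n) {z : ℂ} (hz : z ∈ V) :
    (radius s k z : ℂ) ≠ 0 :=
  ofReal_ne_zero.mpr (hs.radius_pos hk hz).ne'

theorem hermSq_eq (hs : IsHarmonicSequenceOn V f s) {k : ℕ} (hk : k < n) {z : ℂ} (hz : z ∈ V) :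
    hermSq (s k z) = pairNorm k * radius s k z * radius s k z := by
  rw [hermSq_eq_ofReal_re, mul_assoc, ← ofReal_mul (radius s k z), radius,
    Real.mul_self_sqrt (div_pos (hs.pos k hk z hz) (pairNorm_pos k)).le, ← ofReal_mul,
    mul_div_cancel₀ _ (pairNorm_pos k).ne']

theorem contDiffAt_radius (hs : IsHarmonicSequenceOn V f s) {k : ℕ} (hk : k < n) {z : ℂ}
    (hz : z ∈ V) :
    ContDiffAt ℝ ∞ (fun w => radius s k w) z := by
  unfold radius
  refine ContDiffAt.sqrt (ContDiffAt.div_const ?_ _)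
    (div_pos (hs.pos k hk z hz) (pairNorm_pos k)).ne'
  exact reCLM.contDiff.contDiffAt.comp z (contDiffAt_hermSq (hs.smooth k hk.le z hz))

theorem contDiffAt_radius' (hs : IsHarmonicSequenceOn V f s) {k : ℕ} (hk : k < n) {z : ℂ}
    (hz : z ∈ V) :
    ContDiffAt ℝ ∞ (fun w => (radius s k w : ℂ)) z :=
  ofRealCLM.contDiff.contDiffAt.comp z (hs.contDiffAt_radius hk hz)

theorem contDiffAt_inv_radius (hs : IsHarmonicSequenceOn V f s) {k : ℕ} (hk : k < n) {z : ℂ}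
    (hz : z ∈ V) :
    ContDiffAt ℝ ∞ (fun w => (radius s k w : ℂ)⁻¹) z :=
  (hs.contDiffAt_radius' hk hz).inv (hs.radius_ne hk hz)

theorem contDiffAt_unitSeq (hs : IsHarmonicSequenceOn V f s) {k : ℕ} (hk : k < n) {z : ℂ}
    (hz : z ∈ V) :
    ContDiffAt ℝ ∞ (fun w => unitSeq s w k) z :=
  contDiffAt_smulVec (hs.contDiffAt_inv_radius hk hz)
    (hs.smooth k hk.le z hz)

theorem hermSq_zero (hs : IsHarmonicSequenceOn V f s) (hS : ∀ z, f z ∈ deSitter n)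
    (z : ℂ) : hermSq (s 0 z) = 1 := by
  rw [hermSq, hs.zero, conjVec_complexify, bil_complexify_self hS]

theorem radius_zero (hs : IsHarmonicSequenceOn V f s) (hS : ∀ z, f z ∈ deSitter n)
    (z : ℂ) : radius s 0 z = 1 := by
  rw [radius, hs.hermSq_zero hS]; simp [pairNorm]

theorem unitSeq_zero (hs : IsHarmonicSequenceOn V f s) (hS : ∀ z, f z ∈ deSitter n)
    (z : ℂ) : unitSeq s z 0 = complexify f z := by
  rw [unitSeq, hs.radius_zero hS, hs.zero]; simp

theorem isAdapted (hs : IsHarmonicSequenceOn V f s) (hS : ∀ z, f z ∈ deSitter n) {z : ℂ}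
    (hz : z ∈ V) :
    IsAdapted (unitSeq s z) := by
  refine ⟨?_, ?_, ?_⟩
  · rw [hs.unitSeq_zero hS, conjVec_complexify]
  · intro k hk l hl
    by_cases h : k = l
    · subst h
      rw [if_pos rfl]
      rcases Nat.eq_zero_or_pos k with rfl | h0
      · rw [hs.unitSeq_zero hS, bil_complexify_self hS]; simp [pairSign]
      · rw [one_sub_pairSign h0 hk, unitSeq, bil_smul_left, bil_smul_right,
          hs.iso k hk.le k hk.le (by omega) (by omega) z hz, mul_zero, mul_zero]
    · rw [if_neg h, unitSeq, unitSeq, bil_smul_left, bil_smul_right,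
        hs.iso k hk.le l hl.le (by omega) (by omega) z hz, mul_zero, mul_zero]
  · intro k hk l hl
    by_cases h : k = l
    · subst h
      rw [if_pos rfl, unitSeq, conjVec_smul, bil_smul_left, bil_smul_right]
      change _ * (_ * hermSq (s k z)) = _
      have h0 := hs.radius_ne hk hz
      rw [hs.hermSq_eq hk hz, ← pairNorm_eq hk, map_inv₀, conj_ofReal]
      field_simp
    · rw [if_neg h, unitSeq, unitSeq, conjVec_smul, bil_smul_left, bil_smul_right,
        hs.orth k hk.le l hl.le h z hz, mul_zero, mul_zero]

theorem smoothFrameOn (hs : IsHarmonicSequenceOn V f s) (hn : 1 ≤ n) (hS : ∀ z, f z ∈ deSitter n) :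
    SmoothFrameOn V (baseFrame hn s) :=
  smoothFrameOn_adaptedFrame hs.isOpen (fun _ hz => hs.isAdapted hS hz)
    fun _ hz _ hk => hs.contDiffAt_unitSeq hk hz

theorem frame_pair (hs : IsHarmonicSequenceOn V f s) (hn : 1 ≤ n) (hS : ∀ z, f z ∈ deSitter n)
    {k : ℕ} (hk : k < n) {z : ℂ}
    (hz : z ∈ V) : soCMat (baseFrame hn s z) *ᵥ pairVec n k I = unitSeq s z k :=
  (hs.isAdapted hS hz).adaptedFrame_mulVec hk

theorem frame_conj_pair (hs : IsHarmonicSequenceOn V f s) (hn : 1 ≤ n)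
    (hS : ∀ z, f z ∈ deSitter n) {k : ℕ} (hk : k < n) {z : ℂ}
    (hz : z ∈ V) : soCMat (baseFrame hn s z) *ᵥ pairVec n k (-I) = conjVec (unitSeq s z k) := by
  rw [← hs.frame_pair hn hS hk hz, conjVec_soCMat_mulVec, conjVec_pairVec, conj_I]

theorem frame_first (hs : IsHarmonicSequenceOn V f s) (hn : 1 ≤ n) (hS : ∀ z, f z ∈ deSitter n)
    {z : ℂ} (hz : z ∈ V) :
    soMat (baseFrame hn s z) *ᵥ Pi.single 0 1 = f z := by
  have h := hs.frame_pair hn hS (k := 0) (by omega) hz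
  rw [hs.unitSeq_zero hS, complexify_eq_mulVec_pairVec rfl] at h
  ext i
  have := congrFun h i
  simp only [complexify] at this
  exact_mod_cast this

theorem dz_hermSq (hs : IsHarmonicSequenceOn V f s) {k : ℕ} (hk : k < n) {z : ℂ} (hz : z ∈ V) :
    _root_.dz (fun w => hermSq (s k w)) z / hermSq (s k z) =
      2 * (_root_.dz (fun w => (radius s k w : ℂ)) z / radius s k z) := by
  have sm := hs.contDiffAt_radius' hk hz
  have h0 := hs.radius_ne hk hz
  have h1 : (pairNorm k : ℂ) ≠ 0 := ofReal_ne_zero.mpr (pairNorm_pos k).ne'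
  rw [dz_congr (Filter.eventually_of_mem (hs.isOpen.mem_nhds hz) fun w hw => hs.hermSq_eq hk hw),
    dz_mul (sm.diffAt.const_mul _) sm.diffAt, dz_mul (differentiableAt_const _) sm.diffAt,
    dz_const, hs.hermSq_eq hk hz]
  field_simp
  ring

theorem dz_inv_radius (hs : IsHarmonicSequenceOn V f s) {k : ℕ} (hk : k < n) {z : ℂ} (hz : z ∈ V) :
    _root_.dz (fun w => (radius s k w : ℂ)⁻¹) z =
      -(_root_.dz (fun w => (radius s k w : ℂ)) z / radius s k z) * (radius s k z : ℂ)⁻¹ := by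
  have sm := hs.contDiffAt_radius' hk hz
  have h0 := hs.radius_ne hk hz
  have e := dz_mul sm.diffAt (hs.contDiffAt_inv_radius hk hz).diffAt
  rw [dz_congr (h := fun _ => 1) (Filter.eventually_of_mem (hs.isOpen.mem_nhds hz) fun w hw =>
    mul_inv_cancel₀ (hs.radius_ne hk hw)), dz_const] at e
  have e' : (radius s k z : ℂ) * _root_.dz (fun w => (radius s k w : ℂ)⁻¹) z =
      -(_root_.dz (fun w => (radius s k w : ℂ)) z * (radius s k z : ℂ)⁻¹) := by
    linear_combination -e
  refine mul_left_cancel₀ h0 (e'.trans ?_)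
  field_simp

/-- With ρ_k the radius, ∂_z log ‖f_k‖² is 2 ∂_z ρ_k / ρ_k; the factor ρ_k⁻¹ removes one of the two
copies. -/
theorem dz_unitSeq (hs : IsHarmonicSequenceOn V f s) {k : ℕ} (hk : k < n) {z : ℂ} (hz : z ∈ V) :
    dzVec (fun w => unitSeq s w k) z = (radius s k z : ℂ)⁻¹ • s (k + 1) z +
      (_root_.dz (fun w => (radius s k w : ℂ)) z / radius s k z) • unitSeq s z k := by
  have h0 := hs.radius_ne hk hz
  unfold unitSeq
  rw [dzVec_smul (hs.contDiffAt_inv_radius hk hz) (hs.smooth k hk.le z hz),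
    hs.dz k hk z hz, hs.dz_hermSq hk hz, hs.dz_inv_radius hk hz]
  module

/-- This is the conjugate of the ∂_z̄-equation. Its second coefficient is -2c_{k+1} with the same
c_{k+1} that occurs in ∂_z of the k-th unit vector, as skewness of F⁻¹F_z demands. -/
theorem dz_conj_unitSeq (hs : IsHarmonicSequenceOn V f s) {k : ℕ} (hk : k + 1 < n) {z : ℂ}
    (hz : z ∈ V) :
    dzVec (fun w => conjVec (unitSeq s w (k + 1))) z =
      (-(_root_.dz (fun w => (radius s (k + 1) w : ℂ)) z / radius s (k + 1) z)) •
        conjVec (unitSeq s z (k + 1)) -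
      (2 * (radius s (k + 1) z / (pairNorm k * radius s k z)) : ℂ) • conjVec (unitSeq s z k) := by
  have h0 := hs.radius_ne hk hz
  have h1 := hs.radius_ne (show k < n by omega) hz
  have ss := hs.smooth (k + 1) hk.le z hz
  have e : (fun w => conjVec (unitSeq s w (k + 1))) =
      fun w => (radius s (k + 1) w : ℂ)⁻¹ • conjVec (s (k + 1) w) := by
    ext1 w
    rw [unitSeq, conjVec_smul, map_inv₀, conj_ofReal]
  rw [e, dzVec_smul (hs.contDiffAt_inv_radius hk hz) (contDiffAt_conjVec ss), dzVec_conj ss,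
    hs.dzbar k (by omega) z hz, hs.dz_inv_radius hk hz, hs.hermSq_eq hk hz,
    hs.hermSq_eq (by omega) hz]
  simp only [unitSeq, conjVec_smul, map_neg, map_div₀, map_mul, map_inv₀, conj_ofReal, smul_smul]
  have h2 : (pairNorm (k + 1) : ℂ) = 2 := by simp [pairNorm]
  have h3 : (pairNorm k : ℂ) ≠ 0 := ofReal_ne_zero.mpr (pairNorm_pos k).ne'
  rw [h2, sub_eq_add_neg, ← neg_smul]
  congr 2
  field_simp

/-- f_n is orthogonal to all f_k and f̄_k with k < n, so it lies in the plane of the last two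
columns. -/
theorem last_eq (hs : IsHarmonicSequenceOn V f s) (hn : 1 ≤ n) (hS : ∀ z, f z ∈ deSitter n)
    {z : ℂ} (hz : z ∈ V) :
    s n z = (nullCoeff hn s (-1) z / 2) • (soCMat (baseFrame hn s z) *ᵥ pairVec n n 1) +
      (nullCoeff hn s 1 z / 2) • (soCMat (baseFrame hn s z) *ᵥ pairVec n n (-1)) := by
  have hn0 : n ≠ 0 := by omega
  rw [← sub_eq_zero]
  refine eq_of_bil_frame hn (baseFrame hn s z) ?_ ?_ ?_ ?_
  · intro k hk
    rw [bil_sub_left, bil_add_left, bil_smul_left, bil_smul_left, bil_soCMat, bil_soCMat,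
      bil_pairVec_of_ne hn hk.le hk.ne', bil_pairVec_of_ne hn hk.le hk.ne',
      hs.frame_pair hn hS hk hz,
      unitSeq, bil_smul_right, hs.iso n le_rfl k hk.le (by omega) (by omega) z hz]
    ring
  · intro k hk
    rw [bil_sub_left, bil_add_left, bil_smul_left, bil_smul_left, bil_soCMat, bil_soCMat,
      bil_pairVec_of_ne hn hk.le hk.ne', bil_pairVec_of_ne hn hk.le hk.ne',
      hs.frame_conj_pair hn hS hk hz, unitSeq, conjVec_smul, bil_smul_right,
      hs.orth n le_rfl k hk.le hk.ne' z hz]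
    ring
  · rw [bil_sub_left, bil_add_left, bil_smul_left, bil_smul_left, bil_soCMat, bil_soCMat,
      bil_pairVec_self hn le_rfl, bil_pairVec_self hn le_rfl]
    simp only [pairSign, hn0, if_true, if_false, nullCoeff]
    ring
  · rw [bil_sub_left, bil_add_left, bil_smul_left, bil_smul_left, bil_soCMat, bil_soCMat,
      bil_pairVec_self hn le_rfl, bil_pairVec_self hn le_rfl]
    simp only [pairSign, hn0, if_true, if_false, nullCoeff]
    ring

theorem torusCoord_baseTorus (hs : IsHarmonicSequenceOn V f s) (hn : 1 ≤ n)
    (hS : ∀ z, f z ∈ deSitter n) {k : ℕ} (hk : k < n)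
    (z : ℂ) : torusCoord (baseTorus hn s z) k =
      -I * (_root_.dz (fun w => (radius s k w : ℂ)) z / radius s k z) := by
  rcases Nat.eq_zero_or_pos k with rfl | h
  · simp only [torusCoord_zero, hs.radius_zero hS, dz_const]; simp
  · rw [torusCoord, dif_pos ⟨h, hk.le⟩, baseTorus]
    simp only [Nat.sub_add_cancel h]
    rw [if_neg hk.ne]

/-- The base frame is a primitive frame. -/
theorem logDz_baseFrame (hs : IsHarmonicSequenceOn V f s) (hn : 1 ≤ n)
    (hS : ∀ z, f z ∈ deSitter n) {z : ℂ} (hz : z ∈ V) :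
    logDz (baseFrame hn s) z =
      torusMat n (baseTorus hn s z) + rootSum n (baseRoot hn s z) := by
  have hF := hs.smoothFrameOn hn hS
  have inj : ∀ x y : CVec n, soCMat (baseFrame hn s z) *ᵥ x = soCMat (baseFrame hn s z) *ᵥ y →
      x = y := by
    intro x y h
    rw [← one_mulVec x, ← one_mulVec y, ← soCMat_inv_mul (baseFrame hn s z), ← mulVec_mulVec, h,
      mulVec_mulVec]
  have hn0 : n ≠ 0 := by omega
  rw [← sub_eq_zero]
  have holo : ∀ k < n, (logDz (baseFrame hn s) z - (torusMat n (baseTorus hn s z) +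
      rootSum n (baseRoot hn s z))) *ᵥ pairVec n k I = 0 := by
    intro k hk
    rw [sub_mulVec, add_mulVec, sub_eq_zero]
    refine inj _ _ ?_
    rw [← hF.dzVec_mulVec hs.isOpen hz, dzVec_congr (Filter.eventually_of_mem
      (hs.isOpen.mem_nhds hz) fun w hw => hs.frame_pair hn hS hk hw), hs.dz_unitSeq hk hz,
      torusMat_mulVec_pairVec hn _ hk.le (pair_null hk I_mul_I),
      hs.torusCoord_baseTorus hn hS hk, mulVec_add, mulVec_smul, hs.frame_pair hn hS hk hz,
      show I * (-I * (_root_.dz (fun w => (radius s k w : ℂ)) z / radius s k z)) =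
        _root_.dz (fun w => (radius s k w : ℂ)) z / radius s k z by
        rw [← mul_assoc]; simp]
    refine (add_comm _ _).trans ?_
    congr 1
    have h0 := hs.radius_ne hk hz
    by_cases hk1 : k + 1 < n
    · have h1 := hs.radius_ne hk1 hz
      have h3 : (pairNorm k : ℂ) ≠ 0 := ofReal_ne_zero.mpr (pairNorm_pos k).ne'
      rw [rootSum_mulVec_pair hn _ hk1, mulVec_smul, hs.frame_pair hn hS hk1 hz, baseRoot,
        if_neg (by omega), if_neg (by omega), Nat.add_sub_cancel, ← pairNorm_eq hk, unitSeq,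
        smul_smul]
      congr 1
      field_simp
    · obtain rfl : k = n - 1 := by omega
      have h3 : (pairNorm (n - 1) : ℂ) ≠ 0 := ofReal_ne_zero.mpr (pairNorm_pos _).ne'
      rw [rootSum_mulVec_pair_last hn, mulVec_smul, mulVec_add, mulVec_smul, mulVec_smul,
        Nat.sub_add_cancel hn, hs.last_eq hn hS hz, ← pairNorm_eq hk, baseRoot, baseRoot,
        if_pos rfl, if_neg hn0, if_pos rfl, smul_add, smul_add, smul_smul, smul_smul, smul_smul,
        smul_smul]
      refine Eq.trans ?_ (add_comm _ _)
      congr 2 <;> field_simp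
  -- Both sides are skew, so after the columns E_k it suffices to check the conjugate columns and a
  -- single entry of the last block.
  refine IsSkew.eq_zero hn ((hF.isSkew_logDz hs.isOpen hz).sub
    ((isSkew_torusMat _).add (isSkew_rootSum hn _))) holo ?_ ?_
  · intro k hk
    rcases Nat.eq_zero_or_pos k with rfl | hk0
    · have h0 : pairVec n 0 (-I) = pairVec n 0 I := by rw [pairVec_zero, pairVec_zero]
      rw [h0, holo 0 hk]
    · rw [sub_mulVec, add_mulVec, sub_eq_zero]
      refine inj _ _ ?_
      obtain ⟨m, rfl⟩ : ∃ m, k = m + 1 := ⟨k - 1, by omega⟩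
      rw [← hF.dzVec_mulVec hs.isOpen hz, dzVec_congr (Filter.eventually_of_mem
        (hs.isOpen.mem_nhds hz) fun w hw => hs.frame_conj_pair hn hS hk hw),
        hs.dz_conj_unitSeq hk hz, torusMat_mulVec_pairVec hn _ hk.le (pair_null hk (by simp)),
        hs.torusCoord_baseTorus hn hS hk, mulVec_add, mulVec_smul,
        hs.frame_conj_pair hn hS hk hz, rootSum_mulVec_conj_pair hn _ hk0 hk, mulVec_smul,
        Nat.add_sub_cancel, hs.frame_conj_pair hn hS (by omega) hz, baseRoot,
        if_neg (by omega), if_neg (by omega), Nat.add_sub_cancel,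
        show -I * (-I * (_root_.dz (fun w => (radius s (m + 1) w : ℂ)) z / radius s (m + 1) z)) =
          -(_root_.dz (fun w => (radius s (m + 1) w : ℂ)) z / radius s (m + 1) z) by
          rw [← mul_assoc]; simp, neg_smul (2 * _), ← sub_eq_add_neg]
  -- The last torus coordinate in `baseTorus` is defined to be this entry.
  · rw [sub_mulVec, add_mulVec, bil_sub_left, bil_add_left,
      torusMat_mulVec_pairVec hn _ le_rfl (pair_null_last hn (by simp)), rootSum_mulVec_null hn,
      bil_smul_left, bil_smul_left, bil_pairVec_self hn le_rfl,
      bil_pairVec_of_ne hn le_rfl (by omega), torusCoord, dif_pos ⟨hn, le_rfl⟩, baseTorus]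
    simp only [Nat.sub_add_cancel hn, if_true, pairSign, hn0, if_false]
    ring

theorem contDiffAt_nullCoeff (hs : IsHarmonicSequenceOn V f s) (hn : 1 ≤ n)
    (hS : ∀ z, f z ∈ deSitter n) (σ : ℂ) {z : ℂ}
    (hz : z ∈ V) : ContDiffAt ℝ ∞ (nullCoeff hn s σ) z :=
  contDiffAt_bil (hs.smooth n le_rfl z hz)
    ((hs.smoothFrameOn hn hS).contDiffAt_mulVec hs.isOpen hz _)

/-- ∂_z̄ f_n is a multiple of f_{n-1}, which is orthogonal to the null column. Since N_- is real,
∂_z̄(F N_-) is F applied to the conjugate of F⁻¹F_z N_-: its torus part has weight minus the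
conjugate of a_n, and its root part is a multiple of F E_{n-1}, orthogonal to f_n by isotropy. -/
theorem dzbar_nullCoeff (hs : IsHarmonicSequenceOn V f s) (hn : 1 ≤ n)
    (hS : ∀ z, f z ∈ deSitter n) {z : ℂ} (hz : z ∈ V) :
    _root_.dzbar (nullCoeff hn s (-1)) z =
      -(starRingEnd ℂ) (torusCoord (baseTorus hn s z) n) * nullCoeff hn s (-1) z := by
  have hF := hs.smoothFrameOn hn hS
  have sm := hF.contDiffAt_mulVec hs.isOpen hz (pairVec n n (-1))
  have e := dzbar_bil (hs.smooth n le_rfl z hz) sm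
  have e1 : dzbarVec (fun w => soCMat (baseFrame hn s w) *ᵥ pairVec n n (-1)) z =
      soCMat (baseFrame hn s z) *ᵥ conjVec (logDz (baseFrame hn s) z *ᵥ pairVec n n (-1)) := by
    rw [← conjVec_soCMat_mulVec, ← hF.dzVec_mulVec hs.isOpen hz, ← dzbarVec_conj sm]
    congr 1
    ext1 w
    rw [conjVec_soCMat_mulVec, conjVec_pairVec]
    simp
  have e2 : bil (dzbarVec (s n) z) (soCMat (baseFrame hn s z) *ᵥ pairVec n n (-1)) = 0 := by
    have h := hs.dzbar (n - 1) (by omega) z hz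
    rw [Nat.sub_add_cancel hn] at h
    have h1 : s (n - 1) z = (radius s (n - 1) z : ℂ) • unitSeq s z (n - 1) := by
      rw [unitSeq, smul_smul, mul_inv_cancel₀ (hs.radius_ne (by omega) hz), one_smul]
    rw [h, h1, ← hs.frame_pair hn hS (by omega) hz, bil_smul_left, bil_smul_left, bil_soCMat,
      bil_pairVec_of_ne hn le_rfl (by omega)]
    ring
  have e3 : bil (s n z) (soCMat (baseFrame hn s z) *ᵥ pairVec n (n - 1) I) = 0 := by
    rw [hs.frame_pair hn hS (by omega) hz, unitSeq, bil_smul_right,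
      hs.iso n le_rfl (n - 1) (by omega) (by omega) (by omega) z hz, mul_zero]
  change _root_.dzbar (fun w => bil (s n w) (soCMat (baseFrame hn s w) *ᵥ pairVec n n (-1))) z = _
  rw [e, e2, e1, hs.logDz_baseFrame hn hS hz, add_mulVec,
    torusMat_mulVec_pairVec hn _ le_rfl (pair_null_last hn (by simp)), rootSum_mulVec_null hn,
    conjVec_add, conjVec_smul, conjVec_smul, conjVec_pairVec, conjVec_pairVec, mulVec_add,
    mulVec_smul, mulVec_smul, bil_add_right, bil_smul_right, bil_smul_right]
  simp only [map_neg, conj_I, neg_neg, map_one, e3, map_mul, nullCoeff]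
  ring

end IsHarmonicSequenceOn

end BaseFrame

/-! ### Exponentials of the torus algebra. -/

section TorusExponential

variable {n : ℕ}

theorem mul_exp_of_semiconjBy {m 𝕂 : Type*} [Fintype m] [DecidableEq m] [RCLike 𝕂]
    {X A B : Matrix m m 𝕂} (h : X * A = B * X) :
    X * NormedSpace.exp A = NormedSpace.exp B * X := by
  open scoped Matrix.Norms.Operator in
  exact SemiconjBy.exp_right h

theorem exp_smul_one {m : Type*} [Fintype m] [DecidableEq m] (t : ℂ) :
    NormedSpace.exp (t • (1 : Matrix m m ℂ)) = Complex.exp t • 1 := by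
  open scoped Matrix.Norms.Operator in
  have h := NormedSpace.algebraMap_exp_comm (𝕂 := ℂ) (𝔸 := Matrix m m ℂ) t
  rw [Algebra.algebraMap_eq_smul_one, Algebra.algebraMap_eq_smul_one,
    ← Complex.exp_eq_exp_ℂ] at h
  exact h.symm

theorem torusMat_add (a b : Fin n → ℂ) : torusMat n (a + b) = torusMat n a + torusMat n b := by
  simp only [torusMat, Pi.add_apply, add_smul, Finset.sum_add_distrib]

theorem torusMat_smul (t : ℂ) (a : Fin n → ℂ) : torusMat n (t • a) = t • torusMat n a := by
  simp only [torusMat, Pi.smul_apply, smul_eq_mul, mul_smul, Finset.smul_sum]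

theorem torusMat_apply (a : Fin n → ℂ) (i j : Fin (2 * n + 1)) :
    torusMat n a i j = ∑ k, a k * torusMat n (Pi.single k 1) i j := by
  have : a = ∑ k, a k • (Pi.single k 1 : Fin n → ℂ) := by
    ext m; simp [Finset.sum_apply, Pi.single_apply]
  have h : ∀ s : Finset (Fin n), torusMat n (∑ k ∈ s, a k • (Pi.single k 1 : Fin n → ℂ)) =
      ∑ k ∈ s, a k • torusMat n (Pi.single k 1) := by
    classical
    intro s
    induction s using Finset.induction_on with
    | empty => simp [torusMat]
    | insert m s hm ih => rw [Finset.sum_insert hm, Finset.sum_insert hm, torusMat_add, ih,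
        torusMat_smul]
  conv_lhs => rw [this, h]
  simp [Matrix.sum_apply]

/-- All elements of 𝔱^ℂ are diagonal in the basis of weight vectors. -/
theorem commute_torusMat (hn : 1 ≤ n) (a b : Fin n → ℂ) :
    Commute (torusMat n a) (torusMat n b) := by
  refine mat_ext_mulVec fun x => ?_
  have key : ∀ (k : ℕ) (σ : ℂ), k ≤ n → (k = 0 ∨ 1 + pairSign n k * σ * σ = 0) →
      bil (torusMat n a *ᵥ (torusMat n b *ᵥ x) - torusMat n b *ᵥ (torusMat n a *ᵥ x))
        (pairVec n k σ) = 0 := by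
    intro k σ hk hσ
    simp only [bil_sub_left, isSkew_torusMat _ _ (pairVec n k σ), isSkew_torusMat _ x,
      torusMat_mulVec_pairVec hn _ hk hσ, mulVec_smul, bil_smul_right]
    ring
  rw [← mulVec_mulVec, ← mulVec_mulVec, ← sub_eq_zero]
  exact eq_zero_of_bil_pairVec hn (fun k hk => key k I hk.le (pair_null hk I_mul_I))
    (fun k hk => key k (-I) hk.le (pair_null hk (by simp)))
    (key n 1 le_rfl (pair_null_last hn (by simp))) (key n (-1) le_rfl (pair_null_last hn (by simp)))

theorem exp_torusMat_add (hn : 1 ≤ n) (a b : Fin n → ℂ) :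
    NormedSpace.exp (torusMat n (a + b)) =
      NormedSpace.exp (torusMat n a) * NormedSpace.exp (torusMat n b) := by
  rw [torusMat_add, Matrix.exp_add_of_commute _ _ (commute_torusMat hn a b)]

/-- `Ad` of the complex torus acts on the root spaces by the exponentials of the roots. -/
theorem exp_torusMat_mul_rootVec (hn : 1 ≤ n) (a : Fin n → ℂ) {j : ℕ} (hj : j ≤ n) :
    NormedSpace.exp (torusMat n a) * rootVec n j =
      Complex.exp (rootVal a j) • (rootVec n j * NormedSpace.exp (torusMat n a)) := by
  have h := torusMat_commutator_rootVec hn a hj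
  -- [A, R] = αR says that R intertwines A + α with A; exponentiating gives R exp(A) e^α = exp(A) R.
  have h2 := mul_exp_of_semiconjBy (X := rootVec n j)
    (A := torusMat n a + (rootVal a j) • 1) (B := torusMat n a) (by
      rw [mul_add, mul_smul_comm, mul_one, ← h]; abel)
  rw [Matrix.exp_add_of_commute _ _ ((Commute.one_right _).smul_right _), exp_smul_one] at h2
  rw [← h2, mul_smul_comm, mul_one, mul_smul_comm]

theorem exp_torusMat_mul_rootSum (hn : 1 ≤ n) (a : Fin n → ℂ) (c : ℕ → ℂ) :
    NormedSpace.exp (torusMat n a) * rootSum n c =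
      rootSum n (fun j => c j * Complex.exp (rootVal a j)) * NormedSpace.exp (torusMat n a) := by
  rw [rootSum, rootSum, Finset.mul_sum, Finset.sum_mul]
  refine Finset.sum_congr rfl fun j hj => ?_
  rw [mul_smul_comm, exp_torusMat_mul_rootVec hn a (by simpa [Nat.lt_succ_iff] using hj),
    smul_smul, smul_mul_assoc]

theorem exp_torusMat_mul_exp_neg (a : Fin n → ℂ) :
    NormedSpace.exp (torusMat n a) * NormedSpace.exp (-torusMat n a) = 1 := by
  rw [← Matrix.exp_add_of_commute _ _ (Commute.refl (torusMat n a)).neg_right, add_neg_cancel,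
    NormedSpace.exp_zero]

/-- The real matrix underlying an element of `𝔱`. -/
noncomputable def torusReal (b : Fin n → ℝ) : Matrix (Fin (2 * n + 1)) (Fin (2 * n + 1)) ℝ :=
  (torusMat n fun k => (b k : ℂ)).map re

theorem torusReal_map (b : Fin n → ℝ) :
    (torusReal b).map (fun r : ℝ => (r : ℂ)) = torusMat n fun k => (b k : ℂ) := by
  ext i j
  simp only [torusReal, Matrix.map_apply, torusMat, Matrix.sum_apply, Matrix.smul_apply, brk]
  rw [re_sum, ofReal_sum]
  refine Finset.sum_congr rfl fun k _ => ?_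
  rw [show ∀ x : ℂ, ((x.re : ℝ) : ℂ) = x ↔ x.im = 0 from fun x =>
    ⟨fun h => by rw [← h]; exact ofReal_im _, fun h => Complex.ext rfl h.symm⟩]
  split_ifs with h <;> simp only [Matrix.neg_apply, of_apply, smul_eq_mul, im_ofReal_mul] <;>
    split_ifs <;> simp

theorem torusReal_apply (b : Fin n → ℝ) (i j : Fin (2 * n + 1)) :
    torusReal b i j = ∑ k, b k * (torusMat n (Pi.single k 1) i j).re := by
  rw [torusReal, Matrix.map_apply, torusMat_apply, re_sum]
  exact Finset.sum_congr rfl fun k _ => by rw [re_ofReal_mul]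

theorem upsilon_mul_torusReal (b : Fin n → ℝ) :
    upsilon n * torusReal b = -(torusReal b)ᵀ * upsilon n := by
  ext i j
  have h := isSkew_torusMat (fun k => (b k : ℂ)) (stdVec n i.val) (stdVec n j.val)
  have e : ∀ m : Fin (2 * n + 1), stdVec n m.val = Pi.single m 1 := by
    intro m; ext l; simp [stdVec, Pi.single_apply, Fin.ext_iff]
  rw [bil_comm _ (_ *ᵥ _), bil_stdVec_right _ j.isLt, bil_stdVec_right _ i.isLt, e, e,
    mulVec_single_one, mulVec_single_one, ← torusReal_map] at h
  simp only [Fin.eta, col_apply, Matrix.map_apply] at h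
  have h' : lorentzSign n j * torusReal b j i = -(lorentzSign n i * torusReal b i j) := by
    exact_mod_cast h
  rw [upsilon, diagonal_mul, mul_diagonal, neg_apply, transpose_apply]
  linarith

theorem exp_torusReal_gram (b : Fin n → ℝ) :
    (NormedSpace.exp (torusReal b))ᵀ * upsilon n * NormedSpace.exp (torusReal b) = upsilon n := by
  rw [Matrix.mul_assoc, mul_exp_of_semiconjBy (upsilon_mul_torusReal b), ← Matrix.mul_assoc,
    ← Matrix.exp_transpose,
    ← Matrix.exp_add_of_commute _ _ (Commute.refl (torusReal b)ᵀ).neg_right, add_neg_cancel,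
    NormedSpace.exp_zero, Matrix.one_mul]

/-- Preserving the form gives determinant ±1, and exp(A) = exp(A/2)² excludes -1. -/
theorem det_exp_torusReal (b : Fin n → ℝ) : (NormedSpace.exp (torusReal b)).det = 1 := by
  have h := congrArg det (exp_torusReal_gram b)
  have h0 := det_upsilon_ne_zero (n := n)
  rw [det_mul, det_mul, det_transpose] at h
  have h1 : (NormedSpace.exp (torusReal b)).det * (NormedSpace.exp (torusReal b)).det = 1 :=
    mul_left_cancel₀ h0 (by linear_combination h)
  have e : torusReal b = (2 : ℕ) • ((2 : ℝ)⁻¹ • torusReal b) := by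
    ext i j; simp
  have h2 : 0 ≤ (NormedSpace.exp (torusReal b)).det := by
    rw [e, Matrix.exp_nsmul, det_pow]; positivity
  nlinarith

/-- The exponential `𝔱 → T`. -/
noncomputable def torusExp (b : Fin n → ℝ) : SOLorentz n :=
  ⟨⟨NormedSpace.exp (torusReal b), det_exp_torusReal b⟩, exp_torusReal_gram b⟩

theorem map_exp_ofReal {m : Type*} [Fintype m] [DecidableEq m] (A : Matrix m m ℝ) :
    (NormedSpace.exp A).map (fun r : ℝ => (r : ℂ)) =
      NormedSpace.exp (A.map fun r : ℝ => (r : ℂ)) := by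
  have hc : Continuous (Complex.ofRealHom.mapMatrix (m := m)) :=
    continuous_id.matrix_map continuous_ofReal
  open scoped Matrix.Norms.Operator in
  exact NormedSpace.map_exp Complex.ofRealHom.mapMatrix hc A

theorem soCMat_torusExp (b : Fin n → ℝ) :
    soCMat (torusExp b) = NormedSpace.exp (torusMat n fun k => (b k : ℂ)) := by
  rw [← torusReal_map, ← map_exp_ofReal]
  rfl

theorem torusExp_mem (hn : 1 ≤ n) (b : Fin n → ℝ) : torusExp b ∈ cartanT n := by
  refine ⟨?_, fun a => ?_⟩
  · have e : (Pi.single 0 1 : CVec n) = pairVec n 0 I := by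
      rw [pairVec_zero]
      ext i
      rw [Pi.single_apply]
      exact if_congr Fin.ext_iff rfl rfl
    have h : torusMat n (fun k => (b k : ℂ)) *ᵥ (Pi.single 0 1 : CVec n) = 0 := by
      rw [e, torusMat_mulVec_pairVec hn _ (Nat.zero_le n) (Or.inl rfl), torusCoord_zero]; simp
    -- The rank one matrix with all columns e_1 intertwines 0 with A because A e_1 = 0, hence exp(A)
    -- fixes e_1.
    have h2 := mul_exp_of_semiconjBy (X := vecMulVec (Pi.single 0 1 : CVec n) (fun _ => 1))
      (A := 0) (B := torusMat n fun k => (b k : ℂ)) (by rw [mul_vecMulVec, h, Matrix.mul_zero,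
      zero_vecMulVec])
    rw [NormedSpace.exp_zero, Matrix.mul_one, mul_vecMulVec, ← soCMat_torusExp] at h2
    ext i
    have := congrFun (congrFun h2 i) 0
    simpa only [vecMulVec_apply, mul_one] using this.symm
  · rw [soCMat_torusExp]
    exact (mul_exp_of_semiconjBy (commute_torusMat hn _ _)).symm

theorem contDiff_exp_entry {m : Type*} [Fintype m] [DecidableEq m]
    {A : ℂ → Matrix m m ℝ} (hA : ∀ i j, ContDiff ℝ ∞ fun z => A z i j) (i j : m) :
    ContDiff ℝ ∞ fun z => NormedSpace.exp (A z) i j := by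
  open scoped Matrix.Norms.Operator in
  have h1 : ContDiff ℝ ∞ A :=
    (Matrix.ofLinearEquiv ℝ : (m → m → ℝ) ≃ₗ[ℝ] _).toLinearMap.toContinuousLinearMap.contDiff.comp
      (contDiff_pi.mpr fun i => contDiff_pi.mpr (hA i))
  have h2 : ContDiff ℝ ∞ fun z => NormedSpace.exp (A z) := contDiff_iff_contDiffAt.mpr fun z =>
    ((NormedSpace.exp_analytic (𝕂 := ℝ) _).contDiffAt).comp z h1.contDiffAt
  exact (Matrix.entryLinearMap ℝ ℝ i j).toContinuousLinearMap.contDiff.comp h2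

/-- Only the derivative of the exponential at 0, the identity, is needed: commutativity of the torus
reduces every other point to this one. -/
theorem hasFDerivAt_exp_entry {m : Type*} [Fintype m] [DecidableEq m] {z : ℂ}
    {A : ℂ → Matrix m m ℂ} (h0 : A z = 0) (hA : ∀ i j, DifferentiableAt ℝ (fun w => A w i j) z)
    (i j : m) :
    HasFDerivAt (fun w => NormedSpace.exp (A w) i j) (fderiv ℝ (fun w => A w i j) z) z := by
  open scoped Matrix.Norms.Operator in
  set L := (Matrix.ofLinearEquiv ℝ : (m → m → ℂ) ≃ₗ[ℝ] _).toLinearMap.toContinuousLinearMap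
  set D : ℂ →L[ℝ] (m → m → ℂ) := ContinuousLinearMap.pi fun i =>
    ContinuousLinearMap.pi fun j => fderiv ℝ (fun w => A w i j) z
  have h1 : HasFDerivAt A (L.comp D) z :=
    L.hasFDerivAt.comp z (hasFDerivAt_pi.mpr fun i => hasFDerivAt_pi.mpr fun j =>
      (hA i j).hasFDerivAt)
  have h2 : HasFDerivAt NormedSpace.exp (1 : Matrix m m ℂ →L[ℝ] Matrix m m ℂ) (A z) := by
    rw [h0]; exact hasFDerivAt_exp_zero
  exact (Matrix.entryLinearMap ℝ ℂ i j).toContinuousLinearMap.hasFDerivAt.comp z (h2.comp z h1)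

theorem dzMat_mul {A B : ℂ → CMat n} {z : ℂ}
    (hA : ∀ i j, DifferentiableAt ℝ (fun w => A w i j) z)
    (hB : ∀ i j, DifferentiableAt ℝ (fun w => B w i j) z) :
    dzMat (fun w => A w * B w) z = dzMat A z * B z + A z * dzMat B z := by
  ext i j
  simp only [dzMat, Matrix.mul_apply, Matrix.of_apply, Matrix.add_apply]
  rw [dz_sum _ fun k _ => (hA i k).fun_mul (hB k j), ← Finset.sum_add_distrib]
  exact Finset.sum_congr rfl fun k _ => dz_mul (hA i k) (hB k j)

theorem dzMat_torusMat {b : ℂ → Fin n → ℂ} {z : ℂ}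
    (hb : ∀ k, DifferentiableAt ℝ (fun w => b w k) z) :
    dzMat (fun w => torusMat n (b w)) z = torusMat n fun k => dz (fun w => b w k) z := by
  ext i j
  simp only [dzMat, Matrix.of_apply]
  rw [torusMat_apply]
  simp only [torusMat_apply (b _)]
  rw [dz_sum _ fun k _ => (hb k).mul_const _]
  exact Finset.sum_congr rfl fun k _ => by
    rw [dz_mul (hb k) (differentiableAt_const _), dz_const]; ring

theorem dzMat_exp_torusMat (hn : 1 ≤ n) {b : ℂ → Fin n → ℂ} {z : ℂ}
    (hb : ∀ k, DifferentiableAt ℝ (fun w => b w k) z) :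
    dzMat (fun w => NormedSpace.exp (torusMat n (b w))) z =
      NormedSpace.exp (torusMat n (b z)) * torusMat n fun k => dz (fun w => b w k) z := by
  have hd : ∀ k, DifferentiableAt ℝ (fun w => (b w - b z) k) z := fun k => (hb k).sub_const _
  have hA : ∀ i j, DifferentiableAt ℝ (fun w => torusMat n (b w - b z) i j) z := by
    intro i j
    simp only [torusMat_apply (_ - _)]
    exact DifferentiableAt.fun_sum fun k _ => (hd k).mul_const _
  have h0 : torusMat n (b z - b z) = 0 := by rw [sub_self]; simp [torusMat]
  have he := hasFDerivAt_exp_entry (A := fun w => torusMat n (b w - b z)) h0 hA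
  have e : (fun w => NormedSpace.exp (torusMat n (b w))) = fun w =>
      NormedSpace.exp (torusMat n (b z)) * NormedSpace.exp (torusMat n (b w - b z)) := by
    ext1 w
    rw [← exp_torusMat_add hn, add_sub_cancel]
  have e1 : dzMat (fun w => NormedSpace.exp (torusMat n (b w - b z))) z =
      torusMat n fun k => dz (fun w => b w k) z := by
    have e2 : dzMat (fun w => NormedSpace.exp (torusMat n (b w - b z))) z =
        dzMat (fun w => torusMat n (b w - b z)) z := by
      ext i j
      simp only [dzMat, Matrix.of_apply, dz, (he i j).fderiv]
    rw [e2, dzMat_torusMat hd]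
    congr 1
    ext k
    simp only [Pi.sub_apply, dz, fderiv_sub_const]
  rw [e, dzMat_mul (A := fun _ => NormedSpace.exp (torusMat n (b z)))
    (B := fun w => NormedSpace.exp (torusMat n (b w - b z))) (fun _ _ => differentiableAt_const _)
    fun i j => (he i j).differentiableAt, e1]
  have e3 : dzMat (fun _ => NormedSpace.exp (torusMat n (b z))) z = 0 := by
    ext i j; simp [dzMat, dz_const]
  rw [e3, Matrix.zero_mul, zero_add]

theorem smoothFrameOn_torusExp {b : ℂ → Fin n → ℝ} (hb : ContDiff ℝ ∞ b) :
    SmoothFrameOn Set.univ fun z => torusExp (b z) := by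
  refine fun i j => (contDiff_exp_entry (A := fun z => torusReal (b z)) (fun i j => ?_) i
    j).contDiffOn
  simp only [torusReal_apply]
  exact ContDiff.sum fun k _ => (contDiff_pi.mp hb k).mul contDiff_const

end TorusExponential

/-! ### Rotating a primitive frame by the torus. -/

section TodaGauge

variable {n : ℕ}

theorem SmoothFrameOn.mul {U : Set ℂ} {F G : ℂ → SOLorentz n} (hF : SmoothFrameOn U F)
    (hG : SmoothFrameOn U G) : SmoothFrameOn U fun z => F z * G z := by
  intro i j
  have e : (fun z => soMat (F z * G z) i j) =
      fun z => ∑ k, soMat (F z) i k * soMat (G z) k j := by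
    ext1 z
    rw [← Matrix.mul_apply]
    rfl
  rw [e]
  exact ContDiffOn.sum fun k _ => (hF i k).mul (hG k j)

/-- (Fe^b)⁻¹(Fe^b)_z = Ad_{exp(-b)} F⁻¹F_z + b_z, and Ad_{exp(-b)} fixes 𝔱^ℂ and scales the root
space of α_j by exp(-α_j(b)). -/
theorem logDz_mul_torusExp (hn : 1 ≤ n) {U : Set ℂ} {F : ℂ → SOLorentz n}
    (hF : SmoothFrameOn U F) (hU : IsOpen U) {z : ℂ} (hz : z ∈ U) {b : ℂ → Fin n → ℝ}
    (hb : ContDiff ℝ ∞ b) {a : Fin n → ℂ} {c : ℕ → ℂ}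
    (h : logDz F z = torusMat n a + rootSum n c) :
    logDz (fun w => F w * torusExp (b w)) z =
      torusMat n (fun k => a k + dz (fun w => (b w k : ℂ)) z) +
        rootSum n fun j => c j * Complex.exp (-rootVal (fun k => (b z k : ℂ)) j) := by
  have hT := smoothFrameOn_torusExp hb
  have hbk : ∀ k, DifferentiableAt ℝ (fun w => (b w k : ℂ)) z := fun k =>
    (ofRealCLM.contDiff.comp (contDiff_pi.mp hb k)).contDiffAt.diffAt
  set E := NormedSpace.exp (torusMat n fun k => (b z k : ℂ)) with hE
  have hinv : soCMat (torusExp (b z))⁻¹ * E = 1 := by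
    rw [hE, ← soCMat_torusExp]; exact soCMat_inv_mul _
  have e1 : rootSum n c * E =
      E * rootSum n fun j => c j * Complex.exp (-rootVal (fun k => (b z k : ℂ)) j) := by
    rw [exp_torusMat_mul_rootSum hn]
    simp only [mul_assoc, ← Complex.exp_add, neg_add_cancel, Complex.exp_zero, mul_one]
    rfl
  have e2 : torusMat n a * E = E * torusMat n a :=
    mul_exp_of_semiconjBy (commute_torusMat hn _ _)
  have e3 : dzMat (fun w => soCMat (F w * torusExp (b w))) z =
      dzMat (fun w => soCMat (F w)) z * E +
        soCMat (F z) * (E * torusMat n fun k => dz (fun w => (b w k : ℂ)) z) := by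
    simp only [soCMat_mul]
    rw [dzMat_mul (fun i j => (hF.contDiffAt_entry hU hz i j).diffAt)
      fun i j => (hT.contDiffAt_entry isOpen_univ (Set.mem_univ z) i j).diffAt]
    simp only [soCMat_torusExp]
    rw [dzMat_exp_torusMat hn hbk]
  have e4 : (fun k => a k + dz (fun w => (b w k : ℂ)) z) =
      a + fun k => dz (fun w => (b w k : ℂ)) z := rfl
  rw [logDz, e3, _root_.mul_inv_rev, soCMat_mul, Matrix.mul_assoc, Matrix.mul_add,
    ← Matrix.mul_assoc _ _ E,
    ← Matrix.mul_assoc (soCMat (F z)⁻¹) (soCMat (F z)), soCMat_inv_mul, Matrix.one_mul]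
  change _ * (logDz F z * E + _) = _
  rw [h, Matrix.add_mul, e1, e2, ← Matrix.mul_add, ← Matrix.mul_add, ← Matrix.mul_assoc, hinv,
    Matrix.one_mul, e4, torusMat_add]
  abel

theorem rootVal_add (a b : Fin n → ℂ) (j : ℕ) : rootVal (a + b) j = rootVal a j + rootVal b j := by
  have h : ∀ k, torusCoord (a + b) k = torusCoord a k + torusCoord b k := by
    intro k; unfold torusCoord; split_ifs <;> simp
  simp only [rootVal, h]
  split_ifs <;> ring

/-- A primitive frame whose root coefficients and torus part are those of `W`, up to a complex
gauge, can be rotated to a Toda frame. -/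
theorem isTodaFrame_mul_torusExp (hn : 1 ≤ n) {F : ℂ → SOLorentz n}
    (hF : SmoothFrameOn Set.univ F) {a : ℂ → Fin n → ℂ} {c : ℂ → ℕ → ℂ}
    (h : ∀ z, logDz F z = torusMat n (a z) + rootSum n (c z)) {g : ℂ → Fin n → ℂ}
    (hg : ContDiff ℝ ∞ g) {r : ℕ → ℂ}
    (hc : ∀ z, ∀ j ≤ n, c z j = r j * Complex.exp (rootVal (g z) j))
    (ha : ∀ z k, a z k = -dz (fun w => (starRingEnd ℂ) (g w k)) z) :
    IsTodaFrame (fun z => (F z : FlagManifold n)) (rootSum n r)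
      (fun z => F z * torusExp fun k => (g z k).re) := by
  have hre : ContDiff ℝ ∞ fun z k => (g z k).re :=
    contDiff_pi.mpr fun k => reCLM.contDiff.comp (contDiff_pi.mp hg k)
  have him : ContDiff ℝ ∞ fun z k => (g z k).im :=
    contDiff_pi.mpr fun k => imCLM.contDiff.comp (contDiff_pi.mp hg k)
  have dre : ∀ z k, DifferentiableAt ℝ (fun w => ((g w k).re : ℂ)) z := fun z k =>
    (ofRealCLM.contDiff.comp (contDiff_pi.mp hre k)).contDiffAt.diffAt
  have dim : ∀ z k, DifferentiableAt ℝ (fun w => I * ((g w k).im : ℂ)) z := fun z k =>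
    ((ofRealCLM.contDiff.comp (contDiff_pi.mp him k)).contDiffAt.diffAt).const_mul I
  refine ⟨hF.mul (smoothFrameOn_torusExp hre), fun z => ?_, fun z k => (g z k).im,
    fun z => torusMat n fun k => I * ((g z k).im : ℂ), him, fun _ => rfl, fun z => ?_⟩
  · rw [QuotientGroup.eq, _root_.mul_inv_rev, mul_assoc, inv_mul_cancel, mul_one]
    exact inv_mem (torusExp_mem hn _)
  · rw [logDz_mul_torusExp hn hF isOpen_univ (Set.mem_univ z) hre (h z), dzMat_torusMat (dim z),
      exp_torusMat_mul_rootSum hn, Matrix.mul_assoc, exp_torusMat_mul_exp_neg, Matrix.mul_one]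
    congr 1
    · congr 1
      ext k
      -- From ḡ = Re g - i Im g one gets -∂_z ḡ + ∂_z Re g = ∂_z(i Im g), the required Ω_z.
      have e : (fun w => (starRingEnd ℂ) (g w k)) =
          fun w => ((g w k).re : ℂ) + (-1) * (I * ((g w k).im : ℂ)) := by
        ext1 w
        refine Complex.ext ?_ ?_ <;> simp
      rw [ha, e, dz_add (dre z k) ((dim z k).const_mul _),
        dz_mul (differentiableAt_const _) (dim z k), dz_const]
      ring
    · refine Finset.sum_congr rfl fun j hj => congrArg (· • rootVec n j) ?_
      beta_reduce
      have e : g z = (fun k => ((g z k).re : ℂ)) + fun k => I * ((g z k).im : ℂ) := by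
        ext k
        rw [Pi.add_apply, mul_comm, re_add_im]
      rw [hc z j (by simpa [Nat.lt_succ_iff] using hj), mul_assoc, ← Complex.exp_add]
      rw [(congrArg (rootVal · j) e).trans (rootVal_add _ _ j), add_neg_cancel_comm]

end TodaGauge

/-! ### Smooth logarithms on the plane. -/

section SmoothLog

/-- A smooth nowhere vanishing function on the plane has a smooth logarithm. -/
theorem exists_contDiff_log {h : ℂ → ℂ} (hh : ContDiff ℝ ∞ h) (h0 : ∀ z, h z ≠ 0) :
    ∃ ℓ : ℂ → ℂ, ContDiff ℝ ∞ ℓ ∧ ∀ z, Complex.exp (ℓ z) = h z := by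
  have hs : IsSimplyConnected (Set.univ : Set ℂ) := by
    have := convex_univ.contractibleSpace (Set.univ_nonempty (α := ℂ))
    exact inferInstanceAs (SimplyConnectedSpace (Set.univ : Set ℂ))
  obtain ⟨ℓ, hc, he⟩ := Complex.exists_continuousOn_eqOn_exp_comp
    (U := (Set.univ : Set ℂ)) hs isOpen_univ hh.continuous.continuousOn
    (by rintro ⟨z, -, hz⟩; exact h0 z hz)
  have he : ∀ z, Complex.exp (ℓ z) = h z := fun z => he (Set.mem_univ z)
  have hc : Continuous ℓ := continuousOn_univ.mp hc
  refine ⟨ℓ, contDiff_iff_contDiffAt.mpr fun z => ?_, he⟩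
  have hz : h z / h z ∈ Complex.slitPlane := by
    rw [div_self (h0 z)]; exact Complex.one_mem_slitPlane
  -- Near z the imaginary part of ℓ(w) - ℓ(z) is small, so the principal logarithm of h(w)/h(z)
  -- recovers it; smoothness of the continuous logarithm follows.
  have e : ℓ =ᶠ[𝓝 z] fun w => ℓ z + Complex.log (h w / h z) := by
    have h1 : Tendsto (fun w => ((ℓ w - ℓ z).im)) (𝓝 z) (𝓝 0) := by
      have : Continuous fun w => (ℓ w - ℓ z).im := by fun_prop
      simpa using this.tendsto z
    filter_upwards [h1 (Ioo_mem_nhds (neg_lt_zero.mpr Real.pi_pos) Real.pi_pos)] with w hw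
    rw [← he w, ← he z, ← Complex.exp_sub, Complex.log_exp hw.1 hw.2.le, add_sub_cancel]
  refine ContDiffAt.congr_of_eventuallyEq ?_ e
  refine contDiffAt_const.add ?_
  have h3 : ContDiffAt ℝ ∞ Complex.log (h z / h z) :=
    (Complex.contDiffAt_log hz).restrict_scalars ℝ
  exact h3.comp z (contDiffAt_div hh.contDiffAt contDiffAt_const (h0 z))

end SmoothLog

/-! ### Solving for the complex gauge. -/

section TodaCoefficients

variable {n : ℕ}

theorem isCyclicCoeff_of_rootProduct_ne_zero {c : ℕ → ℂ} (h : rootProduct n c ≠ 0) :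
    IsCyclicCoeff n c := by
  intro j hj hc
  refine h ?_
  unfold rootProduct
  rcases Nat.eq_zero_or_pos j with rfl | h0
  · rw [hc, zero_mul, zero_mul]
  · rcases hj.eq_or_lt with rfl | hlt
    · rw [hc, mul_zero]
    · rw [Finset.prod_eq_zero (Finset.mem_Ico.mpr ⟨h0, hlt⟩) (by rw [hc]; ring)]
      ring

theorem rootProduct_ne_zero {c : ℕ → ℂ} (h : IsCyclicCoeff n c) : rootProduct n c ≠ 0 :=
  mul_ne_zero (mul_ne_zero (h 0 (Nat.zero_le n)) (Finset.prod_ne_zero_iff.mpr fun j hj =>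
    pow_ne_zero _ (h j (Finset.mem_Ico.mp hj).2.le))) (h n le_rfl)

/-- `α_0 + 2 α_1 + ⋯ + 2 α_{n-1} + α_n = 0`. -/
theorem rootVal_sum (hn : 1 ≤ n) (a : Fin n → ℂ) :
    rootVal a 0 + ∑ j ∈ Finset.Ico 1 n, 2 * rootVal a j + rootVal a n = 0 := by
  -- 2α_j = 2i a_j - 2i a_{j-1} telescopes, with a_0 = 0, to 2i a_{n-1}, which cancels α_0 + α_n.
  have e : ∀ j ∈ Finset.Ico 1 n, 2 * rootVal a j =
      (fun k => 2 * (I * torusCoord a (k - 1))) (j + 1) -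
        (fun k => 2 * (I * torusCoord a (k - 1))) j := by
    intro j hj
    obtain ⟨h1, h2⟩ := Finset.mem_Ico.mp hj
    have h0 : j ≠ 0 := by omega
    simp only [rootVal, h0, h2.ne, if_false, Nat.add_sub_cancel]
    ring
  have hn0 : n ≠ 0 := by omega
  rw [Finset.sum_congr rfl e,
    Finset.sum_Ico_sub (fun k => 2 * (I * torusCoord a (k - 1))) hn]
  simp only [rootVal, if_true, hn0, if_false, Nat.sub_self, torusCoord_zero]
  ring

/-- Root coefficients which agree up to a gauge for `α_1, …, α_n` and have the same product also
agree for `α_0`. -/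
theorem eq_mul_exp_rootVal_of_rootProduct_eq (hn : 1 ≤ n) {a : Fin n → ℂ} {c r : ℕ → ℂ}
    (hc : IsCyclicCoeff n c) (h : rootProduct n c = rootProduct n r)
    (hj : ∀ j ≤ n, 1 ≤ j → c j = r j * Complex.exp (rootVal a j)) :
    c 0 = r 0 * Complex.exp (rootVal a 0) := by
  have hE : Complex.exp (rootVal a 0) *
      (∏ j ∈ Finset.Ico 1 n, Complex.exp (rootVal a j) ^ 2) * Complex.exp (rootVal a n) = 1 := by
    rw [← Complex.exp_zero, ← rootVal_sum hn a, Complex.exp_add, Complex.exp_add, Complex.exp_sum]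
    congr 2
    exact Finset.prod_congr rfl fun j _ => by rw [← Complex.exp_nat_mul]; simp
  have hP : ∏ j ∈ Finset.Ico 1 n, c j ^ 2 = (∏ j ∈ Finset.Ico 1 n, r j ^ 2) *
      ∏ j ∈ Finset.Ico 1 n, Complex.exp (rootVal a j) ^ 2 := by
    rw [← Finset.prod_mul_distrib]
    refine Finset.prod_congr rfl fun j hj' => ?_
    obtain ⟨h1, h2⟩ := Finset.mem_Ico.mp hj'
    rw [hj j h2.le h1, mul_pow]
  have h0 := rootProduct_ne_zero hc
  unfold rootProduct at h h0
  refine mul_right_cancel₀ (mul_ne_zero (right_ne_zero_of_mul (left_ne_zero_of_mul h0))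
    (right_ne_zero_of_mul h0)) ?_
  rw [← mul_assoc, h, hP, hj n le_rfl hn]
  linear_combination -(r 0 * (∏ j ∈ Finset.Ico 1 n, r j ^ 2) * r n) * hE

/-- The factors by which the radii of the harmonic sequence are to be scaled. -/
noncomputable def radiusScale (r : ℕ → ℂ) : ℕ → ℂ
  | 0 => 1
  | k + 1 => pairNorm k * r (k + 1) * radiusScale r k

theorem radiusScale_ne_zero {r : ℕ → ℂ} (hr : IsCyclicCoeff n r) {k : ℕ} (hk : k ≤ n) :
    radiusScale r k ≠ 0 := by
  induction k with
  | zero => exact one_ne_zero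
  | succ k ih =>
    exact mul_ne_zero (mul_ne_zero (ofReal_ne_zero.mpr (pairNorm_pos k).ne') (hr _ hk))
      (ih (by omega))

/-- The complex gauge relating the base frame to a Toda frame. -/
noncomputable def todaGauge (s : ℕ → ℂ → CVec n) (r : ℕ → ℂ) (ℓ : ℂ → ℂ) (z : ℂ) (k : Fin n) : ℂ :=
  if k.val + 1 = n then ℓ z
  else -I * ((Real.log (radius s (k.val + 1) z) : ℂ) - Complex.log (radiusScale r (k.val + 1)))

namespace IsHarmonicSequenceOn

variable {f : ℂ → RVec n} {s : ℕ → ℂ → CVec n}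

/-- The gauge is built so that ρ_k = μ_k exp(i g_k), with ρ the radii and μ the scales. Any branch
of log μ_k will do. -/
theorem exp_todaGauge (hs : IsHarmonicSequenceOn Set.univ f s) (hS : ∀ z, f z ∈ deSitter n)
    {r : ℕ → ℂ} (hr : IsCyclicCoeff n r) (ℓ : ℂ → ℂ) (z : ℂ) {k : ℕ} (hk : k < n) :
    radiusScale r k * Complex.exp (I * torusCoord (todaGauge s r ℓ z) k) = radius s k z := by
  rcases Nat.eq_zero_or_pos k with rfl | h
  · rw [torusCoord_zero, hs.radius_zero hS]; simp [radiusScale]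
  · rw [torusCoord, dif_pos ⟨h, hk.le⟩, todaGauge]
    simp only [Nat.sub_add_cancel h]
    rw [if_neg hk.ne, ← mul_assoc]
    simp only [mul_neg, I_mul_I, neg_neg, one_mul]
    rw [Complex.exp_sub, Complex.exp_log (radiusScale_ne_zero hr hk.le), ← ofReal_exp,
      Real.exp_log (hs.radius_pos hk (Set.mem_univ z)),
      mul_div_cancel₀ _ (radiusScale_ne_zero hr hk.le)]

theorem contDiff_todaGauge (hs : IsHarmonicSequenceOn Set.univ f s) (r : ℕ → ℂ) {ℓ : ℂ → ℂ}
    (hℓ : ContDiff ℝ ∞ ℓ) : ContDiff ℝ ∞ (todaGauge s r ℓ) := by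
  refine contDiff_pi.mpr fun k => ?_
  unfold todaGauge
  split_ifs with h
  · exact hℓ
  · refine contDiff_const.mul (ContDiff.sub (ofRealCLM.contDiff.comp ?_) contDiff_const)
    refine contDiff_iff_contDiffAt.mpr fun z => ?_
    have hk : k.val + 1 < n := by have := k.isLt; omega
    exact (hs.contDiffAt_radius hk (Set.mem_univ z)).log (hs.radius_pos hk (Set.mem_univ z)).ne'

/-- For 1 ≤ j < n the coefficient is ρ_j / (`pairNorm (j - 1)` ρ_{j-1}); inserting ρ_j = μ_j exp(i
g_j), the recursion for μ_j leaves r_j exp(i g_j - i g_{j-1}). For j = n the null coefficient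
replaces the radius, and j = 0 is forced by the product. -/
theorem baseRoot_eq (hs : IsHarmonicSequenceOn Set.univ f s) (hn : 1 ≤ n)
    (hS : ∀ z, f z ∈ deSitter n) {r : ℕ → ℂ} (hr : IsCyclicCoeff n r) {ℓ : ℂ → ℂ}
    (hℓ : ∀ z, Complex.exp (ℓ z) * (2 * (radiusScale r n)) = nullCoeff hn s (-1) z)
    (hp : ∀ z, rootProduct n (baseRoot hn s z) = rootProduct n r) (z : ℂ) :
    ∀ j ≤ n, baseRoot hn s z j = r j * Complex.exp (rootVal (todaGauge s r ℓ z) j) := by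
  have key : ∀ j ≤ n, 1 ≤ j →
      baseRoot hn s z j = r j * Complex.exp (rootVal (todaGauge s r ℓ z) j) := by
    intro j hj h1
    have hj0 : j ≠ 0 := by omega
    have e1 := hs.exp_todaGauge hS hr ℓ z (k := j - 1) (by omega)
    have hμ := radiusScale_ne_zero hr (k := j - 1) (by omega)
    have hp0 : (pairNorm (j - 1) : ℂ) ≠ 0 := ofReal_ne_zero.mpr (pairNorm_pos _).ne'
    have hstep : radiusScale r j = pairNorm (j - 1) * r j * radiusScale r (j - 1) := by
      conv_lhs => rw [← Nat.sub_add_cancel h1]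
      rw [radiusScale, Nat.sub_add_cancel h1]
    have hx := Complex.exp_ne_zero (I * torusCoord (todaGauge s r ℓ z) (j - 1))
    rw [baseRoot, rootVal, if_neg hj0, if_neg hj0, if_neg hj0]
    by_cases hjn : j = n
    · subst hjn
      have et : torusCoord (todaGauge s r ℓ z) j = ℓ z := by
        rw [torusCoord, dif_pos ⟨hn, le_rfl⟩, todaGauge]
        simp only [Nat.sub_add_cancel hn, if_true]
      rw [if_pos rfl, if_pos rfl, Complex.exp_sub, et, ← hℓ, ← e1, hstep]
      field_simp
    · rw [if_neg hjn, if_neg hjn, Complex.exp_sub,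
        ← hs.exp_todaGauge hS hr ℓ z (k := j) (by omega), ← e1, hstep]
      field_simp
  intro j hj
  rcases Nat.eq_zero_or_pos j with rfl | h1
  · refine eq_mul_exp_rootVal_of_rootProduct_eq hn ?_ (hp z) key
    exact isCyclicCoeff_of_rootProduct_ne_zero (by rw [hp]; exact rootProduct_ne_zero hr)
  · exact key j hj h1

/-- In a rotation block g_k is -i log ρ_k plus a constant, and the claim is the logarithmic
derivative of ρ_k. In the last block exp(ℓ) is a constant multiple of the null coefficient, whose
∂_z̄-equation gives ∂_z̄ ℓ, and conjugation turns it into ∂_z of the conjugate of ℓ. -/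
theorem baseTorus_eq (hs : IsHarmonicSequenceOn Set.univ f s) (hn : 1 ≤ n)
    (hS : ∀ z, f z ∈ deSitter n) {r : ℕ → ℂ} {ℓ : ℂ → ℂ} (hsm : ContDiff ℝ ∞ ℓ)
    (hℓ : ∀ z, Complex.exp (ℓ z) * (2 * (radiusScale r n)) = nullCoeff hn s (-1) z)
    (h0 : ∀ z, nullCoeff hn s (-1) z ≠ 0) (z : ℂ) (k : Fin n) :
    baseTorus hn s z k = -_root_.dz (fun w => (starRingEnd ℂ) (todaGauge s r ℓ w k)) z := by
  by_cases hk : k.val + 1 = n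
  · have hd := hsm.contDiffAt.diffAt (z := z)
    have e1 : (fun w => (starRingEnd ℂ) (todaGauge s r ℓ w k)) = fun w => (starRingEnd ℂ) (ℓ w) :=
      by
      ext1 w; rw [todaGauge, if_pos hk]
    have e2 := hs.dzbar_nullCoeff hn hS (Set.mem_univ z)
    have e3 : nullCoeff hn s (-1) = fun w => Complex.exp (ℓ w) * (2 * radiusScale r n) :=
      funext fun w => (hℓ w).symm
    have e4 : _root_.dzbar (nullCoeff hn s (-1)) z =
        _root_.dzbar ℓ z * nullCoeff hn s (-1) z := by
      rw [← hℓ, e3, dzbar_mul hd.cexp (differentiableAt_const _), dzbar_const, dzbar_exp hd]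
      ring
    have e5 := mul_right_cancel₀ (h0 z) (e4.symm.trans e2)
    have e6 : torusCoord (baseTorus hn s z) n = baseTorus hn s z k := by
      rw [torusCoord, dif_pos ⟨hn, le_rfl⟩]
      congr 1
      exact Fin.ext (by simp only; omega)
    rw [e1, dz_conj hd, e5, e6, map_neg, conj_conj, neg_neg]
  · have hk' : k.val + 1 < n := by have := k.isLt; omega
    have hρ := hs.radius_pos hk' (Set.mem_univ z)
    have hlog : DifferentiableAt ℝ (fun w => (Real.log (radius s (k.val + 1) w) : ℂ)) z :=
      ContDiffAt.diffAt (ofRealCLM.contDiff.contDiffAt.comp z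
        ((hs.contDiffAt_radius hk' (Set.mem_univ z)).log hρ.ne'))
    have e1 : (fun w => (starRingEnd ℂ) (todaGauge s r ℓ w k)) = fun w =>
        I * (Real.log (radius s (k.val + 1) w) : ℂ) +
          -(I * (starRingEnd ℂ) (Complex.log (radiusScale r (k.val + 1)))) := by
      ext1 w
      rw [todaGauge, if_neg hk]
      simp only [map_mul, map_sub, map_neg, conj_I, conj_ofReal, neg_neg]
      ring
    have e2 : (fun w => (radius s (k.val + 1) w : ℂ)) = fun w =>
        Complex.exp (Real.log (radius s (k.val + 1) w) : ℂ) := by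
      ext1 w
      rw [← ofReal_exp, Real.exp_log (hs.radius_pos hk' (Set.mem_univ w))]
    have e3 := congrArg (fun g => _root_.dz g z) e2
    rw [dz_exp hlog, ← ofReal_exp, Real.exp_log hρ] at e3
    rw [e1, dz_add (hlog.const_mul I) (differentiableAt_const _), dz_const,
      dz_mul (differentiableAt_const _) hlog, dz_const, baseTorus, if_neg hk, e3,
      mul_div_cancel_left₀ _ (ofReal_ne_zero.mpr hρ.ne')]
    ring

/-- If the harmonic sequence has no zeros on the plane, the class of the base frame has a Toda
frame for each cyclic element with the right product of root coefficients. -/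
theorem exists_isTodaFrame (hs : IsHarmonicSequenceOn Set.univ f s) (hn : 1 ≤ n)
    (hS : ∀ z, f z ∈ deSitter n) {r : ℕ → ℂ} (hr : IsCyclicCoeff n r)
    (hp : ∀ z, rootProduct n (baseRoot hn s z) = rootProduct n r) :
    ∃ F, IsTodaFrame (fun z => (baseFrame hn s z : FlagManifold n)) (rootSum n r) F := by
  have hn0 : n ≠ 0 := by omega
  have h0 : ∀ z, nullCoeff hn s (-1) z ≠ 0 := by
    intro z h
    have := isCyclicCoeff_of_rootProduct_ne_zero
      (show rootProduct n (baseRoot hn s z) ≠ 0 by rw [hp]; exact rootProduct_ne_zero hr) n le_rfl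
    rw [baseRoot, if_neg hn0, if_pos rfl, h, zero_div] at this
    exact this rfl
  have hμ : 2 * radiusScale r n ≠ 0 := mul_ne_zero two_ne_zero (radiusScale_ne_zero hr le_rfl)
  obtain ⟨ℓ, hsm, hℓ⟩ := exists_contDiff_log
    (h := fun z => nullCoeff hn s (-1) z / (2 * radiusScale r n))
    (contDiff_iff_contDiffAt.mpr fun z => contDiffAt_div
      (hs.contDiffAt_nullCoeff hn hS (-1) (Set.mem_univ z)) contDiffAt_const hμ)
    fun z => div_ne_zero (h0 z) hμ
  have hℓ' : ∀ z, Complex.exp (ℓ z) * (2 * radiusScale r n) = nullCoeff hn s (-1) z := fun z => by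
    rw [hℓ, div_mul_cancel₀ _ hμ]
  exact ⟨_, isTodaFrame_mul_torusExp hn (hs.smoothFrameOn hn hS)
    (fun z => hs.logDz_baseFrame hn hS (Set.mem_univ z)) (hs.contDiff_todaGauge r hsm)
    (hs.baseRoot_eq hn hS hr hℓ' hp) (hs.baseTorus_eq hn hS hsm hℓ' h0)⟩

end IsHarmonicSequenceOn

end TodaCoefficients

/-! ### The lift, its periods, and absence of zeros. -/

section Lift

variable {n : ℕ} {f : ℂ → RVec n} {s : ℕ → ℂ → CVec n}

theorem IsHarmonicSequenceOn.isSmoothFlagMap (hs : IsHarmonicSequenceOn Set.univ f s) (hn : 1 ≤ n)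
    (hS : ∀ z, f z ∈ deSitter n) :
    IsSmoothFlagMap fun z => (baseFrame hn s z : FlagManifold n) := fun _ =>
  ⟨Set.univ, isOpen_univ, Set.mem_univ _, baseFrame hn s, hs.smoothFrameOn hn hS, fun _ _ => rfl⟩

theorem soMat_mulVec_of_mem_cartanT {t : SOLorentz n} (ht : t ∈ cartanT n) :
    soMat t *ᵥ Pi.single 0 1 = Pi.single 0 1 := by
  ext i
  have h := congrFun ht.1 i
  rw [mulVec_single_one] at h ⊢
  simp only [col_apply, soCMat, Matrix.map_apply, Pi.single_apply] at h ⊢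
  split_ifs at h ⊢ <;> exact_mod_cast h

theorem IsHarmonicSequenceOn.isLiftOf (hs : IsHarmonicSequenceOn Set.univ f s) (hn : 1 ≤ n)
    (hS : ∀ z, f z ∈ deSitter n) :
    IsLiftOf (fun z => (baseFrame hn s z : FlagManifold n)) f := by
  intro z g hg
  have ht := QuotientGroup.eq.mp hg.symm
  have e : soMat g = soMat (baseFrame hn s z) * soMat ((baseFrame hn s z)⁻¹ * g) := by
    conv_lhs => rw [← mul_inv_cancel_left (baseFrame hn s z) g]
    rfl
  rw [e, ← mulVec_mulVec, soMat_mulVec_of_mem_cartanT ht, hs.frame_first hn hS (Set.mem_univ z)]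

/-- Without zeros, each entry is determined by the preceding one through a translation invariant
formula. -/
theorem IsHarmonicSequence.periodic (hs : IsHarmonicSequence f s)
    (hne : ∀ j < n, ∀ z, hermSq (s j z) ≠ 0) {l : ℂ} (hp : ∀ z, f (z + l) = f z) {j : ℕ} :
    j ≤ n → ∀ z, s j (z + l) = s j z := by
  induction j with
  | zero => intro _ z; rw [hs.1]; ext i; simp [complexify, hp z]
  | succ j ih =>
    intro hj z
    have ih := ih (by omega)
    have d : dzVec (s j) (z + l) = dzVec (s j) z := by
      rw [← dzVec_translate]; exact dzVec_congr (Filter.Eventually.of_forall ih)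
    rw [(hs.2 j hj z).2 (hne j hj z), (hs.2 j hj (z + l)).2 (hne j hj _), d, ih]

/-- The recursion says nothing beyond index n. Setting those entries to zero makes the whole
sequence, on which the base frame formally depends, periodic. -/
theorem IsHarmonicSequence.truncate (hs : IsHarmonicSequence f s) :
    IsHarmonicSequence f fun k => if k ≤ n then s k else 0 := by
  refine ⟨(if_pos (Nat.zero_le n)).trans hs.1, fun j hj z => ?_⟩
  beta_reduce
  rw [if_pos hj.le, if_pos (show j + 1 ≤ n from hj)]
  exact hs.2 j hj z

/-- If the root coefficient product is constant, `⟨∂_z^n f, ∂_z^n f⟩` has no zeros. -/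
theorem bil_iterate_ne_zero_of_rootProductConstant (hn : 1 ≤ n) (hharm : IsHarmonicMap f)
    (hsuper : IsSuperconformal f) (hs : IsHarmonicSequence f s) {K : ℂ}
    (hK : RootProductConstant f K) (z : ℂ) :
    bil (dzVec^[n] (complexify f) z) (dzVec^[n] (complexify f) z) ≠ 0 := by
  set H : ℂ → ℂ := fun z => bil (dzVec^[n] (complexify f) z) (dzVec^[n] (complexify f) z) with hH
  have hS := hharm.mem_deSitter
  have hc : Continuous H := continuous_iff_continuousAt.mpr fun z =>
    (contDiffAt_bil (contDiffAt_iterate hharm.smooth n z)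
      (contDiffAt_iterate hharm.smooth n z)).continuousAt
  have hiso := isotropy_of_superconformal hn hsuper
  have hV : IsOpen {z | H z ≠ 0} := isOpen_compl_singleton.preimage hc
  have hon := hs.on hn hharm hiso hV fun z hz => hz
  obtain ⟨z₀, hz₀⟩ : ∃ z, H z ≠ 0 := by
    obtain ⟨z, hz⟩ := hsuper.2
    rw [Nat.sub_add_cancel hn] at hz
    exact ⟨z, hz⟩
  have hlog := fun z hz => hon.logDz_baseFrame hn hS (z := z) hz
  have hprod : ∀ z ∈ {z | H z ≠ 0}, H z = 4 ^ n * rootProduct n (baseRoot hn s z) := fun z hz =>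
    bil_iterate_eq_rootProduct hn hharm.smooth hS
      (fun b h1 h2 z => hiso b 0 (by omega) (by omega) z) hV (hon.smoothFrameOn hn hS)
      (fun z hz => hon.frame_first hn hS hz) hlog hz
  have hne : ∀ z ∈ {z | H z ≠ 0}, rootProduct n (baseRoot hn s z) ≠ 0 := fun z hz h =>
    hz (by rw [hprod z hz, h, mul_zero])
  have hF : IsCyclicPrimitiveFrame {z | H z ≠ 0} f (baseFrame hn s) (baseRoot hn s) :=
    ⟨hV, hon.smoothFrameOn hn hS, fun z hz => hon.frame_first hn hS hz,
      fun z hz => ⟨_, hlog z hz⟩, z₀, hz₀, isCyclicCoeff_of_rootProduct_ne_zero (hne z₀ hz₀)⟩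
  have hval : ∀ z, H z ≠ 0 → H z = 4 ^ n * K := fun z hz => by
    rw [hprod z hz, hK _ _ _ hF z hz]
  have hK0 : (4 : ℂ) ^ n * K ≠ 0 := hval z₀ hz₀ ▸ hz₀
  -- On this open set H takes the single value 4^n K ≠ 0, so the set is also the preimage of a
  -- point.
  have hcl : IsClosed {z | H z ≠ 0} := by
    have : {z | H z ≠ 0} = H ⁻¹' {4 ^ n * K} :=
      Set.ext fun z => ⟨fun h => hval z h, fun h => by
        rw [Set.mem_preimage, Set.mem_singleton_iff] at h
        change H z ≠ 0
        rw [h]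
        exact hK0⟩
    rw [this]
    exact isClosed_singleton.preimage hc
  have huniv := IsClopen.eq_univ ⟨hcl, hV⟩ ⟨z₀, hz₀⟩
  exact (Set.ext_iff.mp huniv z).mpr (Set.mem_univ z)

end Lift

/-! ### The main theorem. -/

theorem mainTheorem4 (n : ℕ) (hn : 1 ≤ n) (f : ℂ → RVec n)
    (hharm : IsHarmonicMap f) (hsuper : IsSuperconformal f)
    (hseq : HarmonicSequenceEverywhereDefined f) :
    (∀ K : ℂ, RootProductConstant f K →
      ∃ ψ : ℂ → FlagManifold n, IsSmoothFlagMap ψ ∧ IsLiftOf ψ f ∧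
        (∀ r : ℕ → ℂ, IsCyclicCoeff n r → rootProduct n r = K →
          ∃ F : ℂ → SOLorentz n, IsTodaFrame ψ (rootSum n r) F) ∧
        (∀ (Λ : Submodule ℤ ℂ) [DiscreteTopology Λ] [IsZLattice ℝ Λ],
          LatticePeriodic Λ f → LatticePeriodic Λ ψ)) ∧
    (∀ (Λ : Submodule ℤ ℂ) [DiscreteTopology Λ] [IsZLattice ℝ Λ],
      LatticePeriodic Λ f → ∃ K : ℂ, RootProductConstant f K) := by
  refine ⟨fun K hK => ?_, fun Λ _ _ hp =>
    exists_rootProductConstant_of_periodic hn hharm hsuper Λ hp⟩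
  have hS := hharm.mem_deSitter
  obtain ⟨t, ht0, ht⟩ := hseq
  have hs := IsHarmonicSequence.truncate ⟨ht0, fun j hj => (ht j hj).2⟩
  set s : ℕ → ℂ → CVec n := fun k => if k ≤ n then t k else 0 with hsdef
  have hH := bil_iterate_ne_zero_of_rootProductConstant hn hharm hsuper hs hK
  have hon := hs.on hn hharm (isotropy_of_superconformal hn hsuper) isOpen_univ fun z _ => hH z
  have hlog := fun z => hon.logDz_baseFrame hn hS (Set.mem_univ z)
  have hfirst := fun z (_ : z ∈ Set.univ) => hon.frame_first hn hS (Set.mem_univ z)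
  have hprod : ∀ z, rootProduct n (baseRoot hn s z) ≠ 0 := fun z h => hH z (by
    rw [bil_iterate_eq_rootProduct hn hharm.smooth hS
      (fun b h1 h2 z => isotropy_of_superconformal hn hsuper b 0 (by omega) (by omega) z)
      isOpen_univ (hon.smoothFrameOn hn hS) hfirst (fun z _ => hlog z) (Set.mem_univ z), h,
      mul_zero])
  -- Now that H has no zeros the base frame is global and cyclic at every point; 0 is an arbitrary
  -- choice.
  have hF : IsCyclicPrimitiveFrame Set.univ f (baseFrame hn s) (baseRoot hn s) :=
    ⟨isOpen_univ, hon.smoothFrameOn hn hS, hfirst, fun z _ => ⟨_, hlog z⟩, 0, Set.mem_univ 0,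
      isCyclicCoeff_of_rootProduct_ne_zero (hprod 0)⟩
  refine ⟨fun z => (baseFrame hn s z : FlagManifold n), hon.isSmoothFlagMap hn hS,
    hon.isLiftOf hn hS, fun r hr hrK => ?_, fun Λ _ _ hp l hl z => ?_⟩
  · exact hon.exists_isTodaFrame hn hS hr fun z => (hK _ _ _ hF z (Set.mem_univ z)).trans hrK.symm
  · have hsp : ∀ k, s k (z + l) = s k z := by
      intro k
      by_cases hk : k ≤ n
      · exact hs.periodic (fun j hj z => hon.hermSq_ne hj (Set.mem_univ z)) (hp l hl) hk z
      · simp only [hsdef, if_neg hk, Pi.zero_apply]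
    have e : unitSeq s (z + l) = unitSeq s z := by
      ext1 k
      rw [unitSeq, unitSeq, radius, radius, hsp]
    simp only [baseFrame, e]
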